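/- **Setting.** Fix a coherence time $T\ge 1$ and a finite directed acyclic graph on a node set $V$, with a source $s$ and a destination $d$. In each block of $T$ symbol times node $i$ sends $X_i\in\mathbb C^T$ and receives $$Y_i=\sum_{j\to i} g_{ji}X_j+W_i ,$$ where the sum is over the nodes $j$ with a link to $i$. The fading coefficients $g_{ji}\in\mathbb C$ are constant during a block, all fading coefficients and noise samples are independent (across links, nodes, symbol times and blocks), the entries of $W_i$ are $\mathcal{CN}(0,1)$, and $g_{ji}$ has a given law with finite second moment, depending on the link (for example $\mathcal{CN}(0,\rho_{ji}^2)$). The realizations of the fading are known to no node. A code over $n$ blocks consists of a message set $\{1,\dots,M\}$, for each node and symbol time a measurable function giving the transmitted symbol in terms of the symbols which that node received at strictly earlier times (in the same or in previous blocks) and, at $s$ only, of the message, and a measurable decoder at $d$ acting on all that $d$ receives. The message is uniform. Each node has average power at most $1$ per symbol, averaged over the message, the fading, the noise and the $nT$ symbol times. A rate $R$ (bits per symbol time) is achievable if for every $\varepsilon>0$ and all sufficiently large $n$ there is such a code with $M\ge 2^{nTR}$ and average error probability at most $\varepsilon$. Differential entropies are in bits: $h(Y\mid Z)=-\mathbb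 E\log_2 f(Y\mid Z)$, where $f(\cdot\mid Z)$ is the conditional Lebesgue density of $Y$ given $Z$. **Claim.** Let $R$ be achievable. Then there is a joint law of $(X_i)_i,(g_{ji}),(W_i)_i$ for one block, with corresponding $Y_i=\sum_{j\to i}g_{ji}X_j+W_i$ induced by the channel, such that * the fading and the noise have the law described above, and $\mathbb E\|X_i\|^2\le T$ for all $i$; * (causality in time) for each $t$, $(X_i[t])_i$ is conditionally independent of all the fading and noise of the block, given $(X_i[u],Y_i[u])_{i\in V,\,u<t}$; * (causality along the network) for each $i$, $\bigl((g_{ji})_j,W_i\bigr)$ is independent of $(X_k,Y_k)_{k}$, where $k$ runs over the nodes that cannot be reached from $i$ by a directed path (of length $\ge 0$); and such that the following holds for every set $\Omega\subset V$ with $s\in\Omega$, $d\notin\Omega$. Let $L=|\Omega^c|$ and let $(1),\dots,(L)$ be any enumeration of $\Omega^c$ in which each link between two nodes of $\Omega^c$ goes from a smaller to a larger number. Let $X_{\mathrm{in}(i)}$ be the family of the signals $X_j$ with $j\to(i)$, and $X_{\mathrm{in}(i)}\cap X_{\Omega^c}$ its subfamily with $j\in\Omega^c$. Then $$TR\le\sum_{i=1}^{L}\Bigl[h\bigl(Y_{(i)}\mid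 Y_{(1)},\dots,Y_{(i-1)},\,X_{\mathrm{in}(i)}\cap X_{\Omega^c}\bigr)-h\bigl(Y_{(i)}\mid X_{\mathrm{in}(i)}\bigr)\Bigr]$$ and $$TR\le\sum_{i=1}^{L}\Bigl[h\bigl(Y_{(i)}\mid Y_{(1)},\dots,Y_{(i-1)},\,X_{(1)},\dots,X_{(i-1)}\bigr)-h\bigl(Y_{(i)}\mid X_{\mathrm{in}(i)}\bigr)\Bigr],$$ where all the conditional densities exist and all the entropies are finite. (For $T=1$ the causality in time says that the $X_i$ are independent of the fading and the noise.) -/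

import Mathlib

open MeasureTheory ProbabilityTheory Filter
open scoped ENNReal NNReal

/-- The circularly symmetric complex Gaussian law `CN(0,1)`: independent real and imaginary parts,
each of variance `1/2`. -/
noncomputable def stdComplexGaussian : Measure ℂ :=
  ((gaussianReal 0 (1 / 2)).prod (gaussianReal 0 (1 / 2))).map
    fun p : ℝ × ℝ => (⟨p.1, p.2⟩ : ℂ)

/-- An acyclic network with node set `V`. `graph.Adj j i` says that there is a link from `j` to `i`;
`fading j i` is the law of the fading coefficient of that link (entries of non-links are not
used by the channel). -/
structure FadingNetwork (V : Type*) where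
  graph : Digraph V
  acyclic : ∀ v, ¬ Relation.TransGen graph.Adj v v
  fading : V → V → Measure ℂ
  isProbabilityMeasure_fading : ∀ j i, IsProbabilityMeasure (fading j i)
  secondMoment_fading : ∀ j i, graph.Adj j i → ∫⁻ z, ‖z‖ₑ ^ 2 ∂(fading j i) < ∞

namespace FadingNetwork

variable {V : Type*} [Fintype V] {T : ℕ}

/-- Law of the fading coefficients and of the noise in one coherence block: all fading coefficients
and all noise samples are independent, and the noise samples are `CN(0,1)`. The coefficient of the
link from `j` to `i` is constant during the block. -/
noncomputable def blockLaw (N : FadingNetwork V) (T : ℕ) :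
    Measure ((V → V → ℂ) × (V → Fin T → ℂ)) :=
  (Measure.pi fun j => Measure.pi fun i => N.fading j i).prod
    (Measure.pi fun _ => Measure.pi fun _ => stdComplexGaussian)

open scoped Classical in
/-- The channel at one symbol time: the node `i` receives `∑_{j → i} g j i * x j + w i`. -/
noncomputable def channel (N : FadingNetwork V) (g : V → V → ℂ) (x w : V → ℂ) (i : V) : ℂ :=
  (∑ j, if N.graph.Adj j i then g j i * x j else 0) + w i

end FadingNetwork

/-- The symbol time `(l', t')` (block `l'`, position `t'`) is strictly earlier than `(l, t)`. -/
def SymbolBefore {n T : ℕ} (l' : Fin n) (t' : Fin T) (l : Fin n) (t : Fin T) : Prop :=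
  l' < l ∨ (l' = l ∧ t' < t)

/-- A code over `n` coherence blocks of length `T`, with message set `Fin M` at the source `s`.
The symbol sent by a node at some time is a function of what the node has received at strictly
earlier times and, at the source, of the message. `enc v m y l t` is the symbol sent by `v` at
position `t` of block `l` if `v` receives `y`. -/
structure NetworkCode (V : Type*) (s : V) (T n : ℕ) where
  M : ℕ
  M_pos : 0 < M
  enc : V → Fin M → (Fin n → Fin T → ℂ) → Fin n → Fin T → ℂ
  measurable_enc : ∀ v m, Measurable (enc v m)
  causal_enc : ∀ v m y y' l t,
    (∀ l' t', SymbolBefore l' t' l t → y l' t' = y' l' t') → enc v m y l t = enc v m y' l t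
  enc_relay : ∀ v, v ≠ s → ∀ m m', enc v m = enc v m'
  dec : (Fin n → Fin T → ℂ) → Fin M
  measurable_dec : Measurable dec

namespace NetworkCode

variable {V : Type*} [Fintype V] {s : V} {T n : ℕ}

/-- Apply the encoders and the channel to tentative received signals `y`. -/
noncomputable def step (C : NetworkCode V s T n) (N : FadingNetwork V) (m : Fin C.M)
    (ω : Fin n → (V → V → ℂ) × (V → Fin T → ℂ)) (y : V → Fin n → Fin T → ℂ) :
    V → Fin n → Fin T → ℂ :=
  fun v l t => N.channel (ω l).1 (fun j => C.enc j m (y j) l t) (fun j => (ω l).2 j t) v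

/-- The signals received by all nodes, for the message `m` and the fading and noise realization `ω`.
By causality each application of `step` settles one more symbol time; `received_eq_step` below
shows that after `n * T` applications the channel equation holds at all times. -/
noncomputable def received (C : NetworkCode V s T n) (N : FadingNetwork V) (m : Fin C.M)
    (ω : Fin n → (V → V → ℂ) × (V → Fin T → ℂ)) : V → Fin n → Fin T → ℂ :=
  (C.step N m ω)^[n * T] 0

/-- The signals sent by all nodes. -/
noncomputable def sent (C : NetworkCode V s T n) (N : FadingNetwork V) (m : Fin C.M)
    (ω : Fin n → (V → V → ℂ) × (V → Fin T → ℂ)) : V → Fin n → Fin T → ℂ :=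
  fun v => C.enc v m (C.received N m ω v)

theorem iterate_step_settled (C : NetworkCode V s T n) (N : FadingNetwork V) (m : Fin C.M)
    (ω : Fin n → (V → V → ℂ) × (V → Fin T → ℂ)) (k : ℕ) :
    ∀ (v : V) (l : Fin n) (t : Fin T), (l : ℕ) * T + t < k →
      (C.step N m ω)^[k + 1] 0 v l t = (C.step N m ω)^[k] 0 v l t := by
  induction k with
  | zero => intro v l t h; omega
  | succ k ih =>
    intro v l t h
    rw [Function.iterate_succ_apply']
    conv_rhs => rw [Function.iterate_succ_apply']
    suffices hx : (fun j => C.enc j m ((C.step N m ω)^[k + 1] 0 j) l t) =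
        fun j => C.enc j m ((C.step N m ω)^[k] 0 j) l t by
      change N.channel _ (fun j => C.enc j m ((C.step N m ω)^[k + 1] 0 j) l t) _ v =
        N.channel _ (fun j => C.enc j m ((C.step N m ω)^[k] 0 j) l t) _ v
      rw [hx]
    funext j
    apply C.causal_enc
    intro l' t' hb
    apply ih
    rcases hb with hb | ⟨rfl, hb⟩
    · have h1 : ((l' : ℕ) + 1) * T ≤ (l : ℕ) * T := Nat.mul_le_mul_right _ hb
      have h2 := t'.isLt
      rw [Nat.add_mul] at h1
      omega
    · have : (t' : ℕ) < t := hb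
      omega

/-- The received signals satisfy `Y = G X + W` at all nodes and times. -/
theorem received_eq_step (C : NetworkCode V s T n) (N : FadingNetwork V) (m : Fin C.M)
    (ω : Fin n → (V → V → ℂ) × (V → Fin T → ℂ)) (v : V) (l : Fin n) (t : Fin T) :
    C.received N m ω v l t =
      N.channel (ω l).1 (fun j => C.sent N m ω j l t) (fun j => (ω l).2 j t) v := by
  have h : (l : ℕ) * T + t < n * T := by
    have h1 : ((l : ℕ) + 1) * T ≤ n * T := Nat.mul_le_mul_right _ l.isLt
    have h2 := t.isLt
    rw [Nat.add_mul] at h1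
    omega
  have := C.iterate_step_settled N m ω (n * T) v l t h
  rw [Function.iterate_succ_apply'] at this
  exact this.symm

/-- Average error probability at the destination `d`, for a uniform message; the fading and the
noise are independent from block to block. -/
noncomputable def errorProb (C : NetworkCode V s T n) (N : FadingNetwork V) (d : V) : ℝ :=
  (∑ m, (Measure.pi fun _ : Fin n => N.blockLaw T).real
    {ω | C.dec (C.received N m ω d) ≠ m}) / C.M

/-- Every node has average transmit power at most one per symbol, the average being over the
uniform message, the fading, the noise and the `n * T` symbol times. -/
def PowerConstraint (C : NetworkCode V s T n) (N : FadingNetwork V) : Prop :=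
  ∀ v, ∑ m, ∑ l, ∑ t,
      ∫⁻ ω, ‖C.sent N m ω v l t‖ₑ ^ 2 ∂(Measure.pi fun _ : Fin n => N.blockLaw T)
    ≤ (C.M : ℝ≥0∞) * n * T

end NetworkCode

/-- The rate `R`, in bits per symbol time, is achievable from `s` to `d`: for all large `n` there
are codes over `n` blocks with at least `2 ^ (n T R)` messages and arbitrarily small error. -/
def FadingNetwork.Achievable {V : Type*} [Fintype V] (N : FadingNetwork V) (s d : V) (T : ℕ)
    (R : ℝ) : Prop :=
  ∀ ε : ℝ, 0 < ε → ∀ᶠ n : ℕ in atTop, ∃ C : NetworkCode V s T n,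
    (2 : ℝ) ^ ((n : ℝ) * T * R) ≤ C.M ∧ C.PowerConstraint N ∧ C.errorProb N d ≤ ε

section Entropy

variable {Ω E F : Type*} [MeasurableSpace Ω] [MeasureSpace E] [MeasurableSpace F]

/-- Conditional differential entropy `h(Y | Z) = - E log₂ f(Y | Z)`, in bits, where the conditional
density `f` of `Y` given `Z` is the density of the law of `(Z, Y)` with respect to the product of
the law of `Z` and Lebesgue measure. -/
noncomputable def condDiffEntropy (P : Measure Ω) (Y : Ω → E) (Z : Ω → F) : ℝ :=
  -(∫ p, llr (P.map fun ω => (Z ω, Y ω)) ((P.map Z).prod volume) p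
      ∂(P.map fun ω => (Z ω, Y ω))) / Real.log 2

/-- The conditional density exists and `h(Y | Z)` is a convergent integral. -/
def HasFiniteCondDiffEntropy (P : Measure Ω) (Y : Ω → E) (Z : Ω → F) : Prop :=
  (P.map fun ω => (Z ω, Y ω)) ≪ (P.map Z).prod volume ∧
    Integrable (llr (P.map fun ω => (Z ω, Y ω)) ((P.map Z).prod volume))
      (P.map fun ω => (Z ω, Y ω))

end Entropy

/-- Sample space for one coherence block: transmitted signals `X`, fading coefficients `G` and
noise `W`. -/
abbrev BlockSpace (V : Type*) (T : ℕ) : Type _ :=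
  (V → Fin T → ℂ) × (V → V → ℂ) × (V → Fin T → ℂ)

namespace BlockSpace

variable {V : Type*} [Fintype V] {T : ℕ}

/-- The signals `(X_v)_{v ∈ S}`. -/
def X (S : Set V) (ω : BlockSpace V T) (v : S) : Fin T → ℂ := ω.1 v

/-- The signal received by the node `v`. -/
noncomputable def recv (N : FadingNetwork V) (v : V) (ω : BlockSpace V T) : Fin T → ℂ :=
  fun t => N.channel ω.2.1 (fun j => ω.1 j t) (fun j => ω.2.2 j t) v

/-- The signals `(Y_v)_{v ∈ S}`. -/
noncomputable def Y (N : FadingNetwork V) (S : Set V) (ω : BlockSpace V T) (v : S) : Fin T → ℂ :=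
  recv N v ω

/-- All symbols sent and received in the block strictly before the symbol time `t`. -/
noncomputable def past (N : FadingNetwork V) (t : Fin T) (ω : BlockSpace V T) :
    V → {u : Fin T // u < t} → ℂ × ℂ :=
  fun v u => (ω.1 v u, recv N v ω u)

theorem measurable_past (N : FadingNetwork V) (t : Fin T) :
    Measurable (past N t : BlockSpace V T → _) := by
  classical
  refine measurable_pi_lambda _ fun v => measurable_pi_lambda _ fun u => ?_
  refine Measurable.prodMk (by fun_prop) ?_
  unfold recv FadingNetwork.channel
  refine Measurable.add (Finset.measurable_sum _ fun j _ => ?_) (by fun_prop)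
  split_ifs <;> fun_prop

instance : StandardBorelSpace (BlockSpace V T) :=
  haveI : StandardBorelSpace (Fin T → ℂ) := StandardBorelSpace.pi_countable
  haveI : StandardBorelSpace (V → Fin T → ℂ) := StandardBorelSpace.pi_countable
  haveI : StandardBorelSpace (V → ℂ) := StandardBorelSpace.pi_countable
  haveI : StandardBorelSpace (V → V → ℂ) := StandardBorelSpace.pi_countable
  inferInstance

/-- The signals received by the nodes `σ k` with `k < i`, together with the signals that are incoming
to `σ i` and are sent from the destination side `Ωᶜ` of the cut. -/
noncomputable def prevYInX (N : FadingNetwork V) (Ω : Set V) {L : ℕ} (σ : Fin L → V) (i : Fin L)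
    (ω : BlockSpace V T) :
    ((σ '' Set.Iio i : Set V) → Fin T → ℂ) ×
      (({j | N.graph.Adj j (σ i)} ∩ Ωᶜ : Set V) → Fin T → ℂ) :=
  (Y N _ ω, X _ ω)

/-- The signals received and the signals sent by the nodes `σ k` with `k < i`. -/
noncomputable def prevYPrevX (N : FadingNetwork V) {L : ℕ} (σ : Fin L → V) (i : Fin L)
    (ω : BlockSpace V T) :
    ((σ '' Set.Iio i : Set V) → Fin T → ℂ) × ((σ '' Set.Iio i : Set V) → Fin T → ℂ) :=
  (Y N _ ω, X _ ω)

/-- All signals incoming to the node `v`. -/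
def Xin (N : FadingNetwork V) (v : V) (ω : BlockSpace V T) :
    ({j | N.graph.Adj j v} : Set V) → Fin T → ℂ :=
  X _ ω

end BlockSpace

/-- `P` is a joint law of transmitted signals, fading and noise in one block, as it arises when the
network is operated: relays may use the block that they are receiving, so that `X` need not be
independent of the fading and the noise of the block. The received signals are then
`Y = G X + W`. -/
structure IsBlockInputLaw {V : Type*} [Fintype V] {T : ℕ} (N : FadingNetwork V)
    (P : Measure (BlockSpace V T)) [IsFiniteMeasure P] : Prop where
  /-- The fading and the noise follow the channel law. -/
  map_channel : P.map (fun ω => ω.2) = N.blockLaw T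
  power : ∀ v, ∑ t, ∫⁻ ω, ‖ω.1 v t‖ₑ ^ 2 ∂P ≤ T
  /-- Causality in time: the symbols sent at time `t` depend on the fading and the noise only through
  the symbols sent and received before `t`. -/
  causal : ∀ t : Fin T, CondIndepFun
    (MeasurableSpace.comap (BlockSpace.past N t) inferInstance)
    (BlockSpace.measurable_past N t).comap_le
    (fun ω v => ω.1 v t) (fun ω => ω.2) P
  /-- Causality along the network: the fading of the links into `i` and the noise at `i` are
  independent of the signals sent and received by the nodes to which no signal can flow from `i`. -/
  causal_node : ∀ i : V, IndepFun
    (fun ω : BlockSpace V T => ((fun j => ω.2.1 j i), ω.2.2 i))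
    (fun ω => (BlockSpace.X {j | ¬ Relation.ReflTransGen N.graph.Adj i j} ω,
      BlockSpace.Y N {j | ¬ Relation.ReflTransGen N.graph.Adj i j} ω)) P

/-! The law `P` is a weak limit of averaged block laws. For a code over `n` blocks, `avgLaw`
averages the joint law of sent signals, fading and noise over the messages and over the blocks. The
power constraint makes these laws tight, so codes with error tending to zero have a convergent
subsequence. The limit is chosen before any cut is considered, so one law serves all cuts and all
enumerations.

Conditional independence is in general not stable under mixtures or weak limits, so causality is
encoded differently, in `IsFeedbackLaw`. After multiplication by a bounded continuous weight (the
inverse likelihood of the past given the fading, damped), the past and the current symbols have a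
product law with the fading and the future noise, and the second factor is a fixed measure. This
identity is linear and weakly closed, and `condIndepFun_of_isWeightedProd` recovers conditional
independence from it. Causality along the network is the same kind of identity with weight one.

The converse for one code and one cut (`NetworkCode.converse`) is a change of measure. On the
destination side the true channel densities are replaced by arbitrary kernels that are causal along
the enumeration. Relays do not know the message, so under these kernels the destination side carries
no information about it and a guess is correct with total mass at most one over all messages.
Weighting correct guesses by `M/2` and wrong ones by `1/2`, the inequality `1 + x ≤ exp x` yields a
Fano-type bound: `(1 - error) log M - log 2` is at most `n` times the sum over the cut of the cross
entropy relative to the kernel minus the entropy of the channel output given its inputs.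

Entropies do not pass to weak limits directly, so the kernels are taken proportional to `exp f`
times a fixed reference density, with `f` bounded and continuous. The terms with `f` and with its
normalization converge. The reference density has polynomial tails, so its logarithm is uniformly
integrable under bounded second moments. The remaining term is the integral of the nonnegative
continuous function `outInfo`, which is lower semicontinuous, and it enters with the sign for which
this suffices (`NetworkCode.converse_limit`).

Only then is the supremum over `f` taken. By the Donsker-Varadhan bound
(`klDiv_le_of_forall_boundedContinuous`, `klDiv_ne_top_and_sum_le`) it controls the divergence of
the law of (observation, output) from the product with the reference measure. Finite divergence
gives existence of the conditional density and finiteness of the entropy, and cross entropy minus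
divergence is the conditional entropy. The two inequalities of the theorem are two choices of the
observation. -/

/-! ### Integration along triangular (causal) systems. -/

section Causal

variable {ι E α : Type*} [Fintype ι] [MeasurableSpace E] [LinearOrder α]

/-- A product of kernels, each a subdensity in its own coordinate that otherwise depends only on
coordinates of smaller rank, has total mass at most one. -/
theorem lintegral_prod_le_one_of_causal [DecidableEq ι] (μ : ι → Measure E) [∀ i, SigmaFinite (μ i)]
    (r : ι → α) (k : ι → (ι → E) → ℝ≥0∞) (hk : ∀ i, Measurable (k i))
    (hdep : ∀ i y y', y i = y' i → (∀ j, r j < r i → y j = y' j) → k i y = k i y')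
    (hone : ∀ i y, ∫⁻ a, k i (Function.update y i a) ∂μ i ≤ 1) :
    ∫⁻ y, ∏ i, k i y ∂Measure.pi μ ≤ 1 := by
  -- The coordinate of largest rank is integrated out first: no other factor depends on it, and its
  -- own factor contributes at most one.
  have key : ∀ s : Finset ι, ∀ x, (∫⋯∫⁻_s, (fun y => ∏ i ∈ s, k i y) ∂μ) x ≤ 1 := by
    intro s
    induction s using Finset.induction_on_max_value r with
    | empty => intro x; simp
    | insert a s ha hmax ih =>
      intro x
      rw [lmarginal_insert' _ (Finset.measurable_prod _ fun i _ => hk i) ha]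
      refine le_trans (lmarginal_mono (fun y => ?_) x) (ih x)
      have h1 : ∀ z, ∏ i ∈ insert a s, k i (Function.update y a z)
          = (∏ i ∈ s, k i y) * k a (Function.update y a z) := by
        intro z
        rw [Finset.prod_insert ha, mul_comm]
        congr 1
        refine Finset.prod_congr rfl fun i hi => hdep i _ _ ?_ fun j hj => ?_
        · rw [Function.update_of_ne]; rintro rfl; exact ha hi
        · rw [Function.update_of_ne]; rintro rfl; exact absurd (hmax i hi) (not_le.2 hj)
      simp_rw [h1]
      rw [lintegral_const_mul _ (by exact (hk a).comp (measurable_update y))]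
      exact mul_le_of_le_one_right' (hone a y)
  rcases isEmpty_or_nonempty (ι → E) with h | ⟨⟨x⟩⟩
  · simp [lintegral_of_isEmpty]
  · rw [lintegral_eq_lmarginal_univ x]
    exact key Finset.univ x

/-- A triangular shift preserves a translation invariant product measure. -/
theorem lintegral_sub_causal [DecidableEq ι] [AddGroup E] [MeasurableAdd₂ E] [MeasurableNeg E]
    [MeasurableSub₂ E]
    (μ : Measure E) [SigmaFinite μ] [μ.IsAddRightInvariant]
    (r : ι → α) (h : (ι → E) → ι → E) (hh : Measurable h)
    (hdep : ∀ i y y', (∀ j, r j < r i → y j = y' j) → h y i = h y' i)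
    (F : (ι → E) → ℝ≥0∞) (hF : Measurable F) :
    ∫⁻ y, F (fun i => y i - h y i) ∂Measure.pi (fun _ => μ)
      = ∫⁻ y, F y ∂Measure.pi (fun _ => μ) := by
  have hm : ∀ s : Finset ι, Measurable fun y : ι → E =>
      F (fun i => y i - if i ∈ s then h y i else 0) := by
    intro s
    refine hF.comp (measurable_pi_lambda _ fun i => (measurable_pi_apply i).sub ?_)
    split_ifs
    · exact (measurable_pi_apply i).comp hh
    · exact measurable_const
  -- The shift is switched on one coordinate at a time, in order of rank. When `a` has maximal rank,
  -- neither its shift nor those already present depend on coordinate `a`, so the new shift is a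
  -- translation by a constant in that coordinate.
  have key : ∀ s : Finset ι, ∫⁻ y, F (fun i => y i - if i ∈ s then h y i else 0)
      ∂Measure.pi (fun _ => μ) = ∫⁻ y, F y ∂Measure.pi (fun _ => μ) := by
    intro s
    induction s using Finset.induction_on_max_value r with
    | empty => simp
    | insert a s ha hmax ih =>
      rw [← ih]
      refine lintegral_eq_of_lmarginal_eq {a} (hm _) (hm _) ?_
      rw [lmarginal_singleton, lmarginal_singleton]
      funext x
      have hx : ∀ z, ∀ i, r i ≤ r a → h (Function.update x a z) i = h x i := by
        intro z i hi
        refine hdep i _ _ fun j hj => ?_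
        rw [Function.update_of_ne]; rintro rfl; exact absurd hi (not_le.2 hj)
      have e1 : ∀ z, (fun i => Function.update x a z i
            - if i ∈ insert a s then h (Function.update x a z) i else 0)
          = Function.update (fun i => x i - if i ∈ s then h x i else 0) a (z - h x a) := by
        intro z; funext i
        rcases eq_or_ne i a with rfl | hne
        · simp [hx z i le_rfl]
        · by_cases his : i ∈ s
          · simp [hne, his, hx z i (hmax i his)]
          · simp [hne, his]
      have e2 : ∀ z, (fun i => Function.update x a z i
            - if i ∈ s then h (Function.update x a z) i else 0)
          = Function.update (fun i => x i - if i ∈ s then h x i else 0) a z := by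
        intro z; funext i
        rcases eq_or_ne i a with rfl | hne
        · simp [ha]
        · by_cases his : i ∈ s
          · simp [hne, his, hx z i (hmax i his)]
          · simp [hne, his]
      simp_rw [e1, e2]
      exact lintegral_sub_right_eq_self
        (fun z => F (Function.update (fun i => x i - if i ∈ s then h x i else 0) a z)) (h x a)
  simpa using key Finset.univ

/-- Two solutions of a triangular system agree. -/
theorem eq_of_causal {ι α : Type*} [LinearOrder α] (r : ι → α) [WellFoundedLT α] {E : Type*} {S : ι → Prop} {y y' : ι → E}
    (h : ∀ i, S i → (∀ j, r j < r i → S j → y j = y' j) → y i = y' i) (i : ι) (hi : S i) :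
    y i = y' i := by
  induction hr : r i using WellFoundedLT.induction generalizing i with
  | ind a ih =>
    subst hr
    exact h i hi fun j hj hSj => ih (r j) hj j hSj rfl

end Causal

/-! ### Rearranging and reweighting product measures. -/

section Product

/-- Uncurrying preserves product measures. -/
theorem measurePreserving_uncurry {ι κ : Type*} [Fintype ι] [Fintype κ] {X : Type*}
    [MeasurableSpace X] (μ : ι → κ → Measure X) [∀ i j, SigmaFinite (μ i j)] :
    MeasurePreserving (fun (f : ι → κ → X) (p : ι × κ) => f p.1 p.2)
      (Measure.pi fun i => Measure.pi (μ i)) (Measure.pi fun p : ι × κ => μ p.1 p.2) := by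
  refine ⟨by fun_prop, (Measure.pi_eq fun s hs => ?_).symm⟩
  rw [Measure.map_apply (by fun_prop) (MeasurableSet.univ_pi hs)]
  have : (fun (f : ι → κ → X) (p : ι × κ) => f p.1 p.2) ⁻¹' Set.univ.pi s
      = Set.univ.pi fun i => Set.univ.pi fun j => s (i, j) := by
    ext f; simp [Set.mem_pi]
  rw [this, Measure.pi_pi]
  simp_rw [Measure.pi_pi]
  rw [Fintype.prod_prod_type]

theorem measurePreserving_curry {ι κ : Type*} [Fintype ι] [Fintype κ] {X : Type*}
    [MeasurableSpace X] (μ : ι → κ → Measure X) [∀ i j, SigmaFinite (μ i j)] :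
    MeasurePreserving (fun (f : ι × κ → X) i j => f (i, j))
      (Measure.pi fun p : ι × κ => μ p.1 p.2) (Measure.pi fun i => Measure.pi (μ i)) :=
  let e : (ι → κ → X) ≃ᵐ (ι × κ → X) :=
    { toFun := fun f p => f p.1 p.2
      invFun := fun f i j => f (i, j)
      left_inv := fun _ => rfl
      right_inv := fun _ => rfl
      measurable_toFun := (measurePreserving_uncurry μ).measurable
      measurable_invFun := measurable_pi_lambda _ fun i => measurable_pi_lambda _ fun j =>
        measurable_pi_apply (i, j) }
  MeasurePreserving.symm e (measurePreserving_uncurry μ)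

/-- Exchanging the two indices preserves product measures. -/
theorem measurePreserving_swapIndex {ι κ : Type*} [Fintype ι] [Fintype κ] {X : Type*}
    [MeasurableSpace X] (μ : ι → κ → Measure X) [∀ i j, SigmaFinite (μ i j)] :
    MeasurePreserving (fun (f : κ → ι → X) i j => f j i)
      (Measure.pi fun j => Measure.pi fun i => μ i j) (Measure.pi fun i => Measure.pi (μ i)) := by
  have h1 := measurePreserving_uncurry fun j i => μ i j
  have h2 := measurePreserving_piCongrLeft (fun p : ι × κ => μ p.1 p.2) (Equiv.prodComm κ ι)
  have h3 := measurePreserving_curry μ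
  exact h3.comp (h2.comp h1)

/-- Coordinatewise maps of two independent families. -/
theorem measurePreserving_pi_prod {ι : Type*} [Fintype ι] {X Y Z : ι → Type*}
    [∀ i, MeasurableSpace (X i)] [∀ i, MeasurableSpace (Y i)] [∀ i, MeasurableSpace (Z i)]
    {μ : ∀ i, Measure (X i)} {ν : ∀ i, Measure (Y i)} {ρ : ∀ i, Measure (Z i)}
    [∀ i, SigmaFinite (μ i)] [∀ i, SigmaFinite (ν i)] [∀ i, SigmaFinite (ρ i)]
    {f : ∀ i, X i × Y i → Z i} (hf : ∀ i, MeasurePreserving (f i) ((μ i).prod (ν i)) (ρ i)) :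
    MeasurePreserving (fun (p : (∀ i, X i) × (∀ i, Y i)) i => f i (p.1 i, p.2 i))
      ((Measure.pi μ).prod (Measure.pi ν)) (Measure.pi ρ) := by
  have hg : MeasurePreserving (fun (p : (∀ i, X i) × (∀ i, Y i)) i => (p.1 i, p.2 i))
      ((Measure.pi μ).prod (Measure.pi ν)) (Measure.pi fun i => (μ i).prod (ν i)) := by
    have hm : Measurable (fun (p : (∀ i, X i) × (∀ i, Y i)) i => (p.1 i, p.2 i)) :=
      measurable_pi_lambda _ fun i => by fun_prop
    refine ⟨hm, ?_⟩
    symm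
    -- Measurable rectangles generate each factor, so it is enough to compare the measures on boxes
    -- of rectangles.
    refine Measure.pi_eq_generateFrom
      (C := fun i => Set.image2 (· ×ˢ ·) {s : Set (X i) | MeasurableSet s}
        {t : Set (Y i) | MeasurableSet t}) (fun _ => generateFrom_prod) (fun _ => isPiSystem_prod)
      (fun i => ?_) ?_
    · refine ((μ i).toFiniteSpanningSetsIn.prod (ν i).toFiniteSpanningSetsIn)
    · intro s hs
      choose a ha b hb hab using hs
      have : (fun (p : (∀ i, X i) × (∀ i, Y i)) i => (p.1 i, p.2 i)) ⁻¹' Set.univ.pi s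
          = Set.univ.pi a ×ˢ Set.univ.pi b := by
        ext p; simp [Set.mem_pi, ← hab, forall_and]
      rw [Measure.map_apply hm (MeasurableSet.univ_pi fun i => by
        rw [← hab]; exact (ha i).prod (hb i)), this, Measure.prod_prod, Measure.pi_pi,
        Measure.pi_pi, ← Finset.prod_mul_distrib]
      simp_rw [← hab, Measure.prod_prod]
  exact (measurePreserving_pi _ _ hf).comp hg

theorem measurePreserving_prodProdComm {X Y X' Y' : Type*}
    [MeasurableSpace X] [MeasurableSpace Y] [MeasurableSpace X'] [MeasurableSpace Y']
    (μ : Measure X) (ν : Measure Y) (μ' : Measure X') (ν' : Measure Y')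
    [SigmaFinite μ] [SigmaFinite ν] [SigmaFinite μ'] [SigmaFinite ν'] :
    MeasurePreserving (fun p : (X × X') × (Y × Y') => ((p.1.1, p.2.1), (p.1.2, p.2.2)))
      ((μ.prod μ').prod (ν.prod ν')) ((μ.prod ν).prod (μ'.prod ν')) := by
  refine ⟨by fun_prop, Measure.ext_of_lintegral _ fun F hF => ?_⟩
  rw [lintegral_map hF (by fun_prop), lintegral_prod _ (by fun_prop), lintegral_prod _ (by fun_prop),
    lintegral_prod _ (by fun_prop), lintegral_prod _ (by fun_prop)]
  refine lintegral_congr fun a => ?_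
  have h1 : ∀ b, ∫⁻ q : Y × Y', F ((a, q.1), (b, q.2)) ∂ν.prod ν'
      = ∫⁻ c, ∫⁻ d, F ((a, c), (b, d)) ∂ν' ∂ν := fun b => lintegral_prod _ (by fun_prop)
  have h2 : ∀ c, ∫⁻ q : X' × Y', F ((a, c), q) ∂μ'.prod ν'
      = ∫⁻ b, ∫⁻ d, F ((a, c), (b, d)) ∂ν' ∂μ' := fun c => lintegral_prod _ (by fun_prop)
  simp_rw [h1, h2]
  exact lintegral_lintegral_swap (by fun_prop)

theorem measurePreserving_prod_prod {X Y X' Y' Z Z' : Type*}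
    [MeasurableSpace X] [MeasurableSpace Y] [MeasurableSpace X'] [MeasurableSpace Y']
    [MeasurableSpace Z] [MeasurableSpace Z'] {μ : Measure X} {ν : Measure Y}
    {μ' : Measure X'} {ν' : Measure Y'} {ρ : Measure Z} {ρ' : Measure Z'}
    [SigmaFinite μ] [SigmaFinite ν] [SigmaFinite μ'] [SigmaFinite ν'] [SigmaFinite ρ]
    [SigmaFinite ρ'] {f : X × Y → Z} {f' : X' × Y' → Z'}
    (hf : MeasurePreserving f (μ.prod ν) ρ) (hf' : MeasurePreserving f' (μ'.prod ν') ρ') :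
    MeasurePreserving (fun p : (X × X') × (Y × Y') => (f (p.1.1, p.2.1), f' (p.1.2, p.2.2)))
      ((μ.prod μ').prod (ν.prod ν')) (ρ.prod ρ') :=
  (hf.prod hf').comp (measurePreserving_prodProdComm μ ν μ' ν')

/-- Replacing a family by an independent copy, if a condition holds. -/
theorem measurePreserving_select {X : Type*} [MeasurableSpace X] (μ : Measure X)
    [IsProbabilityMeasure μ] (c : Prop) [Decidable c] :
    MeasurePreserving (fun p : X × X => if c then p.2 else p.1) (μ.prod μ) μ := by
  split_ifs
  · exact measurePreserving_snd
  · exact measurePreserving_fst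

theorem lintegral_pi_prod {ι : Type*} [Fintype ι] {X : ι → Type*} [∀ i, MeasurableSpace (X i)]
    (μ : ∀ i, Measure (X i)) [∀ i, SigmaFinite (μ i)] (f : ∀ i, X i → ℝ≥0∞)
    (hf : ∀ i, Measurable (f i)) :
    ∫⁻ x, ∏ i, f i (x i) ∂Measure.pi μ = ∏ i, ∫⁻ x, f i x ∂μ i := by
  classical
  have key : ∀ s : Finset ι, ∀ x, (∫⋯∫⁻_s, (fun y => ∏ i ∈ s, f i (y i)) ∂μ) x
      = ∏ i ∈ s, ∫⁻ x, f i x ∂μ i := by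
    intro s
    induction s using Finset.induction_on with
    | empty => simp
    | insert a s ha ih =>
      intro x
      have hm : Measurable fun y : ∀ i, X i => ∏ i ∈ s, f i (y i) :=
        Finset.measurable_prod _ fun i _ => (hf i).comp (measurable_pi_apply i)
      have hm' : Measurable fun y : ∀ i, X i => ∏ i ∈ insert a s, f i (y i) :=
        Finset.measurable_prod _ fun i _ => (hf i).comp (measurable_pi_apply i)
      rw [lmarginal_insert' _ hm' ha]
      have h1 : (fun y : ∀ i, X i => ∫⁻ z, ∏ i ∈ insert a s, f i (Function.update y a z i) ∂μ a)
          = fun y => (∫⁻ z, f a z ∂μ a) * ∏ i ∈ s, f i (y i) := by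
        funext y
        rw [← lintegral_mul_const _ (hf a)]
        refine lintegral_congr fun z => ?_
        rw [Finset.prod_insert ha, Function.update_self]
        congr 1
        refine Finset.prod_congr rfl fun i hi => ?_
        rw [Function.update_of_ne]; rintro rfl; exact ha hi
      rw [h1, Finset.prod_insert ha, ← ih x]
      rw [lmarginal, lmarginal, lintegral_const_mul]
      exact hm.comp measurable_updateFinset
  rcases isEmpty_or_nonempty (∀ i, X i) with h | ⟨⟨x⟩⟩
  · rw [lintegral_of_isEmpty]
    obtain ⟨i, hi⟩ := isEmpty_pi.1 h
    rw [Finset.prod_eq_zero (Finset.mem_univ i)]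
    rw [lintegral_of_isEmpty]
  · rw [lintegral_eq_lmarginal_univ x]
    exact key Finset.univ x

theorem pi_withDensity {ι : Type*} [Fintype ι] {X : ι → Type*} [∀ i, MeasurableSpace (X i)]
    (μ : ∀ i, Measure (X i)) [∀ i, SigmaFinite (μ i)] (f : ∀ i, X i → ℝ≥0∞)
    (hf : ∀ i, Measurable (f i)) [∀ i, SigmaFinite ((μ i).withDensity (f i))] :
    Measure.pi (fun i => (μ i).withDensity (f i))
      = (Measure.pi μ).withDensity fun x => ∏ i, f i (x i) := by
  refine Measure.pi_eq fun s hs => ?_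
  rw [withDensity_apply _ (MeasurableSet.univ_pi hs), ← lintegral_indicator (MeasurableSet.univ_pi hs)]
  have : (Set.univ.pi s).indicator (fun x => ∏ i, f i (x i))
      = fun x => ∏ i, (s i).indicator (f i) (x i) := by
    funext x
    by_cases hx : x ∈ Set.univ.pi s
    · rw [Set.indicator_of_mem hx]
      exact Finset.prod_congr rfl fun i _ => (Set.indicator_of_mem (hx i trivial) _).symm
    · rw [Set.indicator_of_notMem hx]
      simp only [Set.mem_pi, not_forall] at hx
      obtain ⟨i, _, hi⟩ := hx
      exact (Finset.prod_eq_zero (Finset.mem_univ i) (Set.indicator_of_notMem hi _)).symm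
  rw [this, lintegral_pi_prod μ _ fun i => (hf i).indicator (hs i)]
  refine Finset.prod_congr rfl fun i _ => ?_
  rw [lintegral_indicator (hs i), withDensity_apply _ (hs i)]

end Product

/-! ### Density and second moment of the complex Gaussian law. -/

section Gaussian

/-- Density of the law `CN(0,1)`. -/
noncomputable def stdComplexGaussianDensity (z : ℂ) : ℝ := Real.pi⁻¹ * Real.exp (-‖z‖ ^ 2)

theorem stdComplexGaussianDensity_pos (z : ℂ) : 0 < stdComplexGaussianDensity z :=
  mul_pos (inv_pos.2 Real.pi_pos) (Real.exp_pos _)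

@[fun_prop]
theorem continuous_stdComplexGaussianDensity : Continuous stdComplexGaussianDensity := by
  unfold stdComplexGaussianDensity; fun_prop

theorem stdComplexGaussian_eq_withDensity :
    stdComplexGaussian = volume.withDensity fun z => ENNReal.ofReal (stdComplexGaussianDensity z) := by
  have h1 : gaussianReal 0 (1 / 2) = volume.withDensity (gaussianPDF 0 (1 / 2)) :=
    gaussianReal_of_var_ne_zero 0 (by norm_num)
  have hm : Measurable fun z : ℂ => ENNReal.ofReal (stdComplexGaussianDensity z) :=
    continuous_stdComplexGaussianDensity.measurable.ennreal_ofReal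
  rw [stdComplexGaussian, h1, prod_withDensity (measurable_gaussianPDF _ _)
    (measurable_gaussianPDF _ _)]
  have hmp := Complex.volume_preserving_equiv_real_prod.symm
  have e : (fun p : ℝ × ℝ => (⟨p.1, p.2⟩ : ℂ)) = Complex.measurableEquivRealProd.symm := by
    funext p; rfl
  rw [e]
  refine Measure.ext fun s hs => ?_
  rw [Measure.map_apply (MeasurableEquiv.measurable _) hs,
    withDensity_apply _ (MeasurableEquiv.measurable _ hs), withDensity_apply _ hs,
    ← hmp.setLIntegral_comp_preimage hs hm]
  refine lintegral_congr fun p => ?_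
  simp only [gaussianPDF, gaussianPDFReal, stdComplexGaussianDensity]
  rw [← ENNReal.ofReal_mul (by positivity)]
  congr 1
  have h2 : ‖Complex.measurableEquivRealProd.symm p‖ ^ 2 = p.1 ^ 2 + p.2 ^ 2 := by
    rw [← Complex.normSq_eq_norm_sq, Complex.normSq_apply]
    simp only [Complex.measurableEquivRealProd_symm_apply]; ring
  rw [h2]
  -- With variance `1/2` the radicand is `π`, so the two normalizing constants multiply to `π⁻¹`.
  have h3 : (√(2 * Real.pi * ((1 / 2 : ℝ≥0) : ℝ)))⁻¹ * (√(2 * Real.pi * ((1 / 2 : ℝ≥0) : ℝ)))⁻¹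
      = Real.pi⁻¹ := by
    rw [← mul_inv, Real.mul_self_sqrt (by positivity)]
    congr 1
    push_cast; ring
  calc _ = ((√(2 * Real.pi * ((1 / 2 : ℝ≥0) : ℝ)))⁻¹ * (√(2 * Real.pi * ((1 / 2 : ℝ≥0) : ℝ)))⁻¹)
        * (Real.exp (-(p.1 - 0) ^ 2 / (2 * ((1 / 2 : ℝ≥0) : ℝ)))
          * Real.exp (-(p.2 - 0) ^ 2 / (2 * ((1 / 2 : ℝ≥0) : ℝ)))) := by ring
    _ = _ := by
      rw [h3, ← Real.exp_add]
      congr 2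
      push_cast; ring

instance : IsProbabilityMeasure stdComplexGaussian := by
  unfold stdComplexGaussian
  exact Measure.isProbabilityMeasure_map
    (Complex.measurableEquivRealProd.symm.measurable).aemeasurable

theorem lintegral_enorm_sq_stdComplexGaussian : ∫⁻ z, ‖z‖ₑ ^ 2 ∂stdComplexGaussian < ∞ := by
  have h : MemLp (id : ℝ → ℝ) 2 (gaussianReal 0 (1 / 2)) := memLp_id_gaussianReal 2
  have h1 : MemLp (fun p : ℝ × ℝ => p.1) 2
      ((gaussianReal 0 (1 / 2)).prod (gaussianReal 0 (1 / 2))) :=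
    h.comp_measurePreserving measurePreserving_fst
  have h2 : MemLp (fun p : ℝ × ℝ => p.2) 2
      ((gaussianReal 0 (1 / 2)).prod (gaussianReal 0 (1 / 2))) :=
    h.comp_measurePreserving measurePreserving_snd
  have hm : Measurable fun p : ℝ × ℝ => (⟨p.1, p.2⟩ : ℂ) :=
    Complex.measurableEquivRealProd.symm.measurable
  have h3 : MemLp (fun p : ℝ × ℝ => (⟨p.1, p.2⟩ : ℂ)) 2
      ((gaussianReal 0 (1 / 2)).prod (gaussianReal 0 (1 / 2))) := by
    refine (h1.norm.add h2.norm).mono hm.aestronglyMeasurable (Eventually.of_forall fun p => ?_)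
    simp only [Pi.add_apply]
    refine (Complex.norm_le_abs_re_add_abs_im _).trans (le_of_eq ?_)
    simp [abs_of_nonneg (add_nonneg (abs_nonneg p.1) (abs_nonneg p.2))]
  have h4 := h3.eLpNorm_lt_top
  rw [eLpNorm_lt_top_iff_lintegral_rpow_enorm_lt_top (by norm_num) (by norm_num)] at h4
  rw [stdComplexGaussian, lintegral_map (by fun_prop) hm]
  simpa using h4

end Gaussian

/-! ### The Donsker-Varadhan bound from bounded continuous test functions. -/

section Variational

open scoped BoundedContinuousFunction Topology

variable {X : Type*} [TopologicalSpace X] [TopologicalSpace.PseudoMetrizableSpace X]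
  [MeasurableSpace X] [BorelSpace X]

/-- An exponential inequality for bounded continuous functions extends to bounded measurable
functions. -/
theorem integral_le_log_integral_exp_of_measurable {μ ν : Measure X} [IsProbabilityMeasure μ]
    [IsProbabilityMeasure ν] {c : ℝ}
    (h : ∀ f : X →ᵇ ℝ, ∫ x, f x ∂μ ≤ c + Real.log (∫ x, Real.exp (f x) ∂ν))
    (f : X → ℝ) (hf : Measurable f) (K : ℝ) (hK : ∀ x, |f x| ≤ K) :
    ∫ x, f x ∂μ ≤ c + Real.log (∫ x, Real.exp (f x) ∂ν) := by
  have hint : ∀ (ρ : Measure X) [IsFiniteMeasure ρ], Integrable f ρ := fun ρ _ =>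
    Integrable.of_bound hf.aestronglyMeasurable K (Eventually.of_forall hK)
  have hexp : ∀ {g : X → ℝ}, Measurable g → (∀ x, |g x| ≤ K) →
      Integrable (fun x => Real.exp (g x)) ν := fun {g} hg hgK =>
    Integrable.of_bound (hg.exp).aestronglyMeasurable (Real.exp K) (Eventually.of_forall fun x => by
      rw [Real.norm_eq_abs, abs_of_pos (Real.exp_pos _)]
      exact Real.exp_le_exp.2 ((le_abs_self _).trans (hgK x)))
  set I := ∫ x, Real.exp (f x) ∂ν with hI
  have hIpos : 0 < I := integral_exp_pos (hexp hf hK)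
  have key : ∀ δ : ℝ, 0 < δ → ∫ x, f x ∂μ ≤ c + Real.log (I + Real.exp K * δ) + δ := by
    intro δ hδ
    -- Approximation in `L¹(μ + ν)` controls both sides of the inequality at once.
    obtain ⟨g, hg, -⟩ := (hint (μ + ν)).exists_boundedContinuous_integral_sub_le hδ
    have hK0 : 0 ≤ K ∨ IsEmpty X := by
      rcases isEmpty_or_nonempty X with hX | ⟨⟨x⟩⟩
      · exact Or.inr hX
      · exact Or.inl ((abs_nonneg _).trans (hK x))
    rcases hK0 with hK0 | hX
    swap
    · exact absurd (measure_univ (μ := μ)) (by simp [Measure.eq_zero_of_isEmpty μ])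
    -- Since `|f| ≤ K`, truncating at `±K` does not increase the distance to `f`, and it makes `exp`
    -- Lipschitz with constant `exp K` on the relevant range.
    let g' : X →ᵇ ℝ := BoundedContinuousFunction.ofNormedAddCommGroup
      (fun x => max (-K) (min K (g x))) (by fun_prop) K (fun x => by
        rw [Real.norm_eq_abs, abs_le]
        exact ⟨le_max_left _ _, max_le (by linarith) (min_le_left _ _)⟩)
    have hg'K : ∀ x, |g' x| ≤ K := fun x => by
      change |max (-K) (min K (g x))| ≤ K
      rw [abs_le]
      exact ⟨le_max_left _ _, max_le (by linarith) (min_le_left _ _)⟩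
    have hle : ∀ x, |f x - g' x| ≤ ‖f x - g x‖ := fun x => by
      have hfx : f x = max (-K) (min K (f x)) := by
        rw [min_eq_right (abs_le.1 (hK x)).2, max_eq_right (abs_le.1 (hK x)).1]
      change |f x - max (-K) (min K (g x))| ≤ |f x - g x|
      conv_lhs => rw [hfx]
      refine (abs_max_sub_max_le_max _ _ _ _).trans ?_
      rw [sub_self, abs_zero, max_eq_right (abs_nonneg _)]
      refine (abs_min_sub_min_le_max _ _ _ _).trans ?_
      rw [sub_self, abs_zero, max_eq_right (abs_nonneg _)]
    have hfg : ∀ (ρ : Measure X) [IsFiniteMeasure ρ], Integrable (fun x => |f x - g' x|) ρ :=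
      fun ρ _ => ((hint ρ).sub (g'.integrable ρ)).abs
    have hfg' : ∀ (ρ : Measure X) [IsFiniteMeasure ρ], Integrable (fun x => ‖f x - g x‖) ρ :=
      fun ρ _ => ((hint ρ).sub (g.integrable ρ)).norm
    have hsum : ∫ x, ‖f x - g x‖ ∂(μ + ν) = ∫ x, ‖f x - g x‖ ∂μ + ∫ x, ‖f x - g x‖ ∂ν :=
      integral_add_measure (hfg' μ) (hfg' ν)
    have hn1 : 0 ≤ ∫ x, ‖f x - g x‖ ∂μ := integral_nonneg fun _ => norm_nonneg _
    have hn2 : 0 ≤ ∫ x, ‖f x - g x‖ ∂ν := integral_nonneg fun _ => norm_nonneg _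
    have h1 : ∫ x, f x ∂μ ≤ ∫ x, g' x ∂μ + δ := by
      have : ∫ x, f x ∂μ - ∫ x, g' x ∂μ ≤ ∫ x, ‖f x - g x‖ ∂μ := by
        rw [← integral_sub (hint μ) (g'.integrable μ)]
        exact integral_mono ((hint μ).sub (g'.integrable μ)) (hfg' μ) fun x =>
          (le_abs_self _).trans (hle x)
      linarith
    have h2 : ∫ x, Real.exp (g' x) ∂ν ≤ I + Real.exp K * δ := by
      have : ∫ x, Real.exp (g' x) ∂ν - I ≤ ∫ x, Real.exp K * ‖f x - g x‖ ∂ν := by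
        rw [hI, ← integral_sub (hexp g'.continuous.measurable hg'K) (hexp hf hK)]
        refine integral_mono ((hexp g'.continuous.measurable hg'K).sub (hexp hf hK))
          ((hfg' ν).const_mul _) fun x => ?_
        have e1 : Real.exp (g' x) - Real.exp (f x) ≤ Real.exp (g' x) * (g' x - f x) := by
          have := Real.add_one_le_exp (f x - g' x)
          have h3 : Real.exp (f x) = Real.exp (g' x) * Real.exp (f x - g' x) := by
            rw [← Real.exp_add]; ring_nf
          rw [h3]
          nlinarith [Real.exp_pos (g' x)]
        refine e1.trans ?_
        calc Real.exp (g' x) * (g' x - f x) ≤ Real.exp (g' x) * |f x - g' x| := by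
              rw [abs_sub_comm]
              exact mul_le_mul_of_nonneg_left (le_abs_self _) (Real.exp_pos _).le
          _ ≤ Real.exp K * ‖f x - g x‖ := mul_le_mul
              (Real.exp_le_exp.2 ((le_abs_self _).trans (hg'K x))) (hle x) (abs_nonneg _)
              (Real.exp_pos _).le
      rw [integral_const_mul] at this
      have : Real.exp K * ∫ x, ‖f x - g x‖ ∂ν ≤ Real.exp K * δ :=
        mul_le_mul_of_nonneg_left (by linarith) (Real.exp_pos _).le
      linarith
    have h3 := h g'
    have h4 : Real.log (∫ x, Real.exp (g' x) ∂ν) ≤ Real.log (I + Real.exp K * δ) :=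
      Real.log_le_log (integral_exp_pos (hexp g'.continuous.measurable hg'K)) h2
    linarith
  have hlim : Tendsto (fun δ : ℝ => c + Real.log (I + Real.exp K * δ) + δ) (𝓝[>] 0)
      (𝓝 (c + Real.log (I + Real.exp K * 0) + 0)) := by
    refine Tendsto.mono_left ?_ nhdsWithin_le_nhds
    have : ContinuousAt (fun δ : ℝ => c + Real.log (I + Real.exp K * δ) + δ) 0 := by
      have h0 : I + Real.exp K * 0 ≠ 0 := by rw [mul_zero, add_zero]; exact hIpos.ne'
      fun_prop (disch := exact h0)
    exact this
  rw [mul_zero, add_zero, add_zero] at hlim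
  exact ge_of_tendsto hlim (eventually_nhdsWithin_of_forall fun δ hδ => key δ hδ)

/-- For `s` between `1` and `r`, replacing the factor `r` by `s` decreases `r log s`, and `s log s +
1 - s` is nonnegative. This supplies the nonnegative integrands needed for Fatou's lemma when a
density `r` is truncated to `s`. -/
theorem mul_log_add_one_sub_nonneg {r s : ℝ} (hs : 0 < s) (h : (1 ≤ s ∧ s ≤ r) ∨ (s ≤ 1 ∧ r ≤ s)) :
    0 ≤ r * Real.log s + 1 - s := by
  have h1 : 0 ≤ s * Real.log s + 1 - s := InformationTheory.klFun_nonneg hs.le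
  rcases h with ⟨h2, h3⟩ | ⟨h2, h3⟩
  · nlinarith [mul_le_mul_of_nonneg_right h3 (Real.log_nonneg h2)]
  · nlinarith [mul_le_mul_of_nonpos_right h3 (Real.log_nonpos hs.le h2)]

/-- The Donsker-Varadhan bound: bounded continuous test functions control the divergence. -/
theorem klDiv_le_of_forall_boundedContinuous {μ ν : Measure X} [IsProbabilityMeasure μ]
    [IsProbabilityMeasure ν] {c : ℝ}
    (h : ∀ f : X →ᵇ ℝ, ∫ x, f x ∂μ ≤ c + Real.log (∫ x, Real.exp (f x) ∂ν)) :
    InformationTheory.klDiv μ ν ≤ ENNReal.ofReal c := by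
  have hm := integral_le_log_integral_exp_of_measurable h
  -- On a `ν`-null set `A` the test function `K · 1_A` has exponential integral one, so `K μ(A) ≤ c`
  -- for every `K`.
  have hac : μ ≪ ν := by
    refine Measure.AbsolutelyContinuous.mk fun A hA hνA => ?_
    by_contra hμA
    have hpos : 0 < μ.real A := ENNReal.toReal_pos hμA (measure_ne_top _ _)
    obtain ⟨K, hK⟩ := exists_nat_gt (c / μ.real A)
    have h1 := hm (A.indicator fun _ => (K : ℝ)) (measurable_const.indicator hA) K fun x => by
      by_cases hx : x ∈ A <;> simp [hx]
    have h2 : ∫ x, Real.exp (A.indicator (fun _ => (K : ℝ)) x) ∂ν = 1 := by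
      have : (fun x => Real.exp (A.indicator (fun _ => (K : ℝ)) x)) =ᵐ[ν] fun _ => 1 := by
        have hA' : ∀ᵐ x ∂ν, x ∉ A := measure_eq_zero_iff_ae_notMem.1 hνA
        filter_upwards [hA'] with x hx
        simp [hx]
      rw [integral_congr_ae this]; simp
    rw [h2, integral_indicator_const _ hA, smul_eq_mul, Real.log_one] at h1
    rw [div_lt_iff₀ hpos] at hK
    nlinarith
  rw [InformationTheory.klDiv_eq_lintegral_klFun_of_ac hac]
  set r : X → ℝ := fun x => (μ.rnDeriv ν x).toReal with hr
  have hrm : Measurable r := (Measure.measurable_rnDeriv μ ν).ennreal_toReal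
  have hr0 : ∀ x, 0 ≤ r x := fun x => ENNReal.toReal_nonneg
  -- The optimal test function `log r` is unbounded; `log (s K)` is its truncation at `±K`.
  let s : ℕ → X → ℝ := fun K x => max (Real.exp (-K)) (min (Real.exp K) (r x))
  have hsm : ∀ K, Measurable (s K) := fun K => measurable_const.max (measurable_const.min hrm)
  have hspos : ∀ K x, 0 < s K x := fun K x => lt_max_of_lt_left (Real.exp_pos _)
  have hexp1 : ∀ K : ℕ, Real.exp (-(K : ℝ)) ≤ 1 := fun K => Real.exp_le_one_iff.2 (by simp)
  have hexp2 : ∀ K : ℕ, 1 ≤ Real.exp (K : ℝ) := fun K => Real.one_le_exp (by simp)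
  have hphi : ∀ K x, 0 ≤ r x * Real.log (s K x) + 1 - s K x := by
    intro K x
    refine mul_log_add_one_sub_nonneg (hspos K x) ?_
    rcases le_total 1 (r x) with h1 | h1
    · left
      refine ⟨le_max_of_le_right (le_min (hexp2 K) h1), max_le ((hexp1 K).trans h1) (min_le_right _ _)⟩
    · right
      refine ⟨max_le (hexp1 K) ((min_le_right _ _).trans h1), ?_⟩
      exact le_max_of_le_right (le_min (h1.trans (hexp2 K)) le_rfl)
  have hlogb : ∀ K x, |Real.log (s K x)| ≤ K := by
    intro K x
    rw [abs_le]
    constructor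
    · rw [Real.le_log_iff_exp_le (hspos K x)]; exact le_max_left _ _
    · rw [Real.log_le_iff_le_exp (hspos K x)]
      exact max_le ((hexp1 K).trans (hexp2 K)) (min_le_left _ _)
  have hlogm : ∀ K, Measurable fun x => Real.log (s K x) := fun K => (hsm K).log
  have hlogi : ∀ K, Integrable (fun x => Real.log (s K x)) μ := fun K =>
    Integrable.of_bound (hlogm K).aestronglyMeasurable K (Eventually.of_forall (hlogb K))
  have hsi : ∀ K, Integrable (s K) ν := fun K =>
    Integrable.of_bound (hsm K).aestronglyMeasurable (Real.exp K) (Eventually.of_forall fun x => by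
      rw [Real.norm_eq_abs, abs_of_pos (hspos K x)]
      exact max_le ((hexp1 K).trans (hexp2 K)) (min_le_left _ _))
  have hri : ∀ K, Integrable (fun x => r x * Real.log (s K x)) ν := fun K =>
    (integrable_rnDeriv_smul_iff hac).2 (hlogi K)
  have hbound : ∀ K, ∫⁻ x, ENNReal.ofReal (r x * Real.log (s K x) + 1 - s K x) ∂ν
      ≤ ENNReal.ofReal c := by
    intro K
    have hi : Integrable (fun x => r x * Real.log (s K x) + 1 - s K x) ν :=
      ((hri K).add (integrable_const 1)).sub (hsi K)
    rw [← ofReal_integral_eq_lintegral_ofReal hi (Eventually.of_forall (hphi K))]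
    refine ENNReal.ofReal_le_ofReal ?_
    have h0 : ∫ x, (r x * Real.log (s K x) + 1 - s K x) ∂ν
        = ∫ x, r x * Real.log (s K x) ∂ν + ∫ _, (1 : ℝ) ∂ν - ∫ x, s K x ∂ν := by
      rw [← integral_add (hri K) (integrable_const 1)]
      exact integral_sub ((hri K).add (integrable_const 1)) (hsi K)
    have h1 : ∫ x, r x * Real.log (s K x) ∂ν = ∫ x, Real.log (s K x) ∂μ :=
      integral_rnDeriv_smul hac
    have h2 := hm _ (hlogm K) K (hlogb K)
    simp_rw [Real.exp_log (hspos K _)] at h2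
    have h3 : 0 < ∫ x, s K x ∂ν := by
      have := integral_exp_pos (μ := ν) (f := fun x => Real.log (s K x))
        (by simp_rw [Real.exp_log (hspos K _)]; exact hsi K)
      simpa only [Real.exp_log (hspos K _)] using this
    -- Bounding `log ∫ s` by `∫ s - 1` makes the variational inequality linear, hence a bound on one
    -- integral over `ν`.
    have h4 := Real.log_le_sub_one_of_pos h3
    rw [h0, h1]; simp only [integral_const, probReal_univ, smul_eq_mul, mul_one]
    linarith
  have hlim : ∀ x, Tendsto (fun K : ℕ => ENNReal.ofReal (r x * Real.log (s K x) + 1 - s K x)) atTop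
      (𝓝 (ENNReal.ofReal (InformationTheory.klFun (r x)))) := by
    intro x
    refine ENNReal.tendsto_ofReal ?_
    rcases (hr0 x).eq_or_lt with h0 | h0
    · have hs : ∀ K : ℕ, s K x = Real.exp (-K) := fun K => by
        simp only [s, ← h0]
        rw [min_eq_right (Real.exp_pos _).le, max_eq_left (Real.exp_pos _).le]
      simp_rw [hs, ← h0, InformationTheory.klFun_zero, zero_mul, zero_add]
      have : Tendsto (fun K : ℕ => 1 - Real.exp (-(K : ℝ))) atTop (𝓝 (1 - 0)) :=
        tendsto_const_nhds.sub (Real.tendsto_exp_neg_atTop_nhds_zero.comp tendsto_natCast_atTop_atTop)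
      simpa using this
    · refine tendsto_const_nhds.congr' ?_
      obtain ⟨K₁, hK₁⟩ := exists_nat_ge |Real.log (r x)|
      filter_upwards [eventually_ge_atTop K₁] with K hK
      have h1 : |Real.log (r x)| ≤ K := hK₁.trans (by exact_mod_cast hK)
      have hs : s K x = r x := by
        have h2 : r x ≤ Real.exp K := (Real.log_le_iff_le_exp h0).1 (abs_le.1 h1).2
        have h3 : Real.exp (-K) ≤ r x := (Real.le_log_iff_exp_le h0).1 (abs_le.1 h1).1
        simp only [s]
        rw [min_eq_right h2, max_eq_right h3]
      rw [hs, InformationTheory.klFun_apply]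
  -- Fatou's lemma: the truncated integrands are nonnegative and converge pointwise to `klFun r`,
  -- also where `r` vanishes.
  calc ∫⁻ x, ENNReal.ofReal (InformationTheory.klFun (r x)) ∂ν
      = ∫⁻ x, liminf (fun K : ℕ => ENNReal.ofReal (r x * Real.log (s K x) + 1 - s K x)) atTop ∂ν :=
        lintegral_congr fun x => (hlim x).liminf_eq.symm
    _ ≤ liminf (fun K : ℕ => ∫⁻ x, ENNReal.ofReal (r x * Real.log (s K x) + 1 - s K x) ∂ν) atTop :=
        lintegral_liminf_le fun K =>
          (((hrm.mul (hlogm K)).add measurable_const).sub (hsm K)).ennreal_ofReal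
    _ ≤ ENNReal.ofReal c := liminf_le_of_le (by isBoundedDefault) fun b hb => by
        obtain ⟨K, hK⟩ := hb.exists
        exact hK.trans (hbound K)

end Variational

/-! ### Semicontinuity and uniform integrability under weak convergence. -/

section WeakLimit

open scoped BoundedContinuousFunction Topology

variable {X : Type*} [TopologicalSpace X] [HasOuterApproxClosed X]
  [MeasurableSpace X] [BorelSpace X] {P : ℕ → ProbabilityMeasure X} {Q : ProbabilityMeasure X}

theorem lintegral_ofReal_le_liminf_of_tendsto (h : Tendsto P atTop (𝓝 Q)) {f : X → ℝ}
    (hf : Continuous f) (hf0 : ∀ x, 0 ≤ f x) :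
    ∫⁻ x, ENNReal.ofReal (f x) ∂(Q : Measure X)
      ≤ liminf (fun k => ∫⁻ x, ENNReal.ofReal (f x) ∂(P k : Measure X)) atTop :=
  lintegral_le_liminf_lintegral_of_forall_isOpen_measure_le_liminf_measure hf hf0 fun _ hG =>
    ProbabilityMeasure.le_liminf_measure_open_of_tendsto h hG

theorem lintegral_ofReal_le_of_tendsto (h : Tendsto P atTop (𝓝 Q)) {f : X → ℝ}
    (hf : Continuous f) (hf0 : ∀ x, 0 ≤ f x) {C : ℝ≥0∞}
    (hC : ∀ k, ∫⁻ x, ENNReal.ofReal (f x) ∂(P k : Measure X) ≤ C) :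
    ∫⁻ x, ENNReal.ofReal (f x) ∂(Q : Measure X) ≤ C :=
  (lintegral_ofReal_le_liminf_of_tendsto h hf hf0).trans
    (liminf_le_of_le (by isBoundedDefault) fun b hb => by
        obtain ⟨K, hK⟩ := hb.exists
        exact hK.trans (hC K))

/-- Integrals of nonnegative continuous functions are lower semicontinuous. -/
theorem integrable_and_integral_le_of_tendsto (h : Tendsto P atTop (𝓝 Q)) {f : X → ℝ}
    (hf : Continuous f) (hf0 : ∀ x, 0 ≤ f x) (hi : ∀ k, Integrable f (P k : Measure X))
    {c : ℕ → ℝ} {c' : ℝ} (hc : ∀ k, ∫ x, f x ∂(P k : Measure X) ≤ c k)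
    (hlim : Tendsto c atTop (𝓝 c')) :
    Integrable f (Q : Measure X) ∧ ∫ x, f x ∂(Q : Measure X) ≤ c' := by
  have hc0 : 0 ≤ c' := ge_of_tendsto' hlim fun k => (integral_nonneg hf0).trans (hc k)
  have key : ∫⁻ x, ENNReal.ofReal (f x) ∂(Q : Measure X) ≤ ENNReal.ofReal c' := by
    refine (lintegral_ofReal_le_liminf_of_tendsto h hf hf0).trans ?_
    rw [← (ENNReal.tendsto_ofReal hlim).liminf_eq]
    refine liminf_le_liminf (Eventually.of_forall fun k => ?_)
    rw [← ofReal_integral_eq_lintegral_ofReal (hi k) (Eventually.of_forall hf0)]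
    exact ENNReal.ofReal_le_ofReal (hc k)
  have hint : Integrable f (Q : Measure X) :=
    ⟨hf.aestronglyMeasurable, by
      rw [hasFiniteIntegral_iff_ofReal (Eventually.of_forall hf0)]
      exact key.trans_lt ENNReal.ofReal_lt_top⟩
  refine ⟨hint, ?_⟩
  rwa [← ofReal_integral_eq_lintegral_ofReal hint (Eventually.of_forall hf0),
    ENNReal.ofReal_le_ofReal_iff hc0] at key

omit [HasOuterApproxClosed X] in
/-- A function with square integrals at most `C` is approximated by its truncations. -/
theorem abs_integral_sub_integral_min_le {ρ : Measure X} [IsProbabilityMeasure ρ] {f : X → ℝ}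
    (hf : Continuous f) (hf0 : ∀ x, 0 ≤ f x) {C : ℝ} (hC0 : 0 ≤ C)
    (hC : ∫⁻ x, ENNReal.ofReal (f x ^ 2) ∂ρ ≤ ENNReal.ofReal C) {K : ℝ} (hK : 0 < K) :
    Integrable f ρ ∧ |∫ x, f x ∂ρ - ∫ x, min (f x) K ∂ρ| ≤ C / K := by
  have h2 : Integrable (fun x => f x ^ 2) ρ := ⟨(hf.pow 2).aestronglyMeasurable, by
    rw [hasFiniteIntegral_iff_ofReal (Eventually.of_forall fun x => sq_nonneg _)]
    exact hC.trans_lt ENNReal.ofReal_lt_top⟩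
  have h2' : ∫ x, f x ^ 2 ∂ρ ≤ C := by
    rwa [← ofReal_integral_eq_lintegral_ofReal h2 (Eventually.of_forall fun x => sq_nonneg _),
      ENNReal.ofReal_le_ofReal_iff hC0] at hC
  have hint : Integrable f ρ := by
    refine (h2.add (integrable_const 1)).mono' hf.aestronglyMeasurable
      (Eventually.of_forall fun x => ?_)
    rw [Real.norm_eq_abs, abs_of_nonneg (hf0 x)]
    simp only [Pi.add_apply]
    nlinarith [sq_nonneg (f x - 1)]
  have hmin : Integrable (fun x => min (f x) K) ρ := hint.inf (integrable_const K)
  refine ⟨hint, ?_⟩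
  rw [← integral_sub hint hmin, abs_of_nonneg (integral_nonneg fun x =>
    sub_nonneg.2 (min_le_left _ _))]
  -- Pointwise, the truncation error vanishes for `f ≤ K` and is at most `f` otherwise, hence is at
  -- most `f² / K`.
  calc ∫ x, (f x - min (f x) K) ∂ρ ≤ ∫ x, f x ^ 2 / K ∂ρ := by
        refine integral_mono (hint.sub hmin) (h2.div_const K) fun x => ?_
        rw [le_div_iff₀ hK]
        rcases le_total (f x) K with h | h
        · simp only [min_eq_left h, sub_self, zero_mul]; positivity
        · simp only [min_eq_right h]; nlinarith [hf0 x]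
    _ ≤ C / K := by
        rw [integral_div]; exact div_le_div_of_nonneg_right h2' hK.le

/-- Integrals of continuous functions with bounded second moments converge. -/
theorem tendsto_integral_of_tendsto_of_sq_le (h : Tendsto P atTop (𝓝 Q)) {f : X → ℝ}
    (hf : Continuous f) (hf0 : ∀ x, 0 ≤ f x) {C : ℝ} (hC0 : 0 ≤ C)
    (hC : ∀ k, ∫⁻ x, ENNReal.ofReal (f x ^ 2) ∂(P k : Measure X) ≤ ENNReal.ofReal C) :
    Integrable f (Q : Measure X) ∧
      Tendsto (fun k => ∫ x, f x ∂(P k : Measure X)) atTop (𝓝 (∫ x, f x ∂(Q : Measure X))) := by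
  have hCQ := lintegral_ofReal_le_of_tendsto h (hf.pow 2) (fun x => sq_nonneg _) hC
  refine ⟨(abs_integral_sub_integral_min_le hf hf0 hC0 hCQ one_pos).1, ?_⟩
  rw [Metric.tendsto_atTop]
  intro ε hε
  -- The truncation error `C / K` falls below `ε / 3`, uniformly along the sequence and in the
  -- limit; `C + 1` keeps `K` positive when `C = 0`.
  set K : ℝ := 4 * (C + 1) / ε with hKdef
  have hK : 0 < K := by positivity
  have hCK : C / K < ε / 3 := by
    rw [div_lt_iff₀ hK, hKdef]
    have : ε / 3 * (4 * (C + 1) / ε) = 4 / 3 * (C + 1) := by field_simp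
    rw [this]; linarith
  let g : X →ᵇ ℝ := BoundedContinuousFunction.ofNormedAddCommGroup
      (fun x => min (f x) K) (by fun_prop) K (fun x => by
        rw [Real.norm_eq_abs, abs_of_nonneg (le_min (hf0 x) hK.le)]
        exact min_le_right _ _)
  have hg := Metric.tendsto_atTop.1 (ProbabilityMeasure.tendsto_iff_forall_integral_tendsto.1 h g)
    (ε / 3) (by positivity)
  obtain ⟨N, hN⟩ := hg
  refine ⟨N, fun k hk => ?_⟩
  have h1 := hN k hk
  have h2 := (abs_integral_sub_integral_min_le hf hf0 hC0 (hC k) hK).2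
  have h3 := (abs_integral_sub_integral_min_le hf hf0 hC0 hCQ hK).2
  rw [Real.dist_eq] at h1 ⊢
  change |∫ x, min (f x) K ∂(P k : Measure X) - ∫ x, min (f x) K ∂(Q : Measure X)| < ε / 3 at h1
  rw [abs_lt] at h1 ⊢
  rw [abs_le] at h2 h3
  constructor <;> linarith [h1.1, h1.2, h2.1, h2.2, h3.1, h3.2]

end WeakLimit

/-! ### Product laws after a change of measure. -/

section WeightedProduct

open scoped BoundedContinuousFunction Topology

variable {X Z S : Type*} [MeasurableSpace X] [MeasurableSpace Z] [MeasurableSpace S]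

/-- With respect to the measure `w P`, the variables `A` and `H` have a product law, the second
factor being proportional to `κ`. -/
def IsWeightedProd (P : Measure X) (w : X → ℝ) (A : X → Z) (H : X → S) (κ : Measure S) : Prop :=
  ∀ (a : Z → ℝ≥0∞) (b : S → ℝ≥0∞), Measurable a → Measurable b →
    κ Set.univ * ∫⁻ x, ENNReal.ofReal (w x) * (a (A x) * b (H x)) ∂P
      = (∫⁻ x, ENNReal.ofReal (w x) * a (A x) ∂P) * ∫⁻ y, b y ∂κ

theorem IsWeightedProd.smul {P : Measure X} {w : X → ℝ} {A : X → Z} {H : X → S} {κ : Measure S}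
    (h : IsWeightedProd P w A H κ) (c : ℝ≥0∞) : IsWeightedProd (c • P) w A H κ := by
  intro a b ha hb
  rw [lintegral_smul_measure, lintegral_smul_measure, smul_eq_mul, smul_eq_mul, mul_left_comm,
    h a b ha hb, mul_assoc]

/-- Each side is linear in `P` because the measure `κ` is prescribed rather than being a marginal of
`P`. This is what allows averaging over messages and blocks. -/
theorem IsWeightedProd.sum {ι : Type*} {s : Finset ι} {P : ι → Measure X} {w : X → ℝ} {A : X → Z}
    {H : X → S} {κ : Measure S}
    (h : ∀ i ∈ s, IsWeightedProd (P i) w A H κ) : IsWeightedProd (∑ i ∈ s, P i) w A H κ := by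
  intro a b ha hb
  rw [lintegral_finsetSum_measure, lintegral_finsetSum_measure, Finset.mul_sum, Finset.sum_mul]
  exact Finset.sum_congr rfl fun i hi => h i hi a b ha hb

variable {P : Measure X} {w : X → ℝ} {A : X → Z} {H : X → S} {κ : Measure S}

theorem isFiniteMeasure_withDensity_of_le_one [IsFiniteMeasure P] (hw1 : ∀ x, w x ≤ 1) :
    IsFiniteMeasure (P.withDensity fun x => ENNReal.ofReal (w x)) :=
  isFiniteMeasure_withDensity ((lintegral_mono fun x => ENNReal.ofReal_le_one.2 (hw1 x)).trans_lt
    (by simp)).ne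

/-- Links the integral form, convenient for computing and for mixtures, with an identity of finite
measures, which can be tested on bounded continuous functions. -/
theorem isWeightedProd_iff [IsFiniteMeasure P] [IsFiniteMeasure κ] (hw : Measurable w)
    (hw1 : ∀ x, w x ≤ 1) (hA : Measurable A) (hH : Measurable H) :
    IsWeightedProd P w A H κ ↔
    κ Set.univ • (P.withDensity fun x => ENNReal.ofReal (w x)).map (fun x => (A x, H x))
      = ((P.withDensity fun x => ENNReal.ofReal (w x)).map A).prod κ := by
  have := isFiniteMeasure_withDensity_of_le_one (P := P) hw1
  have hwm : Measurable fun x => ENNReal.ofReal (w x) := hw.ennreal_ofReal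
  constructor
  · intro h
    refine (Measure.prod_eq fun s t hs ht => ?_).symm
    have h1 := h (s.indicator 1) (t.indicator 1) (measurable_one.indicator hs)
      (measurable_one.indicator ht)
    rw [lintegral_indicator_one ht] at h1
    have h2 : ∀ u : Set X, MeasurableSet u →
        (P.withDensity fun x => ENNReal.ofReal (w x)) u
          = ∫⁻ x, ENNReal.ofReal (w x) * u.indicator 1 x ∂P := by
      intro u hu
      rw [withDensity_apply _ hu, ← lintegral_indicator hu]
      refine lintegral_congr fun x => ?_
      by_cases hx : x ∈ u <;> simp [hx]
    rw [Measure.smul_apply, smul_eq_mul, Measure.map_apply (hA.prodMk hH) (hs.prod ht),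
      Measure.map_apply hA hs, h2 _ (hA hs), h2 _ ((hA.prodMk hH) (hs.prod ht))]
    convert h1 using 3
    · classical
      simp only [Set.indicator_apply, Set.mem_preimage, Set.mem_prod, Pi.one_apply]
      funext x
      split_ifs <;> simp_all
    · rfl
  · intro h a b ha hb
    have h1 := congrArg (fun ρ : Measure (Z × S) => ∫⁻ p, a p.1 * b p.2 ∂ρ) h
    rw [lintegral_smul_measure, smul_eq_mul, lintegral_map (by fun_prop) (hA.prodMk hH),
      lintegral_prod_mul ha.aemeasurable hb.aemeasurable, lintegral_map ha hA,
      lintegral_withDensity_eq_lintegral_mul _ hwm (by fun_prop),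
      lintegral_withDensity_eq_lintegral_mul _ hwm (by fun_prop)] at h1
    exact h1

/-- Product laws with a fixed factor are preserved by weak limits. -/
theorem IsWeightedProd.of_tendsto [TopologicalSpace X] [OpensMeasurableSpace X]
    [TopologicalSpace Z] [BorelSpace Z] [HasOuterApproxClosed Z]
    [TopologicalSpace S] [BorelSpace S] [HasOuterApproxClosed S] [IsFiniteMeasure κ]
    {P : ℕ → ProbabilityMeasure X} {Q : ProbabilityMeasure X} (hlim : Tendsto P atTop (𝓝 Q))
    (hw : Continuous w) (hw0 : ∀ x, 0 ≤ w x) (hw1 : ∀ x, w x ≤ 1)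
    (hwm : Measurable w) (hAm : Measurable A) (hHm : Measurable H)
    (hA : Continuous A) (hH : Continuous H)
    (h : ∀ k, IsWeightedProd (P k : Measure X) w A H κ) :
    IsWeightedProd (Q : Measure X) w A H κ := by
  rw [isWeightedProd_iff hwm hw1 hAm hHm]
  have hfin := fun ρ : ProbabilityMeasure X =>
    isFiniteMeasure_withDensity_of_le_one (P := (ρ : Measure X)) hw1
  have := hfin Q
  have hden : ∀ (ρ : ProbabilityMeasure X) (g : X → ℝ),
      ∫ x, g x ∂((ρ : Measure X).withDensity fun x => ENNReal.ofReal (w x))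
        = ∫ x, w x * g x ∂(ρ : Measure X) := by
    intro ρ g
    rw [integral_withDensity_eq_integral_toReal_smul hwm.ennreal_ofReal
      (Eventually.of_forall fun x => ENNReal.ofReal_lt_top)]
    simp_rw [ENNReal.toReal_ofReal (hw0 _), smul_eq_mul]
  have hl : ∀ (ρ : ProbabilityMeasure X) (f : Z →ᵇ ℝ) (g : S →ᵇ ℝ),
      ∫ p, f p.1 * g p.2 ∂(κ Set.univ •
        ((ρ : Measure X).withDensity fun x => ENNReal.ofReal (w x)).map (fun x => (A x, H x)))
      = (κ Set.univ).toReal * ∫ x, w x * (f (A x) * g (H x)) ∂(ρ : Measure X) := by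
    intro ρ f g
    rw [integral_smul_measure, smul_eq_mul, integral_map (hAm.prodMk hHm).aemeasurable, hden]
    exact ((f.continuous.measurable.comp measurable_fst).mul
      (g.continuous.measurable.comp measurable_snd)).aestronglyMeasurable
  have hr : ∀ (ρ : ProbabilityMeasure X) (f : Z →ᵇ ℝ) (g : S →ᵇ ℝ),
      ∫ p, f p.1 * g p.2
        ∂(((ρ : Measure X).withDensity fun x => ENNReal.ofReal (w x)).map A).prod κ
      = (∫ x, w x * f (A x) ∂(ρ : Measure X)) * ∫ y, g y ∂κ := by
    intro ρ f g
    have := hfin ρ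
    rw [integral_prod_mul (fun z => f z) (fun y => g y), integral_map hAm.aemeasurable
      f.continuous.measurable.aestronglyMeasurable, hden]
  have : IsFiniteMeasure (κ Set.univ •
      ((Q : Measure X).withDensity fun x => ENNReal.ofReal (w x)).map (fun x => (A x, H x))) :=
    Measure.smul_finite _ (measure_ne_top _ _)
  -- Products of bounded continuous functions separate finite measures on the product. Since `w` is
  -- itself bounded and continuous, both sides are integrals of bounded continuous functions under
  -- `P k` and converge.
  refine Measure.ext_of_integral_mul_boundedContinuousFunction fun f g => ?_
  rw [hl, hr]
  let W : X →ᵇ ℝ := BoundedContinuousFunction.ofNormedAddCommGroup w hw 1 fun x => by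
    rw [Real.norm_eq_abs, abs_of_nonneg (hw0 x)]; exact hw1 x
  let fA : X →ᵇ ℝ := f.compContinuous ⟨A, hA⟩
  let gH : X →ᵇ ℝ := g.compContinuous ⟨H, hH⟩
  have t1 := (ProbabilityMeasure.tendsto_iff_forall_integral_tendsto.1 hlim
    (W * (fA * gH))).const_mul (κ Set.univ).toReal
  have t2 := (ProbabilityMeasure.tendsto_iff_forall_integral_tendsto.1 hlim
    (W * fA)).mul_const (∫ y, g y ∂κ)
  refine tendsto_nhds_unique t1 (t2.congr fun k => ?_)
  have h1 := (isWeightedProd_iff hwm hw1 hAm hHm).1 (h k)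
  have h2 := hl (P k) f g
  rw [h1, hr] at h2
  exact h2

end WeightedProduct

/-! ### Density of the noise at one node. -/

section NoiseDensity

variable {T : ℕ}

/-- The law of the noise at one node in one block. -/
noncomputable def noiseLaw (T : ℕ) : Measure (Fin T → ℂ) := Measure.pi fun _ => stdComplexGaussian

instance : IsProbabilityMeasure (noiseLaw T) := by unfold noiseLaw; infer_instance

/-- The density of the noise at one node in one block. -/
noncomputable def noiseDensity (z : Fin T → ℂ) : ℝ := ∏ t, stdComplexGaussianDensity (z t)

theorem noiseDensity_pos (z : Fin T → ℂ) : 0 < noiseDensity z :=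
  Finset.prod_pos fun _ _ => stdComplexGaussianDensity_pos _

@[fun_prop]
theorem continuous_noiseDensity : Continuous (noiseDensity : (Fin T → ℂ) → ℝ) := by
  unfold noiseDensity; fun_prop

@[fun_prop]
theorem measurable_noiseDensity : Measurable (noiseDensity : (Fin T → ℂ) → ℝ) :=
  continuous_noiseDensity.measurable

theorem noiseDensity_eq (z : Fin T → ℂ) :
    noiseDensity z = Real.pi⁻¹ ^ T * Real.exp (-∑ t, ‖z t‖ ^ 2) := by
  simp [noiseDensity, stdComplexGaussianDensity, Finset.prod_mul_distrib, ← Real.exp_sum]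

theorem noiseDensity_le (z : Fin T → ℂ) : noiseDensity z ≤ Real.pi⁻¹ ^ T := by
  rw [noiseDensity_eq]
  refine mul_le_of_le_one_right (by positivity) (Real.exp_le_one_iff.2 ?_)
  simp only [Left.neg_nonpos_iff]
  positivity

theorem noiseLaw_eq_withDensity :
    noiseLaw T = volume.withDensity fun z => ENNReal.ofReal (noiseDensity z) := by
  have hs : SigmaFinite ((volume : Measure ℂ).withDensity
      fun z => ENNReal.ofReal (stdComplexGaussianDensity z)) := by
    rw [← stdComplexGaussian_eq_withDensity]; infer_instance
  rw [noiseLaw]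
  simp_rw [stdComplexGaussian_eq_withDensity]
  rw [pi_withDensity (fun _ : Fin T => (volume : Measure ℂ))
    (fun _ z => ENNReal.ofReal (stdComplexGaussianDensity z))
    fun _ => continuous_stdComplexGaussianDensity.measurable.ennreal_ofReal, volume_pi]
  congr 1
  funext z
  rw [noiseDensity, ENNReal.ofReal_prod_of_nonneg fun _ _ => (stdComplexGaussianDensity_pos _).le]

theorem lintegral_noiseLaw (F : (Fin T → ℂ) → ℝ≥0∞) (hF : Measurable F) :
    ∫⁻ w, F w ∂noiseLaw T = ∫⁻ w, ENNReal.ofReal (noiseDensity w) * F w := by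
  rw [noiseLaw_eq_withDensity, lintegral_withDensity_eq_lintegral_mul _ (by fun_prop) hF]
  rfl

theorem lintegral_noiseDensity : ∫⁻ z : Fin T → ℂ, ENNReal.ofReal (noiseDensity z) = 1 := by
  have := lintegral_noiseLaw (T := T) (fun _ => 1) measurable_const
  simpa using this.symm

end NoiseDensity

/-! ### The channel at one node: conditional output density and its tails. -/

namespace FadingNetwork

variable {V : Type*} [Fintype V] {T : ℕ} (N : FadingNetwork V)

instance (j i : V) : IsProbabilityMeasure (N.fading j i) := N.isProbabilityMeasure_fading j i

instance : IsProbabilityMeasure (N.blockLaw T) := by unfold blockLaw; infer_instance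

/-- The law of the fading coefficients of the links into `v`. -/
noncomputable def gainLaw (v : V) : Measure (V → ℂ) := Measure.pi fun j => N.fading j v

instance (v : V) : IsProbabilityMeasure (N.gainLaw v) := by unfold gainLaw; infer_instance

/-- The joint law of the fading coefficients of the links into `v` and of the noise at `v`. -/
noncomputable def nodeLaw (T : ℕ) (v : V) : Measure ((V → ℂ) × (Fin T → ℂ)) :=
  (N.gainLaw v).prod (noiseLaw T)

instance (v : V) : IsProbabilityMeasure (N.nodeLaw T v) := by unfold nodeLaw; infer_instance

open scoped Classical in
/-- The noiseless signal received by `v`. -/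
noncomputable def signal (v : V) (g : V → ℂ) (x : V → Fin T → ℂ) : Fin T → ℂ :=
  fun t => ∑ j, if N.graph.Adj j v then g j * x j t else 0

@[fun_prop]
theorem continuous_signal (v : V) :
    Continuous fun p : (V → ℂ) × (V → Fin T → ℂ) => N.signal v p.1 p.2 := by
  unfold signal
  refine continuous_pi fun t => continuous_finsetSum _ fun j _ => ?_
  split_ifs <;> fun_prop

@[fun_prop]
theorem measurable_signal (v : V) :
    Measurable fun p : (V → ℂ) × (V → Fin T → ℂ) => N.signal v p.1 p.2 := by
  unfold signal
  refine measurable_pi_lambda _ fun t => Finset.measurable_sum _ fun j _ => ?_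
  split_ifs <;> fun_prop

theorem signal_congr {v : V} {g : V → ℂ} {x x' : V → Fin T → ℂ}
    (h : ∀ j, N.graph.Adj j v → x j = x' j) : N.signal v g x = N.signal v g x' := by
  classical
  funext t
  refine Finset.sum_congr rfl fun j _ => ?_
  split_ifs with hj
  · rw [h j hj]
  · rfl

theorem recv_eq (v : V) (ω : BlockSpace V T) :
    BlockSpace.recv N v ω = N.signal v (fun j => ω.2.1 j v) ω.1 + ω.2.2 v := rfl

@[fun_prop]
theorem continuous_recv (v : V) : Continuous (BlockSpace.recv N v : BlockSpace V T → _) := by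
  have h : Continuous fun ω : BlockSpace V T => N.signal v (fun j => ω.2.1 j v) ω.1 :=
    (N.continuous_signal v).comp (by fun_prop : Continuous fun ω : BlockSpace V T =>
      ((fun j => ω.2.1 j v), ω.1))
  exact h.add (by fun_prop)

@[fun_prop]
theorem measurable_recv (v : V) : Measurable (BlockSpace.recv N v : BlockSpace V T → _) := by
  have h : Measurable fun ω : BlockSpace V T => N.signal v (fun j => ω.2.1 j v) ω.1 :=
    (N.measurable_signal v).comp (by fun_prop : Measurable fun ω : BlockSpace V T =>
      ((fun j => ω.2.1 j v), ω.1))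
  exact h.add (by fun_prop)

/-- The conditional density of the signal received by `v`, given the signals `x` sent. -/
noncomputable def outDensity (v : V) (x : V → Fin T → ℂ) (y : Fin T → ℂ) : ℝ :=
  ∫ g, noiseDensity (y - N.signal v g x) ∂N.gainLaw v

theorem measurable_noiseDensity_sub_signal (v : V) :
    Measurable fun p : ((V → Fin T → ℂ) × (Fin T → ℂ)) × (V → ℂ) =>
      noiseDensity (p.1.2 - N.signal v p.2 p.1.1) := by
  have h : Measurable fun p : ((V → Fin T → ℂ) × (Fin T → ℂ)) × (V → ℂ) =>
      N.signal v p.2 p.1.1 := (N.measurable_signal v).comp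
        (by fun_prop : Measurable fun p : ((V → Fin T → ℂ) × (Fin T → ℂ)) × (V → ℂ) =>
          (p.2, p.1.1))
  exact measurable_noiseDensity.comp (by fun_prop)

theorem integrable_noiseDensity_sub_signal (v : V) (x : V → Fin T → ℂ) (y : Fin T → ℂ) :
    Integrable (fun g => noiseDensity (y - N.signal v g x)) (N.gainLaw v) :=
  Integrable.of_bound ((N.measurable_noiseDensity_sub_signal v).comp
    (measurable_prodMk_left (x := (x, y)))).aestronglyMeasurable (Real.pi⁻¹ ^ T)
    (Eventually.of_forall fun g => by
      rw [Real.norm_eq_abs, abs_of_pos (noiseDensity_pos _)]; exact noiseDensity_le _)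

theorem ofReal_outDensity (v : V) (x : V → Fin T → ℂ) (y : Fin T → ℂ) :
    ENNReal.ofReal (N.outDensity v x y)
      = ∫⁻ g, ENNReal.ofReal (noiseDensity (y - N.signal v g x)) ∂N.gainLaw v :=
  ofReal_integral_eq_lintegral_ofReal (N.integrable_noiseDensity_sub_signal v x y)
    (Eventually.of_forall fun _ => (noiseDensity_pos _).le)

theorem outDensity_pos (v : V) (x : V → Fin T → ℂ) (y : Fin T → ℂ) : 0 < N.outDensity v x y :=
  (integral_pos_iff_support_of_nonneg (fun _ => (noiseDensity_pos _).le)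
    (N.integrable_noiseDensity_sub_signal v x y)).2 (by
      have : Function.support (fun g => noiseDensity (y - N.signal v g x)) = Set.univ :=
        Set.eq_univ_of_forall fun g => (noiseDensity_pos _).ne'
      rw [this, measure_univ]; exact one_pos)

theorem outDensity_le (v : V) (x : V → Fin T → ℂ) (y : Fin T → ℂ) :
    N.outDensity v x y ≤ Real.pi⁻¹ ^ T := by
  calc N.outDensity v x y ≤ ∫ _, Real.pi⁻¹ ^ T ∂N.gainLaw v :=
        integral_mono (N.integrable_noiseDensity_sub_signal v x y) (integrable_const _)
          fun g => noiseDensity_le _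
    _ = Real.pi⁻¹ ^ T := by simp

theorem outDensity_congr {v : V} {x x' : V → Fin T → ℂ} (y : Fin T → ℂ)
    (h : ∀ j, N.graph.Adj j v → x j = x' j) : N.outDensity v x y = N.outDensity v x' y := by
  unfold outDensity
  simp_rw [N.signal_congr h]

@[fun_prop]
theorem continuous_outDensity (v : V) :
    Continuous fun p : (V → Fin T → ℂ) × (Fin T → ℂ) => N.outDensity v p.1 p.2 := by
  refine continuous_of_dominated (bound := fun _ => Real.pi⁻¹ ^ T)
    (fun p => (N.integrable_noiseDensity_sub_signal v p.1 p.2).aestronglyMeasurable)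
    (fun p => Eventually.of_forall fun g => ?_) (integrable_const _)
    (Eventually.of_forall fun g => ?_)
  · rw [Real.norm_eq_abs, abs_of_pos (noiseDensity_pos _)]; exact noiseDensity_le _
  · refine continuous_noiseDensity.comp (continuous_snd.sub ?_)
    exact (N.continuous_signal v).comp (by fun_prop :
      Continuous fun p : (V → Fin T → ℂ) × (Fin T → ℂ) => (g, p.1))

@[fun_prop]
theorem measurable_outDensity (v : V) :
    Measurable fun p : (V → Fin T → ℂ) × (Fin T → ℂ) => N.outDensity v p.1 p.2 :=
  (N.continuous_outDensity v).measurable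

theorem lintegral_outDensity (v : V) (x : V → Fin T → ℂ) :
    ∫⁻ y, ENNReal.ofReal (N.outDensity v x y) = 1 := by
  simp_rw [N.ofReal_outDensity]
  rw [lintegral_lintegral_swap]
  · have h : ∀ g, ∫⁻ y : Fin T → ℂ, ENNReal.ofReal (noiseDensity (y - N.signal v g x)) = 1 := by
      intro g
      rw [lintegral_sub_right_eq_self (fun y => ENNReal.ofReal (noiseDensity y))]
      exact lintegral_noiseDensity
    simp_rw [h]; simp
  · exact (((N.measurable_noiseDensity_sub_signal v).comp (by fun_prop :
      Measurable fun p : (Fin T → ℂ) × (V → ℂ) => ((x, p.1), p.2))).ennreal_ofReal).aemeasurable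

open scoped Classical in
/-- Second moment of the fading coefficient of a link (zero for non-links). -/
noncomputable def linkMoment (j v : V) : ℝ≥0∞ :=
  if N.graph.Adj j v then ∫⁻ z, ‖z‖ₑ ^ 2 ∂N.fading j v else 0

omit [Fintype V] in
theorem linkMoment_lt_top (j v : V) : N.linkMoment j v < ∞ := by
  unfold linkMoment
  split_ifs with h
  · exact N.secondMoment_fading j v h
  · exact ENNReal.zero_lt_top

theorem norm_signal_sq_le (v : V) (g : V → ℂ) (x : V → Fin T → ℂ) (t : Fin T) [DecidableRel N.graph.Adj] :
    ‖N.signal v g x t‖ ^ 2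
      ≤ Fintype.card V * ∑ j, if N.graph.Adj j v then ‖g j‖ ^ 2 * ‖x j t‖ ^ 2 else 0 := by
  have h1 : ‖N.signal v g x t‖ ≤ ∑ j, if N.graph.Adj j v then ‖g j‖ * ‖x j t‖ else 0 := by
    refine (norm_sum_le _ _).trans (Finset.sum_le_sum fun j _ => ?_)
    split_ifs <;> simp
  calc ‖N.signal v g x t‖ ^ 2 ≤ (∑ j, if N.graph.Adj j v then ‖g j‖ * ‖x j t‖ else 0) ^ 2 :=
        pow_le_pow_left₀ (norm_nonneg _) h1 2
    _ ≤ Fintype.card V * ∑ j, (if N.graph.Adj j v then ‖g j‖ * ‖x j t‖ else 0) ^ 2 := by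
        simpa using sq_sum_le_card_mul_sum_sq (s := (Finset.univ : Finset V))
          (f := fun j => if N.graph.Adj j v then ‖g j‖ * ‖x j t‖ else 0)
    _ = _ := by
        congr 1
        refine Finset.sum_congr rfl fun j _ => ?_
        split_ifs
        · rw [mul_pow]
        · simp

theorem integral_norm_sq_gain (j v : V) (h : N.graph.Adj j v) :
    Integrable (fun g : V → ℂ => ‖g j‖ ^ 2) (N.gainLaw v) ∧
      ∫ g, ‖g j‖ ^ 2 ∂N.gainLaw v = (N.linkMoment j v).toReal := by
  have hmp : MeasurePreserving (fun g : V → ℂ => g j) (N.gainLaw v) (N.fading j v) :=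
    measurePreserving_eval (fun j => N.fading j v) j
  have h1 : ∫⁻ g : V → ℂ, ENNReal.ofReal (‖g j‖ ^ 2) ∂N.gainLaw v = N.linkMoment j v := by
    rw [linkMoment, if_pos h, ← hmp.lintegral_comp (by fun_prop : Measurable fun z : ℂ => ‖z‖ₑ ^ 2)]
    refine lintegral_congr fun g => ?_
    rw [ENNReal.ofReal_pow (norm_nonneg _), ofReal_norm]
  have hi : Integrable (fun g : V → ℂ => ‖g j‖ ^ 2) (N.gainLaw v) := by
    refine ⟨(by fun_prop : Measurable fun g : V → ℂ => ‖g j‖ ^ 2).aestronglyMeasurable, ?_⟩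
    rw [hasFiniteIntegral_iff_ofReal (Eventually.of_forall fun g => sq_nonneg _), h1]
    exact N.linkMoment_lt_top j v
  refine ⟨hi, ?_⟩
  rw [integral_eq_lintegral_of_nonneg_ae (Eventually.of_forall fun g => sq_nonneg _)
    hi.aestronglyMeasurable, h1]

/-- The conditional density has Gaussian tails. -/
theorem neg_log_outDensity_le (v : V) (x : V → Fin T → ℂ) (y : Fin T → ℂ) :
    -Real.log (N.outDensity v x y) ≤ T * Real.log Real.pi
      + ∑ t, (2 * ‖y t‖ ^ 2
        + 2 * (Fintype.card V * ∑ j, (N.linkMoment j v).toReal * ‖x j t‖ ^ 2)) := by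
  classical
  -- An upper bound for the exponent `∑ ‖y - signal‖²`, from `‖a - b‖² ≤ 2‖a‖² + 2‖b‖²` and
  -- Cauchy-Schwarz over the incoming links. It is affine in the squared gains, so its mean involves
  -- only second moments of the fading.
  let H : (V → ℂ) → ℝ := fun g => ∑ t, (2 * ‖y t‖ ^ 2
    + 2 * (Fintype.card V * ∑ j, if N.graph.Adj j v then ‖g j‖ ^ 2 * ‖x j t‖ ^ 2 else 0))
  have hint1 : ∀ (t : Fin T) (j : V), Integrable (fun g : V → ℂ =>
      if N.graph.Adj j v then ‖g j‖ ^ 2 * ‖x j t‖ ^ 2 else 0) (N.gainLaw v) := by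
    intro t j
    split_ifs with h
    · exact (N.integral_norm_sq_gain j v h).1.mul_const _
    · exact integrable_zero _ _ _
  have hint2 : ∀ t : Fin T, Integrable (fun g : V → ℂ => 2 * ‖y t‖ ^ 2
    + 2 * (Fintype.card V * ∑ j, if N.graph.Adj j v then ‖g j‖ ^ 2 * ‖x j t‖ ^ 2 else 0))
      (N.gainLaw v) := fun t =>
    (integrable_const _).add (((integrable_finsetSum _ fun j _ => hint1 t j).const_mul _).const_mul _)
  have hH : Integrable H (N.gainLaw v) := integrable_finsetSum _ fun t _ => hint2 t
  have hHint : ∫ g, H g ∂N.gainLaw v = ∑ t, (2 * ‖y t‖ ^ 2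
        + 2 * (Fintype.card V * ∑ j, (N.linkMoment j v).toReal * ‖x j t‖ ^ 2)) := by
    rw [integral_finsetSum _ fun t _ => hint2 t]
    refine Finset.sum_congr rfl fun t _ => ?_
    rw [integral_add (integrable_const _)
      (((integrable_finsetSum _ fun j _ => hint1 t j).const_mul _).const_mul _), integral_const_mul,
      integral_const_mul, integral_const_mul, integral_finsetSum _ fun j _ => hint1 t j]
    simp only [integral_const, probReal_univ, smul_eq_mul, one_mul]
    congr 3
    refine Finset.sum_congr rfl fun j _ => ?_
    by_cases h : N.graph.Adj j v
    · simp only [h, if_true]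
      rw [integral_mul_const, (N.integral_norm_sq_gain j v h).2]
    · simp [h, linkMoment]
  have hle : ∀ g, Real.pi⁻¹ ^ T * Real.exp (-H g) ≤ noiseDensity (y - N.signal v g x) := by
    intro g
    rw [noiseDensity_eq]
    refine mul_le_mul_of_nonneg_left (Real.exp_le_exp.2 (neg_le_neg ?_)) (by positivity)
    refine Finset.sum_le_sum fun t _ => ?_
    have h1 := N.norm_signal_sq_le v g x t
    have h2 : ‖(y - N.signal v g x) t‖ ≤ ‖y t‖ + ‖N.signal v g x t‖ := norm_sub_le _ _
    have h3 := norm_nonneg ((y - N.signal v g x) t)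
    nlinarith [sq_nonneg (‖y t‖ - ‖N.signal v g x t‖)]
  have hexpi : Integrable (fun g => Real.exp (-H g)) (N.gainLaw v) := by
    refine Integrable.of_bound (Real.continuous_exp.measurable.comp_aemeasurable
      hH.neg.aestronglyMeasurable.aemeasurable).aestronglyMeasurable 1
      (Eventually.of_forall fun g => ?_)
    rw [Real.norm_eq_abs, abs_of_pos (Real.exp_pos _)]
    refine Real.exp_le_one_iff.2 (neg_nonpos.2 (Finset.sum_nonneg fun t _ => ?_))
    have : 0 ≤ ∑ j, if N.graph.Adj j v then ‖g j‖ ^ 2 * ‖x j t‖ ^ 2 else 0 :=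
      Finset.sum_nonneg fun j _ => by split_ifs <;> positivity
    positivity
  -- Jensen's inequality moves the average over the fading into the exponent.
  have hjensen : Real.exp (∫ g, -H g ∂N.gainLaw v) ≤ ∫ g, Real.exp (-H g) ∂N.gainLaw v :=
    convexOn_exp.map_integral_le Real.continuous_exp.continuousOn isClosed_univ
      (Eventually.of_forall fun _ => Set.mem_univ _) hH.neg hexpi
  have hmain : Real.pi⁻¹ ^ T * Real.exp (-∫ g, H g ∂N.gainLaw v) ≤ N.outDensity v x y := by
    rw [integral_neg] at hjensen
    calc _ ≤ Real.pi⁻¹ ^ T * ∫ g, Real.exp (-H g) ∂N.gainLaw v :=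
          mul_le_mul_of_nonneg_left hjensen (by positivity)
      _ = ∫ g, Real.pi⁻¹ ^ T * Real.exp (-H g) ∂N.gainLaw v := (integral_const_mul _ _).symm
      _ ≤ _ := integral_mono (hexpi.const_mul _) (N.integrable_noiseDensity_sub_signal v x y) hle
  have hlog := Real.log_le_log (by positivity) hmain
  rw [Real.log_mul (by positivity) (Real.exp_pos _).ne', Real.log_pow, Real.log_inv,
    Real.log_exp, hHint] at hlog
  linarith

end FadingNetwork

theorem IsWeightedProd.comp_left {X Z Z' S : Type*} [MeasurableSpace X] [MeasurableSpace Z]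
    [MeasurableSpace Z'] [MeasurableSpace S] {P : Measure X} {w : X → ℝ} {A : X → Z} {H : X → S}
    {κ : Measure S} (h : IsWeightedProd P w A H κ) {φ : Z → Z'} (hφ : Measurable φ) :
    IsWeightedProd P w (fun x => φ (A x)) H κ :=
  fun a b ha hb => h (fun z => a (φ z)) b (ha.comp hφ) hb

/-- A product law with trivial weight. -/
theorem IsWeightedProd.map_eq_prod {X Z S : Type*} [MeasurableSpace X] [MeasurableSpace Z]
    [MeasurableSpace S] {P : Measure X} [IsFiniteMeasure P] {A : X → Z} {H : X → S}
    {κ : Measure S} [IsProbabilityMeasure κ] (h : IsWeightedProd P (fun _ => 1) A H κ)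
    (hA : Measurable A) (hH : Measurable H) :
    P.map (fun x => (A x, H x)) = (P.map A).prod κ := by
  have h1 := (isWeightedProd_iff measurable_const (fun _ => le_rfl) hA hH).1 h
  simp only [measure_univ, one_smul, ENNReal.ofReal_one] at h1
  rwa [show (fun _ : X => (1 : ℝ≥0∞)) = 1 from rfl, withDensity_one] at h1

instance {V : Type*} [Fintype V] {T : ℕ} : BorelSpace (BlockSpace V T) := Prod.borelSpace

instance {V : Type*} [Fintype V] {T : ℕ} : OpensMeasurableSpace (BlockSpace V T) :=
  BorelSpace.opensMeasurable

/-! ### Block laws under feedback, in a form closed under mixtures and weak limits. -/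

namespace FadingNetwork

variable {V : Type*} [Fintype V] {T : ℕ} (N : FadingNetwork V)

/-- The nodes to which no signal can flow from `i`. -/
def unreachable (i : V) : Set V := {j | ¬ Relation.ReflTransGen N.graph.Adj i j}

omit [Fintype V] in
theorem mem_unreachable_of_adj {j i : V} (h : N.graph.Adj j i) : j ∈ N.unreachable i := by
  intro h'
  exact N.acyclic i (Relation.TransGen.tail' h' h)

/-- The fading coefficients of the links into `i` and the noise at `i`. -/
def nodeChannel (i : V) (ω : BlockSpace V T) : (V → ℂ) × (Fin T → ℂ) :=
  ((fun j => ω.2.1 j i), ω.2.2 i)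

/-- The signals sent and received by a set of nodes. -/
noncomputable def signals (S : Set V) (ω : BlockSpace V T) :
    (S → Fin T → ℂ) × (S → Fin T → ℂ) :=
  (BlockSpace.X S ω, BlockSpace.Y N S ω)

omit [Fintype V] in
@[fun_prop]
theorem continuous_X (S : Set V) :
    Continuous (BlockSpace.X S : BlockSpace V T → S → Fin T → ℂ) := by
  unfold BlockSpace.X; fun_prop

omit [Fintype V] in
@[fun_prop]
theorem measurable_X (S : Set V) :
    Measurable (BlockSpace.X S : BlockSpace V T → S → Fin T → ℂ) := by
  unfold BlockSpace.X; fun_prop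

@[fun_prop]
theorem continuous_Y (S : Set V) :
    Continuous (BlockSpace.Y N S : BlockSpace V T → S → Fin T → ℂ) :=
  continuous_pi fun v => N.continuous_recv v

@[fun_prop]
theorem measurable_Y (S : Set V) :
    Measurable (BlockSpace.Y N S : BlockSpace V T → S → Fin T → ℂ) :=
  measurable_pi_lambda _ fun v => N.measurable_recv v

omit [Fintype V] in
@[fun_prop]
theorem continuous_nodeChannel (i : V) :
    Continuous (nodeChannel i : BlockSpace V T → (V → ℂ) × (Fin T → ℂ)) := by
  unfold nodeChannel; fun_prop

omit [Fintype V] in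
@[fun_prop]
theorem measurable_nodeChannel (i : V) :
    Measurable (nodeChannel i : BlockSpace V T → (V → ℂ) × (Fin T → ℂ)) := by
  unfold nodeChannel; fun_prop

/-- The symbols sent at time `t`, with everything sent and received before. -/
noncomputable def pastAndSent (t : Fin T) (ω : BlockSpace V T) :
    (V → {u : Fin T // u < t} → ℂ × ℂ) × (V → ℂ) :=
  (BlockSpace.past N t ω, fun v => ω.1 v t)

/-- The fading coefficients and the noise from time `t` on. -/
def gainAndFuture (t : Fin T) (b : (V → V → ℂ) × (V → Fin T → ℂ)) :
    (V → V → ℂ) × (V → {u : Fin T // t ≤ u} → ℂ) :=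
  (b.1, fun v u => b.2 v u)

/-- A weight that makes the likelihood of the past integrable: contribution of the fading. -/
noncomputable def gainWeight (T : ℕ) (g : V → V → ℂ) : ℝ :=
  Real.exp (-(T * (Fintype.card V * ∑ v, ∑ j, ‖g j v‖ ^ 4)))

/-- A weight that makes the likelihood of the past integrable: contribution of the past. -/
noncomputable def pastWeight {t : Fin T} (p : V → {u : Fin T // u < t} → ℂ × ℂ) : ℝ :=
  Real.exp (-∑ u, ∑ v, (2 * ‖(p v u).2‖ ^ 2 + Fintype.card V * ∑ j, ‖(p j u).1‖ ^ 4))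

open scoped Classical in
/-- The noise before time `t`, as a function of the past and of the fading. -/
noncomputable def pastNoise {t : Fin T} (p : V → {u : Fin T // u < t} → ℂ × ℂ)
    (g : V → V → ℂ) (v : V) (u : {u : Fin T // u < t}) : ℂ :=
  (p v u).2 - ∑ j, if N.graph.Adj j v then g j v * (p j u).1 else 0

/-- The inverse likelihood of the past, multiplied by weights that make it bounded. -/
noncomputable def likelihoodWeight {t : Fin T} (p : V → {u : Fin T // u < t} → ℂ × ℂ)
    (g : V → V → ℂ) : ℝ :=
  Real.exp (∑ u, ∑ v, ‖N.pastNoise p g v u‖ ^ 2) * pastWeight p * gainWeight T g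

theorem pastNoise_past (t : Fin T) (ω : BlockSpace V T) (v : V) (u : {u : Fin T // u < t}) :
    N.pastNoise (BlockSpace.past N t ω) ω.2.1 v u = ω.2.2 v u := by
  simp [pastNoise, BlockSpace.past, BlockSpace.recv, channel]

theorem likelihoodWeight_pos {t : Fin T} (p : V → {u : Fin T // u < t} → ℂ × ℂ)
    (g : V → V → ℂ) : 0 < N.likelihoodWeight p g :=
  mul_pos (mul_pos (Real.exp_pos _) (Real.exp_pos _)) (Real.exp_pos _)

/-- The exponent `‖noise‖²` contains products of gains and sent symbols. Cauchy-Schwarz and `2a²b² ≤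
a⁴ + b⁴` separate them, which is where the fourth powers in the two damping weights come from. The
factor `T` in `gainWeight` bounds the number of earlier symbol times. -/
theorem likelihoodWeight_le_one {t : Fin T} (p : V → {u : Fin T // u < t} → ℂ × ℂ)
    (g : V → V → ℂ) : N.likelihoodWeight p g ≤ 1 := by
  classical
  unfold likelihoodWeight pastWeight gainWeight
  rw [← Real.exp_add, ← Real.exp_add]
  refine Real.exp_le_one_iff.2 ?_
  have hb : ∀ v u, ‖N.pastNoise p g v u‖ ^ 2 ≤ (2 * ‖(p v u).2‖ ^ 2
      + Fintype.card V * ∑ j, ‖(p j u).1‖ ^ 4) + Fintype.card V * ∑ j, ‖g j v‖ ^ 4 := by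
    intro v u
    set s := ∑ j, if N.graph.Adj j v then g j v * (p j u).1 else 0 with hs
    have h1 : ‖s‖ ≤ ∑ j, ‖g j v‖ * ‖(p j u).1‖ := by
      refine (norm_sum_le _ _).trans (Finset.sum_le_sum fun j _ => ?_)
      split_ifs
      · rw [norm_mul]
      · rw [norm_zero]; positivity
    have h2 : ‖s‖ ^ 2 ≤ Fintype.card V * ∑ j, (‖g j v‖ * ‖(p j u).1‖) ^ 2 :=
      (pow_le_pow_left₀ (norm_nonneg _) h1 2).trans (by
        simpa using sq_sum_le_card_mul_sum_sq (s := (Finset.univ : Finset V))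
          (f := fun j => ‖g j v‖ * ‖(p j u).1‖))
    have h3 : 2 * ∑ j, (‖g j v‖ * ‖(p j u).1‖) ^ 2
        ≤ ∑ j, ‖(p j u).1‖ ^ 4 + ∑ j, ‖g j v‖ ^ 4 := by
      rw [Finset.mul_sum, ← Finset.sum_add_distrib]
      refine Finset.sum_le_sum fun j _ => ?_
      nlinarith [sq_nonneg (‖g j v‖ ^ 2 - ‖(p j u).1‖ ^ 2)]
    have h4 : ‖N.pastNoise p g v u‖ ≤ ‖(p v u).2‖ + ‖s‖ := norm_sub_le _ _
    have h5 : ‖N.pastNoise p g v u‖ ^ 2 ≤ 2 * ‖(p v u).2‖ ^ 2 + 2 * ‖s‖ ^ 2 := by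
      nlinarith [norm_nonneg (N.pastNoise p g v u), sq_nonneg (‖(p v u).2‖ - ‖s‖)]
    have h6 : (0 : ℝ) ≤ Fintype.card V := Nat.cast_nonneg _
    nlinarith [mul_le_mul_of_nonneg_left h3 h6]
  have hc : ∑ _u : {u : Fin T // u < t}, ∑ v, (Fintype.card V * ∑ j, ‖g j v‖ ^ 4 : ℝ)
      ≤ T * (Fintype.card V * ∑ v, ∑ j, ‖g j v‖ ^ 4) := by
    rw [Finset.sum_const, Finset.card_univ, nsmul_eq_mul, ← Finset.mul_sum]
    refine mul_le_mul_of_nonneg_right ?_ (by positivity)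
    have := Fintype.card_subtype_le (fun u : Fin T => u < t)
    rw [Fintype.card_fin] at this
    exact_mod_cast this
  have ha : ∑ u, ∑ v, ‖N.pastNoise p g v u‖ ^ 2 ≤
      ∑ u, ∑ v, (2 * ‖(p v u).2‖ ^ 2 + Fintype.card V * ∑ j, ‖(p j u).1‖ ^ 4)
      + ∑ _u : {u : Fin T // u < t}, ∑ v, (Fintype.card V * ∑ j, ‖g j v‖ ^ 4 : ℝ) := by
    rw [← Finset.sum_add_distrib]
    refine Finset.sum_le_sum fun u _ => ?_
    rw [← Finset.sum_add_distrib]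
    exact Finset.sum_le_sum fun v _ => hb v u
  linarith

@[fun_prop]
theorem continuous_likelihoodWeight {t : Fin T} :
    Continuous fun p : (V → {u : Fin T // u < t} → ℂ × ℂ) × (V → V → ℂ) =>
      N.likelihoodWeight p.1 p.2 := by
  have h : ∀ v u, Continuous fun p : (V → {u : Fin T // u < t} → ℂ × ℂ) × (V → V → ℂ) =>
      N.pastNoise p.1 p.2 v u := by
    intro v u
    unfold pastNoise
    refine Continuous.sub (by fun_prop) (continuous_finsetSum _ fun j _ => ?_)
    split_ifs <;> fun_prop
  unfold likelihoodWeight pastWeight gainWeight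
  fun_prop

@[fun_prop]
theorem measurable_likelihoodWeight {t : Fin T} :
    Measurable fun p : (V → {u : Fin T // u < t} → ℂ × ℂ) × (V → V → ℂ) =>
      N.likelihoodWeight p.1 p.2 := N.continuous_likelihoodWeight.measurable

/-- The weighted law of the fading and of the future noise. -/
noncomputable def futureLaw (t : Fin T) :
    Measure ((V → V → ℂ) × (V → {u : Fin T // t ≤ u} → ℂ)) :=
  ((N.blockLaw T).withDensity fun b => ENNReal.ofReal (gainWeight T b.1)).map (gainAndFuture t)

theorem gainWeight_le_one (g : V → V → ℂ) : gainWeight T g ≤ 1 :=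
  Real.exp_le_one_iff.2 (by simp only [Left.neg_nonpos_iff]; positivity)

@[fun_prop]
theorem measurable_gainWeight : Measurable (gainWeight T : (V → V → ℂ) → ℝ) := by
  unfold gainWeight; fun_prop

omit [Fintype V] in
@[fun_prop]
theorem measurable_gainAndFuture (t : Fin T) : Measurable (gainAndFuture (V := V) t) := by
  unfold gainAndFuture; fun_prop

instance (t : Fin T) : IsFiniteMeasure (N.futureLaw t) := by
  have := isFiniteMeasure_withDensity_of_le_one (P := N.blockLaw T)
    (w := fun b => gainWeight T b.1) fun b => gainWeight_le_one b.1
  unfold futureLaw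
  infer_instance

theorem lintegral_futureLaw (t : Fin T)
    (b : (V → V → ℂ) × (V → {u : Fin T // t ≤ u} → ℂ) → ℝ≥0∞) (hb : Measurable b) :
    ∫⁻ h, b h ∂N.futureLaw t
      = ∫⁻ x, ENNReal.ofReal (gainWeight T x.1) * b (gainAndFuture t x) ∂N.blockLaw T := by
  rw [futureLaw, lintegral_map hb (by fun_prop),
    lintegral_withDensity_eq_lintegral_mul _ (by fun_prop) (by fun_prop)]
  rfl

theorem futureLaw_univ_ne_zero (t : Fin T) : N.futureLaw t Set.univ ≠ 0 := by
  rw [← lintegral_one, N.lintegral_futureLaw t _ measurable_const, ne_eq,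
    lintegral_eq_zero_iff (by fun_prop)]
  intro h
  have h1 : ∀ᵐ x ∂N.blockLaw T, False := h.mono fun x hx => by
    simp only [mul_one, Pi.zero_apply, ENNReal.ofReal_eq_zero] at hx
    exact absurd hx (not_le.2 (Real.exp_pos _))
  rw [eventually_false_iff_eq_bot, ae_eq_bot] at h1
  exact IsProbabilityMeasure.ne_zero _ h1

/-- The laws of one block that arise from operating the network, described by conditions which
are preserved by mixtures and by weak limits. -/
structure IsFeedbackLaw (P : Measure (BlockSpace V T)) : Prop where
  map_channel : P.map (fun ω => ω.2) = N.blockLaw T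
  power : ∀ v, ∑ t, ∫⁻ ω, ‖ω.1 v t‖ₑ ^ 2 ∂P ≤ T
  -- Given the fading, the past has a likelihood proportional to `exp (-‖past noise‖²)`. Dividing by
  -- it decouples the past and the symbols sent at `t` from the fading. The factors `pastWeight` and
  -- `gainWeight` each involve only one of the two sides, so they keep the product structure while
  -- making the weight bounded.
  time : ∀ t : Fin T, IsWeightedProd P
    (fun ω => N.likelihoodWeight (BlockSpace.past N t ω) ω.2.1) (N.pastAndSent t)
    (fun ω => gainAndFuture t ω.2) (N.futureLaw t)
  node : ∀ i : V, IsWeightedProd P (fun _ => 1) (N.signals (N.unreachable i)) (nodeChannel i)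
    (N.nodeLaw T i)

theorem continuous_past (t : Fin T) : Continuous (BlockSpace.past N t : BlockSpace V T → _) := by
  refine continuous_pi fun v => continuous_pi fun u => Continuous.prodMk (by fun_prop) ?_
  exact (continuous_apply (u : Fin T)).comp (N.continuous_recv v)

theorem continuous_pastAndSent (t : Fin T) : Continuous (N.pastAndSent (T := T) t) :=
  (N.continuous_past t).prodMk (by fun_prop)

theorem measurable_pastAndSent (t : Fin T) : Measurable (N.pastAndSent (T := T) t) :=
  (BlockSpace.measurable_past N t).prodMk (by fun_prop)

theorem continuous_likelihoodWeight_past (t : Fin T) : Continuous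
    fun ω : BlockSpace V T => N.likelihoodWeight (BlockSpace.past N t ω) ω.2.1 :=
  N.continuous_likelihoodWeight.comp
    (f := fun ω : BlockSpace V T => (BlockSpace.past N t ω, ω.2.1))
    ((N.continuous_past t).prodMk (continuous_fst.comp continuous_snd))

theorem measurable_likelihoodWeight_past (t : Fin T) : Measurable
    fun ω : BlockSpace V T => N.likelihoodWeight (BlockSpace.past N t ω) ω.2.1 :=
  N.measurable_likelihoodWeight.comp
    (f := fun ω : BlockSpace V T => (BlockSpace.past N t ω, ω.2.1))
    ((BlockSpace.measurable_past N t).prodMk (measurable_fst.comp measurable_snd))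

-- The channel marginal is continuous in the law, power is lower semicontinuous, and the two
-- causality conditions are product identities with continuous weights bounded by one.
open scoped Topology in
theorem IsFeedbackLaw.of_tendsto {P : ℕ → ProbabilityMeasure (BlockSpace V T)}
    {Q : ProbabilityMeasure (BlockSpace V T)} (hlim : Tendsto P atTop (𝓝 Q))
    (h : ∀ k, N.IsFeedbackLaw (P k : Measure (BlockSpace V T))) :
    N.IsFeedbackLaw (Q : Measure (BlockSpace V T)) where
  map_channel := by
    have h1 := ProbabilityMeasure.tendsto_map_of_tendsto_of_continuous P Q hlim
      (f := fun ω : BlockSpace V T => ω.2) continuous_snd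
    have h2 : ∀ k, (P k).map continuous_snd.measurable.aemeasurable
        = (⟨N.blockLaw T, inferInstance⟩ : ProbabilityMeasure _) := fun k =>
      Subtype.ext (h k).map_channel
    simp_rw [h2] at h1
    have h3 := tendsto_nhds_unique h1 tendsto_const_nhds
    exact congrArg Subtype.val h3
  power v := by
    have hrw : ∀ ρ : Measure (BlockSpace V T), ∑ t, ∫⁻ ω, ‖ω.1 v t‖ₑ ^ 2 ∂ρ
        = ∫⁻ ω, ENNReal.ofReal (∑ t, ‖ω.1 v t‖ ^ 2) ∂ρ := by
      intro ρ
      rw [← lintegral_finsetSum _ fun t _ => by fun_prop]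
      refine lintegral_congr fun ω => ?_
      rw [ENNReal.ofReal_sum_of_nonneg fun t _ => sq_nonneg _]
      refine Finset.sum_congr rfl fun t _ => ?_
      rw [ENNReal.ofReal_pow (norm_nonneg _), ofReal_norm]
    rw [hrw]
    refine lintegral_ofReal_le_of_tendsto hlim (by fun_prop)
      (fun ω => Finset.sum_nonneg fun t _ => sq_nonneg _) fun k => ?_
    rw [← hrw]
    exact (h k).power v
  time t := by
    exact IsWeightedProd.of_tendsto hlim (N.continuous_likelihoodWeight_past t)
      (fun ω => (N.likelihoodWeight_pos _ _).le) (fun ω => N.likelihoodWeight_le_one _ _)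
      (N.measurable_likelihoodWeight_past t) (N.measurable_pastAndSent t)
      (by fun_prop) (N.continuous_pastAndSent t)
      (by unfold gainAndFuture; fun_prop) fun k => (h k).time t
  node i := IsWeightedProd.of_tendsto hlim continuous_const (fun _ => zero_le_one)
    (fun _ => le_rfl) measurable_const
    ((measurable_X _).prodMk (N.measurable_Y _)) (measurable_nodeChannel i)
    ((continuous_X _).prodMk (N.continuous_Y _)) (continuous_nodeChannel i) fun k => (h k).node i

end FadingNetwork

/-! ### Conditional independence from a weighted product law. -/

section CondIndep

variable {Ω γ β β' S : Type*} [MeasurableSpace Ω] [StandardBorelSpace Ω] [MeasurableSpace γ]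
  [MeasurableSpace β] [StandardBorelSpace β] [Nonempty β] [MeasurableSpace β']
  [StandardBorelSpace β'] [Nonempty β'] [MeasurableSpace S]

/-- If `(k, f)` is independent of `H` after a change of measure whose density depends only on
`k` and `H`, then `f` is conditionally independent of all functions of `k` and `H`, given `k`. -/
theorem condIndepFun_of_isWeightedProd {P : Measure Ω} [IsProbabilityMeasure P] {k : Ω → γ}
    {f : Ω → β} {H : Ω → S} {κ : Measure S} [IsFiniteMeasure κ] (hκ : κ Set.univ ≠ 0)
    {w : γ × S → ℝ} (hwm : Measurable w) (hw0 : ∀ p, 0 < w p) (hw1 : ∀ p, w p ≤ 1)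
    (hk : Measurable k) (hf : Measurable f) (hH : Measurable H)
    (h : IsWeightedProd P (fun ω => w (k ω, H ω)) (fun ω => (k ω, f ω)) H κ)
    {θ : γ × S → β'} (hθ : Measurable θ) :
    CondIndepFun (MeasurableSpace.comap k inferInstance) hk.comap_le f
      (fun ω => θ (k ω, H ω)) P := by
  have hwk : Measurable fun ω => w (k ω, H ω) := hwm.comp (hk.prodMk hH)
  have := isFiniteMeasure_withDensity_of_le_one (P := P) (w := fun ω => w (k ω, H ω))
    fun ω => hw1 _
  set Pw := P.withDensity fun ω => ENNReal.ofReal (w (k ω, H ω)) with hPw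
  have hmap := (isWeightedProd_iff hwk (fun ω => hw1 _) (hk.prodMk hf) hH).1 h
  set Q := Pw.map fun ω => (k ω, f ω) with hQ
  -- The conditional law of `f` given `k` under the weighted measure. Since the weight is a function
  -- of `(k, H)`, removing it leaves the conditional law of `f` given `(k, H)` unchanged.
  set η := Q.condKernel with hη
  have hQη : Q.fst ⊗ₘ η = Q := Q.disintegrate η
  have key : ∀ F : γ × β × S → ℝ≥0∞, Measurable F →
      κ Set.univ * ∫⁻ ω, F (k ω, f ω, H ω) ∂P
        = ∫⁻ p, (∫⁻ x, F (p.1, x, p.2) ∂η p.1) * (ENNReal.ofReal (w p))⁻¹ ∂(Q.fst.prod κ) := by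
    intro F hF
    have e1 : ∫⁻ ω, F (k ω, f ω, H ω) ∂P
        = ∫⁻ ω, F (k ω, f ω, H ω) * (ENNReal.ofReal (w (k ω, H ω)))⁻¹ ∂Pw := by
      rw [hPw, lintegral_withDensity_eq_lintegral_mul _ hwk.ennreal_ofReal (by fun_prop)]
      refine lintegral_congr fun ω => ?_
      simp only [Pi.mul_apply]
      rw [mul_left_comm, ENNReal.mul_inv_cancel (by simpa using hw0 _) ENNReal.ofReal_ne_top,
        mul_one]
    have hF0 : Measurable fun p : γ × S => ∫⁻ x, F (p.1, x, p.2) ∂η p.1 :=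
      Measurable.lintegral_kernel_prod_right' (κ := η.comap (fun p : γ × S => p.1) (by fun_prop))
        (f := fun q : (γ × S) × β => F (q.1.1, q.2, q.1.2)) (by fun_prop)
    have hF1 : Measurable fun p : γ × S =>
        (∫⁻ x, F (p.1, x, p.2) ∂η p.1) * (ENNReal.ofReal (w p))⁻¹ := hF0.mul (by fun_prop)
    have e2 := congrArg (fun ρ : Measure ((γ × β) × S) =>
      ∫⁻ p, F (p.1.1, p.1.2, p.2) * (ENNReal.ofReal (w (p.1.1, p.2)))⁻¹ ∂ρ) hmap
    rw [lintegral_smul_measure, smul_eq_mul, lintegral_map (by fun_prop) (by fun_prop)] at e2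
    rw [e1, e2, lintegral_prod_symm' _ (by fun_prop),
      lintegral_prod_symm' _ hF1]
    refine lintegral_congr fun s => ?_
    rw [← hQη, Measure.lintegral_compProd (by fun_prop), Measure.fst_compProd]
    refine lintegral_congr fun a => ?_
    exact lintegral_mul_const (μ := η a) (ENNReal.ofReal (w (a, s)))⁻¹ (f := fun x => F (a, x, s))
      (by fun_prop)
  -- Applying `key` to `F` and to its average over `η` gives the same right-hand side, and the
  -- finite nonzero factor `κ univ` cancels.
  have key' : ∀ F : γ × β × S → ℝ≥0∞, Measurable F →
      ∫⁻ ω, F (k ω, f ω, H ω) ∂P = ∫⁻ ω, ∫⁻ x, F (k ω, x, H ω) ∂η (k ω) ∂P := by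
    intro F hF
    have hFm : Measurable fun p : γ × β × S => ∫⁻ x, F (p.1, x, p.2.2) ∂η p.1 :=
      Measurable.lintegral_kernel_prod_right' (κ := η.comap (fun p : γ × β × S => p.1) (by fun_prop))
        (f := fun q : (γ × β × S) × β => F (q.1.1, q.2, q.1.2.2)) (by fun_prop)
    have e1 := key F hF
    have e2 := key _ hFm
    simp only [lintegral_const, measure_univ, mul_one] at e2
    rw [← e1] at e2
    exact ((ENNReal.mul_right_inj hκ (measure_ne_top _ _)).1 e2).symm
  set g := fun ω => θ (k ω, H ω) with hg
  have hgm : Measurable g := hθ.comp (hk.prodMk hH)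
  -- The same kernel `η` serves given `k` and given `(k, g)`, which is the claimed conditional
  -- independence.
  have c1 : condDistrib f k P =ᵐ[P.map k] η := by
    rw [condDistrib_ae_eq_iff_measure_eq_compProd k hf.aemeasurable]
    refine Measure.ext_of_lintegral _ fun F hF => ?_
    rw [lintegral_map hF (by fun_prop), Measure.lintegral_compProd hF,
      lintegral_map (by fun_prop) hk]
    exact key' (fun p => F (p.1, p.2.1)) (by fun_prop)
  have c2 : condDistrib f (fun ω => (k ω, g ω)) P =ᵐ[P.map fun ω => (k ω, g ω)]
      η.prodMkRight β' := by
    rw [condDistrib_ae_eq_iff_measure_eq_compProd _ hf.aemeasurable]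
    refine Measure.ext_of_lintegral _ fun F hF => ?_
    rw [lintegral_map hF (by fun_prop), Measure.lintegral_compProd hF,
      lintegral_map (by fun_prop) (by fun_prop)]
    exact key' (fun p => F ((p.1, θ (p.1, p.2.2)), p.2.1)) (by fun_prop)
  refine CondIndepFun.symm ((condIndepFun_iff_condDistrib_prod_ae_eq_prodMkRight hf hgm hk).2 ?_)
  refine c2.trans ?_
  have c3 : ∀ᵐ p ∂P.map (fun ω => (k ω, g ω)), condDistrib f k P p.1 = η p.1 := by
    have c4 : (P.map fun ω => (k ω, g ω)).map Prod.fst = P.map k := by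
      rw [Measure.map_map measurable_fst (by fun_prop)]
      rfl
    rw [← c4] at c1
    exact ae_of_ae_map measurable_fst.aemeasurable c1
  filter_upwards [c3] with p hp
  rw [Kernel.prodMkRight_apply, Kernel.prodMkRight_apply, hp]

end CondIndep

/-! ### Consequences for feedback laws: causality and moment bounds. -/

namespace FadingNetwork

variable {V : Type*} [Fintype V] {T : ℕ} (N : FadingNetwork V)

open scoped Classical in
/-- The fading and the noise, recovered from the past, the fading and the future noise. -/
noncomputable def channelOfPast (t : Fin T)
    (p : (V → {u : Fin T // u < t} → ℂ × ℂ) × ((V → V → ℂ) × (V → {u : Fin T // t ≤ u} → ℂ))) :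
    (V → V → ℂ) × (V → Fin T → ℂ) :=
  (p.2.1, fun v u => if h : u < t then N.pastNoise p.1 p.2.1 v ⟨u, h⟩
    else p.2.2 v ⟨u, not_lt.1 h⟩)

theorem measurable_channelOfPast (t : Fin T) : Measurable (N.channelOfPast t) := by
  unfold channelOfPast
  refine Measurable.prodMk (by fun_prop) (measurable_pi_lambda _ fun v =>
    measurable_pi_lambda _ fun u => ?_)
  split_ifs with h
  · unfold pastNoise
    refine Measurable.sub (by fun_prop) (Finset.measurable_sum _ fun j _ => ?_)
    split_ifs <;> fun_prop
  · fun_prop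

theorem channelOfPast_past (t : Fin T) (ω : BlockSpace V T) :
    N.channelOfPast t (BlockSpace.past N t ω, gainAndFuture t ω.2) = ω.2 := by
  refine Prod.ext rfl (funext fun v => funext fun u => ?_)
  simp only [channelOfPast, gainAndFuture]
  split_ifs with h
  · exact N.pastNoise_past t ω v ⟨u, h⟩
  · rfl

variable {N}

theorem IsFeedbackLaw.map_signals_nodeChannel {P : Measure (BlockSpace V T)}
    [IsProbabilityMeasure P] (h : N.IsFeedbackLaw P) (i : V) :
    P.map (fun ω => (N.signals (N.unreachable i) ω, nodeChannel i ω))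
      = (P.map (N.signals (N.unreachable i))).prod (N.nodeLaw T i) :=
  (h.node i).map_eq_prod ((measurable_X _).prodMk (N.measurable_Y _)) (measurable_nodeChannel i)

theorem IsFeedbackLaw.map_nodeChannel {P : Measure (BlockSpace V T)}
    [IsProbabilityMeasure P] (h : N.IsFeedbackLaw P) (i : V) :
    P.map (nodeChannel i) = N.nodeLaw T i := by
  have h1 := congrArg Measure.snd (h.map_signals_nodeChannel i)
  have hm : Measurable (N.signals (T := T) (N.unreachable i)) :=
    (measurable_X _).prodMk (N.measurable_Y _)
  have := Measure.isProbabilityMeasure_map (μ := P) hm.aemeasurable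
  rwa [Measure.snd_map_prodMk hm, Measure.snd_prod] at h1

/-- The noise before `t` equals the received minus the noiseless signal, so the whole channel
realization is a function of the past, the fading and the future noise. The weight depends on the
past and the fading only, as the general criterion requires. -/
theorem IsFeedbackLaw.condIndepFun {P : Measure (BlockSpace V T)} [IsProbabilityMeasure P]
    (h : N.IsFeedbackLaw P) (t : Fin T) : CondIndepFun
    (MeasurableSpace.comap (BlockSpace.past N t) inferInstance)
    (BlockSpace.measurable_past N t).comap_le
    (fun ω v => ω.1 v t) (fun ω => ω.2) P := by
  have : StandardBorelSpace (V → ℂ) := StandardBorelSpace.pi_countable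
  have : StandardBorelSpace (Fin T → ℂ) := StandardBorelSpace.pi_countable
  have : StandardBorelSpace (V → Fin T → ℂ) := StandardBorelSpace.pi_countable
  have : StandardBorelSpace (V → V → ℂ) := StandardBorelSpace.pi_countable
  let w : (V → {u : Fin T // u < t} → ℂ × ℂ) × ((V → V → ℂ) × (V → {u : Fin T // t ≤ u} → ℂ)) → ℝ :=
    fun p => N.likelihoodWeight p.1 p.2.1
  have hw : Measurable w := N.measurable_likelihoodWeight.comp
    (f := fun p : (V → {u : Fin T // u < t} → ℂ × ℂ)
          × ((V → V → ℂ) × (V → {u : Fin T // t ≤ u} → ℂ)) => (p.1, p.2.1)) (by fun_prop)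
  have h0 : IsWeightedProd P
      (fun ω => w (BlockSpace.past N t ω, gainAndFuture t ω.2))
      (fun ω => (BlockSpace.past N t ω, fun v => ω.1 v t))
      (fun ω => gainAndFuture t ω.2) (N.futureLaw t) := h.time t
  have hf : Measurable fun (ω : BlockSpace V T) v => ω.1 v t := by fun_prop
  have hH : Measurable fun ω : BlockSpace V T => gainAndFuture t ω.2 :=
    (measurable_gainAndFuture t).comp measurable_snd
  have h1 := condIndepFun_of_isWeightedProd (N.futureLaw_univ_ne_zero t) hw
    (fun p => N.likelihoodWeight_pos _ _) (fun p => N.likelihoodWeight_le_one _ _)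
    (BlockSpace.measurable_past N t) hf hH h0 (N.measurable_channelOfPast t)
  have h2 : (fun ω : BlockSpace V T => N.channelOfPast t
      (BlockSpace.past N t ω, gainAndFuture t ω.2)) = fun ω => ω.2 :=
    funext fun ω => N.channelOfPast_past t ω
  rw [h2] at h1
  exact h1

theorem IsFeedbackLaw.isBlockInputLaw {P : Measure (BlockSpace V T)} [IsProbabilityMeasure P]
    (h : N.IsFeedbackLaw P) : IsBlockInputLaw N P where
  map_channel := h.map_channel
  power := h.power
  causal t := h.condIndepFun t
  causal_node i := by
    have hm : Measurable (N.signals (T := T) (N.unreachable i)) :=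
      (measurable_X _).prodMk (N.measurable_Y _)
    refine IndepFun.symm (g := nodeChannel i) ?_
    refine (indepFun_iff_map_prod_eq_prod_map_map hm.aemeasurable
      (measurable_nodeChannel i).aemeasurable).2 ?_
    rw [h.map_nodeChannel i]
    exact h.map_signals_nodeChannel i

variable (N)

/-- A bound on the second moment of the signal received by `v` in one block. -/
noncomputable def recvMoment (T : ℕ) (v : V) : ℝ≥0∞ :=
  T * (2 * Fintype.card V * ∑ j, T * N.linkMoment j v
    + 2 * ∫⁻ z, ‖z‖ₑ ^ 2 ∂stdComplexGaussian)

theorem recvMoment_lt_top (v : V) : N.recvMoment T v < ∞ := by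
  unfold recvMoment
  refine ENNReal.mul_lt_top (by simp) (ENNReal.add_lt_top.2 ⟨ENNReal.mul_lt_top
    (ENNReal.mul_lt_top (by simp) (by simp)) ?_, ENNReal.mul_lt_top (by simp)
      lintegral_enorm_sq_stdComplexGaussian⟩)
  exact ENNReal.sum_lt_top.2 fun j _ => ENNReal.mul_lt_top (by simp) (N.linkMoment_lt_top j v)

variable {N}

/-- The signals of a node may depend on the fading of the same block, but by acyclicity a node with
a link into `v` cannot be reached from `v`, so its signal is independent of the gains into `v` and
the second moments multiply. -/
theorem IsFeedbackLaw.lintegral_gain_mul_sent {P : Measure (BlockSpace V T)}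
    [IsProbabilityMeasure P] (h : N.IsFeedbackLaw P) {j v : V} (hj : N.graph.Adj j v) (t : Fin T) :
    ∫⁻ ω, ‖ω.2.1 j v‖ₑ ^ 2 * ‖ω.1 j t‖ₑ ^ 2 ∂P ≤ T * N.linkMoment j v := by
  have h1 := h.node v (fun p => ‖p.1 ⟨j, N.mem_unreachable_of_adj hj⟩ t‖ₑ ^ 2)
    (fun q => ‖q.1 j‖ₑ ^ 2) (by fun_prop) (by fun_prop)
  simp only [measure_univ, one_mul, ENNReal.ofReal_one] at h1
  have h2 : ∫⁻ q, ‖q.1 j‖ₑ ^ 2 ∂N.nodeLaw T v = N.linkMoment j v := by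
    have hmp : MeasurePreserving (fun q : (V → ℂ) × (Fin T → ℂ) => q.1 j) (N.nodeLaw T v)
        (N.fading j v) :=
      (measurePreserving_eval (fun j => N.fading j v) j).comp measurePreserving_fst
    rw [linkMoment, if_pos hj]
    exact hmp.lintegral_comp (f := fun z : ℂ => ‖z‖ₑ ^ 2) (by fun_prop)
  rw [h2] at h1
  calc ∫⁻ ω, ‖ω.2.1 j v‖ₑ ^ 2 * ‖ω.1 j t‖ₑ ^ 2 ∂P
      = ∫⁻ ω, ‖ω.1 j t‖ₑ ^ 2 * ‖ω.2.1 j v‖ₑ ^ 2 ∂P := by simp_rw [mul_comm]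
    _ = (∫⁻ ω, ‖ω.1 j t‖ₑ ^ 2 ∂P) * N.linkMoment j v := h1
    _ ≤ T * N.linkMoment j v := by
        gcongr
        exact (Finset.single_le_sum (f := fun t => ∫⁻ ω, ‖ω.1 j t‖ₑ ^ 2 ∂P)
          (fun _ _ => zero_le) (Finset.mem_univ t)).trans (h.power j)

/-- The bound does not depend on the law `P`; it later gives uniform integrability along the
sequence of codes. -/
theorem IsFeedbackLaw.lintegral_recv_sq_le {P : Measure (BlockSpace V T)}
    [IsProbabilityMeasure P] (h : N.IsFeedbackLaw P) (v : V) :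
    ∫⁻ ω, ENNReal.ofReal (∑ t, ‖BlockSpace.recv N v ω t‖ ^ 2) ∂P ≤ N.recvMoment T v := by
  classical
  have hW : ∀ t, ∫⁻ ω : BlockSpace V T, ‖ω.2.2 v t‖ₑ ^ 2 ∂P
      = ∫⁻ z, ‖z‖ₑ ^ 2 ∂stdComplexGaussian := by
    intro t
    have hmp : MeasurePreserving (fun q : (V → ℂ) × (Fin T → ℂ) => q.2 t) (N.nodeLaw T v)
        stdComplexGaussian :=
      (measurePreserving_eval (fun _ => stdComplexGaussian) t).comp measurePreserving_snd
    rw [← hmp.lintegral_comp (f := fun z : ℂ => ‖z‖ₑ ^ 2) (by fun_prop), ← h.map_nodeChannel v,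
      lintegral_map (by fun_prop) (measurable_nodeChannel v)]
    rfl
  have hpt : ∀ (ω : BlockSpace V T) (t : Fin T), ENNReal.ofReal (‖BlockSpace.recv N v ω t‖ ^ 2)
      ≤ 2 * Fintype.card V * (∑ j, if N.graph.Adj j v then ‖ω.2.1 j v‖ₑ ^ 2 * ‖ω.1 j t‖ₑ ^ 2 else 0)
        + 2 * ‖ω.2.2 v t‖ₑ ^ 2 := by
    intro ω t
    have h1 := N.norm_signal_sq_le v (fun j => ω.2.1 j v) ω.1 t
    have h2 : ‖BlockSpace.recv N v ω t‖ ≤ ‖N.signal v (fun j => ω.2.1 j v) ω.1 t‖ + ‖ω.2.2 v t‖ := by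
      rw [recv_eq]; exact norm_add_le _ _
    have h3 : ‖BlockSpace.recv N v ω t‖ ^ 2 ≤ 2 * Fintype.card V *
        (∑ j, if N.graph.Adj j v then ‖ω.2.1 j v‖ ^ 2 * ‖ω.1 j t‖ ^ 2 else 0)
        + 2 * ‖ω.2.2 v t‖ ^ 2 := by
      nlinarith [norm_nonneg (BlockSpace.recv N v ω t),
        sq_nonneg (‖N.signal v (fun j => ω.2.1 j v) ω.1 t‖ - ‖ω.2.2 v t‖)]
    refine (ENNReal.ofReal_le_ofReal h3).trans (le_of_eq ?_)
    have hs : 0 ≤ ∑ j, if N.graph.Adj j v then ‖ω.2.1 j v‖ ^ 2 * ‖ω.1 j t‖ ^ 2 else 0 :=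
      Finset.sum_nonneg fun j _ => by split_ifs <;> positivity
    rw [ENNReal.ofReal_add (by positivity) (by positivity), ENNReal.ofReal_mul (by positivity),
      ENNReal.ofReal_mul (by positivity), ENNReal.ofReal_mul (by positivity),
      ENNReal.ofReal_natCast, ENNReal.ofReal_ofNat, ENNReal.ofReal_pow (norm_nonneg _), ofReal_norm,
      ENNReal.ofReal_sum_of_nonneg fun j _ => by split_ifs <;> positivity]
    congr 2
    refine Finset.sum_congr rfl fun j _ => ?_
    split_ifs
    · rw [ENNReal.ofReal_mul (by positivity), ENNReal.ofReal_pow (norm_nonneg _),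
        ENNReal.ofReal_pow (norm_nonneg _), ofReal_norm, ofReal_norm]
    · exact ENNReal.ofReal_zero
  have hmj : ∀ (t : Fin T) (j : V), Measurable fun ω : BlockSpace V T =>
      if N.graph.Adj j v then ‖ω.2.1 j v‖ₑ ^ 2 * ‖ω.1 j t‖ₑ ^ 2 else 0 := by
    intro t j; split_ifs <;> fun_prop
  have ht : ∀ t : Fin T, ∫⁻ ω, ENNReal.ofReal (‖BlockSpace.recv N v ω t‖ ^ 2) ∂P
      ≤ 2 * Fintype.card V * ∑ j, T * N.linkMoment j v
        + 2 * ∫⁻ z, ‖z‖ₑ ^ 2 ∂stdComplexGaussian := by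
    intro t
    refine (lintegral_mono fun ω => hpt ω t).trans ?_
    have hm1 : Measurable fun ω : BlockSpace V T =>
        ∑ j, if N.graph.Adj j v then ‖ω.2.1 j v‖ₑ ^ 2 * ‖ω.1 j t‖ₑ ^ 2 else 0 :=
      Finset.measurable_sum _ fun j _ => hmj t j
    rw [lintegral_add_left (hm1.const_mul _), lintegral_const_mul _ hm1,
      lintegral_const_mul _ (by fun_prop), hW t, lintegral_finsetSum _ fun j _ => hmj t j]
    gcongr with j
    by_cases hj : N.graph.Adj j v
    · simp only [hj, if_true]
      exact h.lintegral_gain_mul_sent hj t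
    · simp [hj]
  calc ∫⁻ ω, ENNReal.ofReal (∑ t, ‖BlockSpace.recv N v ω t‖ ^ 2) ∂P
      = ∑ t, ∫⁻ ω, ENNReal.ofReal (‖BlockSpace.recv N v ω t‖ ^ 2) ∂P := by
        rw [← lintegral_finsetSum _ fun t _ => ?_]
        · exact lintegral_congr fun ω => ENNReal.ofReal_sum_of_nonneg fun t _ => sq_nonneg _
        · exact ((((measurable_pi_apply t).comp (N.measurable_recv v)).norm).pow_const 2).ennreal_ofReal
    _ ≤ ∑ _t : Fin T, (2 * Fintype.card V * ∑ j, T * N.linkMoment j v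
        + 2 * ∫⁻ z, ‖z‖ₑ ^ 2 ∂stdComplexGaussian) := Finset.sum_le_sum fun t _ => ht t
    _ = N.recvMoment T v := by simp [recvMoment, mul_add]

variable (N)

/-- Minus the logarithm of the conditional density of the signal received by `v`. -/
noncomputable def outInfo (v : V) (ω : BlockSpace V T) : ℝ :=
  -Real.log (N.outDensity v ω.1 (BlockSpace.recv N v ω))

theorem continuous_outInfo (v : V) : Continuous (N.outInfo v : BlockSpace V T → ℝ) := by
  have h : Continuous fun ω : BlockSpace V T => N.outDensity v ω.1 (BlockSpace.recv N v ω) :=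
    (N.continuous_outDensity v).comp (f := fun ω : BlockSpace V T => (ω.1, BlockSpace.recv N v ω))
      (continuous_fst.prodMk (N.continuous_recv v))
  exact (h.log fun ω => (N.outDensity_pos v _ _).ne').neg

/-- The output density is at most `π⁻ᵀ ≤ 1`. Nonnegativity makes the integral of `outInfo` lower
semicontinuous under weak convergence. -/
theorem outInfo_nonneg (v : V) (ω : BlockSpace V T) : 0 ≤ N.outInfo v ω := by
  refine neg_nonneg.2 (Real.log_nonpos (N.outDensity_pos v _ _).le ((N.outDensity_le v _ _).trans ?_))
  exact pow_le_one₀ (inv_nonneg.2 Real.pi_pos.le)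
    (inv_le_one_of_one_le₀ (by linarith [Real.pi_gt_three]))

variable {N}

theorem IsFeedbackLaw.integrable_outInfo {P : Measure (BlockSpace V T)}
    [IsProbabilityMeasure P] (h : N.IsFeedbackLaw P) (v : V) : Integrable (N.outInfo v) P := by
  have hx : ∀ j t, Integrable (fun ω : BlockSpace V T => ‖ω.1 j t‖ ^ 2) P := by
    intro j t
    refine ⟨(by fun_prop : Measurable fun ω : BlockSpace V T => ‖ω.1 j t‖ ^ 2).aestronglyMeasurable,
      ?_⟩
    rw [hasFiniteIntegral_iff_ofReal (Eventually.of_forall fun ω => sq_nonneg _)]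
    have h1 := (Finset.single_le_sum (f := fun t => ∫⁻ ω, ‖ω.1 j t‖ₑ ^ 2 ∂P)
          (fun _ _ => zero_le) (Finset.mem_univ t)).trans (h.power j)
    refine lt_of_le_of_lt (le_of_eq_of_le (lintegral_congr fun ω => ?_) h1) (by simp)
    rw [ENNReal.ofReal_pow (norm_nonneg _), ofReal_norm]
  have hy : Integrable (fun ω : BlockSpace V T => ∑ t, ‖BlockSpace.recv N v ω t‖ ^ 2) P := by
    refine ⟨Continuous.aestronglyMeasurable (continuous_finsetSum _ fun t _ =>
      (((continuous_apply t).comp (N.continuous_recv v)).norm).pow 2), ?_⟩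
    rw [hasFiniteIntegral_iff_ofReal
      (Eventually.of_forall fun ω => Finset.sum_nonneg fun t _ => sq_nonneg _)]
    exact (h.lintegral_recv_sq_le v).trans_lt (N.recvMoment_lt_top v)
  have hb : Integrable (fun ω : BlockSpace V T => T * Real.log Real.pi
      + (2 * ∑ t, ‖BlockSpace.recv N v ω t‖ ^ 2 + ∑ t, 2 * (Fintype.card V *
        ∑ j, (N.linkMoment j v).toReal * ‖ω.1 j t‖ ^ 2))) P :=
    (integrable_const _).add ((hy.const_mul _).add (integrable_finsetSum _ fun t _ =>
      ((integrable_finsetSum _ fun j _ => (hx j t).const_mul _).const_mul _).const_mul _))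
  refine hb.mono' (N.continuous_outInfo v).aestronglyMeasurable (Eventually.of_forall fun ω => ?_)
  rw [Real.norm_eq_abs, abs_of_nonneg (N.outInfo_nonneg v ω)]
  refine (N.neg_log_outDensity_le v _ _).trans (le_of_eq ?_)
  rw [Finset.sum_add_distrib, Finset.mul_sum]

end FadingNetwork

/-! ### Conditional entropies computed from an explicit conditional density. -/

section Density

variable {Ω E F : Type*} [MeasurableSpace Ω] [MeasureSpace E] [SigmaFinite (volume : Measure E)]
  [MeasurableSpace F]

theorem llr_ae_eq_log_of_map_eq_withDensity {P : Measure Ω} [IsProbabilityMeasure P] {Y : Ω → E}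
    {Z : Ω → F} {f : F × E → ℝ} (hf : Measurable f) (hf0 : ∀ p, 0 < f p)
    (h : P.map (fun ω => (Z ω, Y ω))
      = ((P.map Z).prod volume).withDensity fun p => ENNReal.ofReal (f p)) :
    llr (P.map fun ω => (Z ω, Y ω)) ((P.map Z).prod volume)
      =ᵐ[P.map fun ω => (Z ω, Y ω)] fun p => Real.log (f p) := by
  have h1 := Measure.rnDeriv_withDensity ((P.map Z).prod (volume : Measure E))
    hf.ennreal_ofReal
  have hac : (P.map fun ω => (Z ω, Y ω)) ≪ (P.map Z).prod volume :=
    h ▸ withDensity_absolutelyContinuous _ _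
  rw [← h] at h1
  filter_upwards [hac.ae_le h1] with p hp
  rw [llr, hp, ENNReal.toReal_ofReal (hf0 p).le]

theorem hasFiniteCondDiffEntropy_of_map_eq_withDensity {P : Measure Ω} [IsProbabilityMeasure P]
    {Y : Ω → E} {Z : Ω → F} (hY : Measurable Y) (hZ : Measurable Z) {f : F × E → ℝ}
    (hf : Measurable f) (hf0 : ∀ p, 0 < f p)
    (h : P.map (fun ω => (Z ω, Y ω))
      = ((P.map Z).prod volume).withDensity fun p => ENNReal.ofReal (f p))
    (hi : Integrable (fun ω => Real.log (f (Z ω, Y ω))) P) : HasFiniteCondDiffEntropy P Y Z := by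
  refine ⟨h ▸ withDensity_absolutelyContinuous _ _, ?_⟩
  rw [integrable_congr (llr_ae_eq_log_of_map_eq_withDensity hf hf0 h),
    integrable_map_measure hf.log.aestronglyMeasurable (hZ.prodMk hY).aemeasurable]
  exact hi

theorem condDiffEntropy_of_map_eq_withDensity {P : Measure Ω} [IsProbabilityMeasure P]
    {Y : Ω → E} {Z : Ω → F} (hY : Measurable Y) (hZ : Measurable Z) {f : F × E → ℝ}
    (hf : Measurable f) (hf0 : ∀ p, 0 < f p)
    (h : P.map (fun ω => (Z ω, Y ω))
      = ((P.map Z).prod volume).withDensity fun p => ENNReal.ofReal (f p)) :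
    condDiffEntropy P Y Z = -(∫ ω, Real.log (f (Z ω, Y ω)) ∂P) / Real.log 2 := by
  rw [condDiffEntropy, integral_congr_ae (llr_ae_eq_log_of_map_eq_withDensity hf hf0 h),
    integral_map (hZ.prodMk hY).aemeasurable hf.log.aestronglyMeasurable]

end Density

/-! ### Entropy of a received signal given all incoming signals. -/

namespace FadingNetwork

variable {V : Type*} [Fintype V] {T : ℕ} (N : FadingNetwork V)

open scoped Classical in
/-- Extend the signals incoming to `v` by zero. -/
noncomputable def extendIn (v : V) (x : ({j | N.graph.Adj j v} : Set V) → Fin T → ℂ) :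
    V → Fin T → ℂ :=
  fun j => if h : N.graph.Adj j v then x ⟨j, h⟩ else 0

omit [Fintype V] in
@[fun_prop]
theorem measurable_extendIn (v : V) : Measurable (N.extendIn (T := T) v) := by
  refine measurable_pi_lambda _ fun j => ?_
  unfold extendIn
  split_ifs <;> fun_prop

theorem signal_extendIn_Xin (v : V) (g : V → ℂ) (ω : BlockSpace V T) :
    N.signal v g (N.extendIn v (BlockSpace.Xin N v ω)) = N.signal v g ω.1 :=
  N.signal_congr fun j hj => by simp [extendIn, BlockSpace.Xin, BlockSpace.X, hj]

theorem outDensity_extendIn_Xin (v : V) (y : Fin T → ℂ) (ω : BlockSpace V T) :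
    N.outDensity v (N.extendIn v (BlockSpace.Xin N v ω)) y = N.outDensity v ω.1 y :=
  N.outDensity_congr y fun j hj => by simp [extendIn, BlockSpace.Xin, BlockSpace.X, hj]

variable {N}

/-- The incoming signals come from nodes unreachable from `v`, hence are independent of the gains
and the noise at `v`. For fixed incoming signals the output is a translate of the noise, and
averaging the translated noise density over the gains gives `outDensity`. -/
theorem IsFeedbackLaw.map_Xin_recv {P : Measure (BlockSpace V T)} [IsProbabilityMeasure P]
    (h : N.IsFeedbackLaw P) (v : V) :
    P.map (fun ω => (BlockSpace.Xin N v ω, BlockSpace.recv N v ω))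
      = ((P.map (BlockSpace.Xin N v)).prod volume).withDensity
          fun p => ENNReal.ofReal (N.outDensity v (N.extendIn v p.1) p.2) := by
  have hXm : Measurable (BlockSpace.Xin N v : BlockSpace V T → _) := measurable_X _
  have hq : Measurable fun p : (({j | N.graph.Adj j v} : Set V) → Fin T → ℂ) × (Fin T → ℂ) =>
      ENNReal.ofReal (N.outDensity v (N.extendIn v p.1) p.2) :=
    ((N.measurable_outDensity v).comp (f := fun p : (({j | N.graph.Adj j v} : Set V) →
      Fin T → ℂ) × (Fin T → ℂ) => (N.extendIn v p.1, p.2)) (by fun_prop)).ennreal_ofReal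
  have hmap : P.map (fun ω => (BlockSpace.Xin N v ω, nodeChannel v ω))
      = (P.map (BlockSpace.Xin N v)).prod (N.nodeLaw T v) :=
    ((h.node v).comp_left (φ := fun z (j : ({j | N.graph.Adj j v} : Set V)) =>
      z.1 ⟨j, N.mem_unreachable_of_adj j.2⟩) (by fun_prop)).map_eq_prod hXm
        (measurable_nodeChannel v)
  have hs : Measurable fun p : (({j | N.graph.Adj j v} : Set V) → Fin T → ℂ) × (V → ℂ) =>
      N.signal v p.2 (N.extendIn v p.1) :=
    (N.measurable_signal v).comp (f := fun p : (({j | N.graph.Adj j v} : Set V) →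
      Fin T → ℂ) × (V → ℂ) => (p.2, N.extendIn v p.1)) (by fun_prop)
  refine Measure.ext_of_lintegral _ fun F hF => ?_
  have hs' : Measurable fun p : (({j | N.graph.Adj j v} : Set V) → Fin T → ℂ)
      × (V → ℂ) × (Fin T → ℂ) => N.signal v p.2.1 (N.extendIn v p.1) :=
    hs.comp (f := fun p : (({j | N.graph.Adj j v} : Set V) → Fin T → ℂ)
      × (V → ℂ) × (Fin T → ℂ) => (p.1, p.2.1)) (by fun_prop)
  have hF' : Measurable fun p : (({j | N.graph.Adj j v} : Set V) → Fin T → ℂ)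
      × (V → ℂ) × (Fin T → ℂ) => F (p.1, N.signal v p.2.1 (N.extendIn v p.1) + p.2.2) :=
    hF.comp (measurable_fst.prodMk (hs'.add (by fun_prop)))
  have e1 : ∫⁻ ω, F (BlockSpace.Xin N v ω, BlockSpace.recv N v ω) ∂P
      = ∫⁻ p, F (p.1, N.signal v p.2.1 (N.extendIn v p.1) + p.2.2)
          ∂((P.map (BlockSpace.Xin N v)).prod (N.nodeLaw T v)) := by
    rw [← hmap, lintegral_map hF' (hXm.prodMk (measurable_nodeChannel v))]
    refine lintegral_congr fun ω => ?_
    rw [signal_extendIn_Xin, recv_eq]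
    rfl
  rw [lintegral_map hF (hXm.prodMk (N.measurable_recv v)), e1,
    lintegral_withDensity_eq_lintegral_mul _ hq hF, lintegral_prod _ hF'.aemeasurable,
    lintegral_prod _ (hq.mul hF).aemeasurable]
  refine lintegral_congr fun x => ?_
  have hFx : Measurable fun q : (V → ℂ) × (Fin T → ℂ) =>
      F (x, N.signal v q.1 (N.extendIn v x) + q.2) := hF'.comp (measurable_prodMk_left (x := x))
  have hsx : Measurable fun g : V → ℂ => N.signal v g (N.extendIn v x) :=
    hs.comp (measurable_prodMk_left (x := x))
  rw [nodeLaw, lintegral_prod _ hFx.aemeasurable]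
  have e2 : ∀ g : V → ℂ, ∫⁻ w, F (x, N.signal v g (N.extendIn v x) + w) ∂noiseLaw T
      = ∫⁻ y, ENNReal.ofReal (noiseDensity (y - N.signal v g (N.extendIn v x))) * F (x, y) := by
    intro g
    rw [lintegral_noiseLaw _ (by fun_prop), ← lintegral_add_left_eq_self _
      (-N.signal v g (N.extendIn v x))]
    refine lintegral_congr fun y => ?_
    rw [neg_add_eq_sub, add_sub_cancel]
  simp_rw [e2]
  have hm : Measurable fun p : (V → ℂ) × (Fin T → ℂ) =>
      ENNReal.ofReal (noiseDensity (p.2 - N.signal v p.1 (N.extendIn v x))) :=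
    (measurable_noiseDensity.comp (measurable_snd.sub (hsx.comp measurable_fst))).ennreal_ofReal
  rw [lintegral_lintegral_swap (hm.mul (by fun_prop)).aemeasurable]
  refine lintegral_congr fun y => ?_
  have hmy : Measurable fun g : V → ℂ =>
      ENNReal.ofReal (noiseDensity (y - N.signal v g (N.extendIn v x))) :=
    hm.comp (f := fun g : V → ℂ => (g, y)) (by fun_prop)
  rw [lintegral_mul_const _ hmy, Pi.mul_apply, N.ofReal_outDensity]

theorem IsFeedbackLaw.hasFiniteCondDiffEntropy_Xin {P : Measure (BlockSpace V T)}
    [IsProbabilityMeasure P] (h : N.IsFeedbackLaw P) (v : V) :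
    HasFiniteCondDiffEntropy P (BlockSpace.recv N v) (BlockSpace.Xin N v) := by
  refine hasFiniteCondDiffEntropy_of_map_eq_withDensity (N.measurable_recv v) (measurable_X _)
    ((N.measurable_outDensity v).comp (f := fun p : (({j | N.graph.Adj j v} : Set V) →
      Fin T → ℂ) × (Fin T → ℂ) => (N.extendIn v p.1, p.2)) (by fun_prop))
    (fun p => N.outDensity_pos _ _ _) (h.map_Xin_recv v) ?_
  simp only [Function.comp_apply, outDensity_extendIn_Xin]
  refine (h.integrable_outInfo v).neg.congr (Eventually.of_forall fun ω => ?_)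
  simp [outInfo]

theorem IsFeedbackLaw.condDiffEntropy_Xin {P : Measure (BlockSpace V T)}
    [IsProbabilityMeasure P] (h : N.IsFeedbackLaw P) (v : V) :
    condDiffEntropy P (BlockSpace.recv N v) (BlockSpace.Xin N v)
      = (∫ ω, N.outInfo v ω ∂P) / Real.log 2 := by
  have hXm : Measurable (BlockSpace.Xin N v : BlockSpace V T → _) := measurable_X _
  rw [condDiffEntropy_of_map_eq_withDensity (N.measurable_recv v) hXm
    ((N.measurable_outDensity v).comp (f := fun p : (({j | N.graph.Adj j v} : Set V) →
      Fin T → ℂ) × (Fin T → ℂ) => (N.extendIn v p.1, p.2)) (by fun_prop))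
    (fun p => N.outDensity_pos _ _ _) (h.map_Xin_recv v)]
  simp only [Function.comp_apply, outDensity_extendIn_Xin, outInfo, integral_neg]

end FadingNetwork

/-- Functions which depend on complementary parts of the sample are independent. -/
theorem lintegral_mul_of_resample {Ω Z S : Type*} [MeasurableSpace Ω] [MeasurableSpace Z]
    [MeasurableSpace S] {μ : Measure Ω} [SFinite μ] {Ψ : Ω × Ω → Ω}
    (hΨ : MeasurePreserving Ψ (μ.prod μ) μ) {A : Ω → Z} {H : Ω → S} (hAm : Measurable A)
    (hHm : Measurable H) (hA : ∀ p, A (Ψ p) = A p.1) (hH : ∀ p, H (Ψ p) = H p.2)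
    {a : Z → ℝ≥0∞} {b : S → ℝ≥0∞} (ha : Measurable a) (hb : Measurable b) :
    ∫⁻ ω, a (A ω) * b (H ω) ∂μ = (∫⁻ ω, a (A ω) ∂μ) * ∫⁻ ω, b (H ω) ∂μ := by
  rw [← hΨ.lintegral_comp (by fun_prop)]
  simp_rw [hA, hH]
  exact lintegral_prod_mul (f := fun ω => a (A ω)) (g := fun ω => b (H ω)) (by fun_prop)
    (by fun_prop)

theorem isWeightedProd_map {Ω X Z S : Type*} [MeasurableSpace Ω] [MeasurableSpace X]
    [MeasurableSpace Z] [MeasurableSpace S] {μ : Measure Ω} {φ : Ω → X} (hφ : Measurable φ)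
    {w : X → ℝ} (hw : Measurable w) {A : X → Z} {H : X → S} (hA : Measurable A)
    (hH : Measurable H) {κ : Measure S} :
    IsWeightedProd (μ.map φ) w A H κ
      ↔ IsWeightedProd μ (fun ω => w (φ ω)) (fun ω => A (φ ω)) (fun ω => H (φ ω)) κ := by
  refine forall₄_congr fun a b ha hb => ?_
  rw [lintegral_map (by fun_prop) hφ, lintegral_map (by fun_prop) hφ]

/-! ### Resampling parts of the channel. -/

namespace FadingNetwork

variable {V : Type*} [Fintype V] {T : ℕ} (N : FadingNetwork V)

open scoped Classical in
/-- Replace the fading coefficients of the links into certain nodes, and certain noise samples. -/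
noncomputable def resampleBlock (c : V → Prop) (c' : V → Fin T → Prop)
    (p : ((V → V → ℂ) × (V → Fin T → ℂ)) × ((V → V → ℂ) × (V → Fin T → ℂ))) :
    (V → V → ℂ) × (V → Fin T → ℂ) :=
  (fun j v => if c v then p.2.1 j v else p.1.1 j v,
    fun v t => if c' v t then p.2.2 v t else p.1.2 v t)

theorem measurePreserving_resampleBlock (c : V → Prop) (c' : V → Fin T → Prop) :
    MeasurePreserving (resampleBlock c c') ((N.blockLaw T).prod (N.blockLaw T)) (N.blockLaw T) := by
  classical
  have h1 := measurePreserving_pi_prod fun j => measurePreserving_pi_prod fun v =>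
    measurePreserving_select (N.fading j v) (c v)
  have h2 := measurePreserving_pi_prod fun v => measurePreserving_pi_prod fun t =>
    measurePreserving_select stdComplexGaussian (c' v t)
  exact measurePreserving_prod_prod h1 h2

/-- Replace one block. -/
theorem measurePreserving_update_block {n : ℕ} (l : Fin n) :
    MeasurePreserving (fun p : (Fin n → (V → V → ℂ) × (V → Fin T → ℂ)) ×
        ((V → V → ℂ) × (V → Fin T → ℂ)) => Function.update p.1 l p.2)
      ((Measure.pi fun _ => N.blockLaw T).prod (N.blockLaw T))
      (Measure.pi fun _ => N.blockLaw T) := by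
  have hm : Measurable (fun p : (Fin n → (V → V → ℂ) × (V → Fin T → ℂ)) ×
        ((V → V → ℂ) × (V → Fin T → ℂ)) => Function.update p.1 l p.2) := by
    refine measurable_pi_lambda _ fun l' => ?_
    by_cases h : l' = l
    · subst h; simpa using measurable_snd
    · simp only [Function.update_of_ne h]; fun_prop
  refine ⟨hm, ?_⟩
  have h1 := measurePreserving_pi_prod fun l' : Fin n =>
    measurePreserving_select (N.blockLaw T) (l' = l)
  have h2 : MeasurePreserving (fun p : (Fin n → (V → V → ℂ) × (V → Fin T → ℂ)) ×
        (Fin n → (V → V → ℂ) × (V → Fin T → ℂ)) => (p.1, p.2 l))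
      ((Measure.pi fun _ => N.blockLaw T).prod (Measure.pi fun _ => N.blockLaw T))
      ((Measure.pi fun _ => N.blockLaw T).prod (N.blockLaw T)) :=
    (MeasurePreserving.id _).prod (measurePreserving_eval (fun _ : Fin n => N.blockLaw T) l)
  rw [← h2.map_eq, Measure.map_map hm h2.measurable]
  convert h1.map_eq using 2
  funext p l'
  by_cases h : l' = l
  · subst h; simp
  · simp [h]

/-- Replace some fading coefficients and noise samples in one block. -/
theorem measurePreserving_resample {n : ℕ} (l : Fin n) (c : V → Prop) (c' : V → Fin T → Prop) :
    MeasurePreserving (fun p : (Fin n → (V → V → ℂ) × (V → Fin T → ℂ)) ×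
        (Fin n → (V → V → ℂ) × (V → Fin T → ℂ)) =>
        fun l' => if l' = l then resampleBlock c c' (p.1 l', p.2 l') else p.1 l')
      ((Measure.pi fun _ => N.blockLaw T).prod (Measure.pi fun _ => N.blockLaw T))
      (Measure.pi fun _ => N.blockLaw T) := by
  refine measurePreserving_pi_prod (f := fun l' p => if l' = l then resampleBlock c c' p else p.1)
    fun l' => ?_
  split_ifs
  · exact N.measurePreserving_resampleBlock c c'
  · exact measurePreserving_fst

theorem measurePreserving_nodeChannel (i : V) :
    MeasurePreserving (fun b : (V → V → ℂ) × (V → Fin T → ℂ) => ((fun j => b.1 j i), b.2 i))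
      (N.blockLaw T) (N.nodeLaw T i) :=
  (measurePreserving_pi _ _ fun j => measurePreserving_eval (fun i => N.fading j i) i).prod
    (measurePreserving_eval (fun _ : V => noiseLaw T) i)

end FadingNetwork

/-! ### The averaged block law of a code and causality along the network. -/

namespace NetworkCode

variable {V : Type*} [Fintype V] {s : V} {T n : ℕ} (C : NetworkCode V s T n) (N : FadingNetwork V)

/-- Signals sent, fading and noise in the block `l`. -/
noncomputable def blockSample (m : Fin C.M) (l : Fin n)
    (ω : Fin n → (V → V → ℂ) × (V → Fin T → ℂ)) : BlockSpace V T :=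
  (fun v => C.sent N m ω v l, ω l)

theorem recv_blockSample (m : Fin C.M) (l : Fin n) (ω : Fin n → (V → V → ℂ) × (V → Fin T → ℂ))
    (v : V) : BlockSpace.recv N v (C.blockSample N m l ω) = C.received N m ω v l :=
  funext fun t => (C.received_eq_step N m ω v l t).symm

theorem measurable_iterate_step (m : Fin C.M) (k : ℕ) :
    Measurable fun ω => (C.step N m ω)^[k] 0 := by
  induction k with
  | zero => exact measurable_const
  | succ k ih =>
    simp_rw [Function.iterate_succ_apply']
    refine measurable_pi_lambda _ fun v => measurable_pi_lambda _ fun l =>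
      measurable_pi_lambda _ fun t => ?_
    unfold step FadingNetwork.channel
    refine Measurable.add (Finset.measurable_sum _ fun j _ => ?_) (by fun_prop)
    split_ifs
    · refine Measurable.mul (by fun_prop) ?_
      have h1 : Measurable fun ω => C.enc j m ((C.step N m ω)^[k] 0 j) :=
        (C.measurable_enc j m).comp ((measurable_pi_apply j).comp ih)
      exact (measurable_pi_apply t).comp ((measurable_pi_apply l).comp h1)
    · exact measurable_const

@[fun_prop]
theorem measurable_received (m : Fin C.M) : Measurable (C.received N m) :=
  C.measurable_iterate_step N m (n * T)

@[fun_prop]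
theorem measurable_sent (m : Fin C.M) : Measurable (C.sent N m) :=
  measurable_pi_lambda _ fun v => (C.measurable_enc v m).comp
    ((measurable_pi_apply v).comp (C.measurable_received N m))

@[fun_prop]
theorem measurable_blockSample (m : Fin C.M) (l : Fin n) : Measurable (C.blockSample N m l) := by
  refine Measurable.prodMk (measurable_pi_lambda _ fun v => ?_) (measurable_pi_apply l)
  exact (measurable_pi_apply l).comp ((measurable_pi_apply v).comp (C.measurable_sent N m))

/-- The signals received by a set of nodes without incoming links depend only on the channels of
these nodes. -/
theorem received_congr (m : Fin C.M) {ω ω' : Fin n → (V → V → ℂ) × (V → Fin T → ℂ)} {S : Set V}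
    (hS : ∀ j v, N.graph.Adj j v → v ∈ S → j ∈ S)
    (h : ∀ l, ∀ v ∈ S, (∀ j, (ω l).1 j v = (ω' l).1 j v) ∧ (ω l).2 v = (ω' l).2 v) :
    ∀ v ∈ S, C.received N m ω v = C.received N m ω' v := by
  have key : ∀ k, ∀ v ∈ S, (C.step N m ω)^[k] 0 v = (C.step N m ω')^[k] 0 v := by
    intro k
    induction k with
    | zero => intro v _; rfl
    | succ k ih =>
      intro v hv
      rw [Function.iterate_succ_apply', Function.iterate_succ_apply']
      funext l t
      simp only [step, FadingNetwork.channel]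
      rw [(h l v hv).2]
      congr 1
      refine Finset.sum_congr rfl fun j _ => ?_
      split_ifs with hj
      · rw [ih j (hS j v hj hv), (h l v hv).1 j]
      · rfl
  exact key _

/-- The signals received in a block depend only on the channel in this and the earlier blocks. -/
theorem received_congr_of_le (m : Fin C.M) {ω ω' : Fin n → (V → V → ℂ) × (V → Fin T → ℂ)}
    {l : Fin n} (h : ∀ l' ≤ l, ω l' = ω' l') (v : V) :
    C.received N m ω v l = C.received N m ω' v l := by
  have key : ∀ k, ∀ l' ≤ l, ∀ v, (C.step N m ω)^[k] 0 v l' = (C.step N m ω')^[k] 0 v l' := by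
    intro k
    induction k with
    | zero => intro _ _ _; rfl
    | succ k ih =>
      intro l' hl' v
      rw [Function.iterate_succ_apply', Function.iterate_succ_apply']
      funext t
      simp only [step, FadingNetwork.channel]
      rw [h l' hl']
      congr 1
      refine Finset.sum_congr rfl fun j _ => ?_
      split_ifs with hj
      · congr 1
        refine C.causal_enc j m _ _ l' t fun l'' t'' hb => ?_
        rw [ih l'' ?_ j]
        rcases hb with hb | hb
        · exact hb.le.trans hl'
        · exact hb.1.le.trans hl'
      · rfl
  exact key _ l le_rfl v

/-- The average over the message and over the blocks of the law of one block. -/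
noncomputable def avgLaw : Measure (BlockSpace V T) :=
  ∑ m, ∑ l, ((C.M : ℝ≥0∞) * n)⁻¹ •
    (Measure.pi fun _ : Fin n => N.blockLaw T).map (C.blockSample N m l)

theorem lintegral_avgLaw {F : BlockSpace V T → ℝ≥0∞} (hF : Measurable F) :
    ∫⁻ ω, F ω ∂C.avgLaw N = ((C.M : ℝ≥0∞) * n)⁻¹ * ∑ m, ∑ l,
      ∫⁻ ω, F (C.blockSample N m l ω) ∂Measure.pi fun _ : Fin n => N.blockLaw T := by
  simp_rw [avgLaw, lintegral_finsetSum_measure, lintegral_smul_measure, smul_eq_mul,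
    lintegral_map hF (C.measurable_blockSample N _ _), Finset.mul_sum]

theorem isProbabilityMeasure_avgLaw (hn : 0 < n) : IsProbabilityMeasure (C.avgLaw N) := by
  refine ⟨?_⟩
  rw [← lintegral_one, C.lintegral_avgLaw N measurable_const]
  simp only [lintegral_one, measure_univ, Finset.sum_const, Finset.card_univ, Fintype.card_fin,
    nsmul_eq_mul, mul_one]
  refine ENNReal.inv_mul_cancel ?_ (by finiteness)
  have := C.M_pos
  simp only [ne_eq, mul_eq_zero, Nat.cast_eq_zero, not_or]
  omega

theorem map_avgLaw_snd (hn : 0 < n) : (C.avgLaw N).map (fun ω => ω.2) = N.blockLaw T := by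
  refine Measure.ext_of_lintegral _ fun F hF => ?_
  rw [lintegral_map hF measurable_snd, C.lintegral_avgLaw N (by fun_prop)]
  have h1 : ∀ (m : Fin C.M) (l : Fin n), ∫⁻ ω, F (C.blockSample N m l ω).2
      ∂(Measure.pi fun _ : Fin n => N.blockLaw T) = ∫⁻ b, F b ∂N.blockLaw T := fun m l =>
    (measurePreserving_eval (fun _ : Fin n => N.blockLaw T) l).lintegral_comp hF
  simp_rw [h1]
  simp only [Finset.sum_const, Finset.card_univ, Fintype.card_fin, nsmul_eq_mul]
  rw [← mul_assoc, ← mul_assoc, mul_assoc _ (C.M : ℝ≥0∞), ENNReal.inv_mul_cancel, one_mul]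
  · have := C.M_pos
    simp only [ne_eq, mul_eq_zero, Nat.cast_eq_zero, not_or]
    omega
  · finiteness

theorem avgLaw_power (hn : 0 < n) (hC : C.PowerConstraint N) (v : V) :
    ∑ t, ∫⁻ ω, ‖ω.1 v t‖ₑ ^ 2 ∂C.avgLaw N ≤ T := by
  have h1 : ∀ t : Fin T, ∫⁻ ω, ‖ω.1 v t‖ₑ ^ 2 ∂C.avgLaw N = ((C.M : ℝ≥0∞) * n)⁻¹ * ∑ m, ∑ l,
      ∫⁻ ω, ‖C.sent N m ω v l t‖ₑ ^ 2 ∂Measure.pi fun _ : Fin n => N.blockLaw T := fun t =>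
    C.lintegral_avgLaw N (F := fun ω => ‖ω.1 v t‖ₑ ^ 2) (by fun_prop)
  simp_rw [h1]
  rw [← Finset.mul_sum, Finset.sum_comm]
  simp_rw [Finset.sum_comm (s := (Finset.univ : Finset (Fin T)))]
  refine (mul_le_mul_right (hC v) _).trans (le_of_eq ?_)
  rw [← mul_assoc, ENNReal.inv_mul_cancel, one_mul]
  · have := C.M_pos
    simp only [ne_eq, mul_eq_zero, Nat.cast_eq_zero, not_or]
    omega
  · finiteness

/-- Resample, in block `l`, the gains into `i` and the noise at `i`. The nodes unreachable from `i`
form a set closed under predecessors and not containing `i`, so their signals do not change, while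
the channel at `i` is replaced by an independent copy. -/
theorem isWeightedProd_node (m : Fin C.M) (l : Fin n) (i : V) :
    IsWeightedProd ((Measure.pi fun _ : Fin n => N.blockLaw T).map (C.blockSample N m l))
      (fun _ => 1) (N.signals (N.unreachable i)) (FadingNetwork.nodeChannel i) (N.nodeLaw T i) := by
  classical
  have hsm : Measurable (N.signals (T := T) (N.unreachable i)) :=
    (FadingNetwork.measurable_X _).prodMk (N.measurable_Y _)
  rw [isWeightedProd_map (C.measurable_blockSample N m l) measurable_const hsm
    (FadingNetwork.measurable_nodeChannel i)]
  intro a b ha hb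
  simp only [measure_univ, one_mul, ENNReal.ofReal_one]
  have hmp : MeasurePreserving
      (fun ω => FadingNetwork.nodeChannel i (C.blockSample N m l ω))
      (Measure.pi fun _ : Fin n => N.blockLaw T) (N.nodeLaw T i) :=
    (N.measurePreserving_nodeChannel i).comp
      (measurePreserving_eval (fun _ : Fin n => N.blockLaw T) l)
  rw [← hmp.lintegral_comp hb]
  refine lintegral_mul_of_resample
    (N.measurePreserving_resample l (fun v => v = i) (fun v _ => v = i))
    (hsm.comp (C.measurable_blockSample N m l)) hmp.measurable (fun p => ?_) (fun p => ?_) ha hb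
  · have hrec : ∀ v ∈ N.unreachable i, C.received N m (fun l' => if l' = l then
        FadingNetwork.resampleBlock (fun v => v = i) (fun v _ => v = i) (p.1 l', p.2 l')
        else p.1 l') v = C.received N m p.1 v := by
      refine C.received_congr N m (fun j v hjv hv hj => hv (hj.tail hjv)) fun l' v hv => ?_
      have hvi : v ≠ i := by rintro rfl; exact hv Relation.ReflTransGen.refl
      split_ifs <;> simp [FadingNetwork.resampleBlock, hvi]
    refine Prod.ext (funext fun v => ?_) (funext fun v => ?_)
    · change C.enc v m (C.received N m _ v) l = C.enc v m (C.received N m p.1 v) l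
      rw [hrec v v.2]
    · change BlockSpace.recv N v (C.blockSample N m l _)
        = BlockSpace.recv N v (C.blockSample N m l p.1)
      rw [recv_blockSample, recv_blockSample, hrec v v.2]
  · simp [FadingNetwork.nodeChannel, blockSample, FadingNetwork.resampleBlock]

end NetworkCode

/-- The product identity may be checked with part of the randomness frozen, because `κ` is the same
for every frozen value. It is used with all blocks but one frozen. -/
theorem IsWeightedProd.of_measurePreserving {Ω Ω' Ω'' Z S : Type*} [MeasurableSpace Ω]
    [MeasurableSpace Ω'] [MeasurableSpace Ω''] [MeasurableSpace Z] [MeasurableSpace S]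
    {μ : Measure Ω} {ν : Measure Ω'} {ρ : Measure Ω''} [SFinite ν] {φ : Ω × Ω' → Ω''}
    (hφ : MeasurePreserving φ (μ.prod ν) ρ) {w : Ω'' → ℝ} (hw : Measurable w) {A : Ω'' → Z}
    {H : Ω'' → S} (hA : Measurable A) (hH : Measurable H) {κ : Measure S}
    (h : ∀ ω, IsWeightedProd ν (fun ω' => w (φ (ω, ω'))) (fun ω' => A (φ (ω, ω')))
      (fun ω' => H (φ (ω, ω'))) κ) : IsWeightedProd ρ w A H κ := by
  intro a b ha hb
  have hφm := hφ.measurable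
  have h1 : Measurable fun x => ENNReal.ofReal (w (φ x)) * (a (A (φ x)) * b (H (φ x))) := by
    fun_prop
  have h2 : Measurable fun x => ENNReal.ofReal (w (φ x)) * a (A (φ x)) := by fun_prop
  rw [← hφ.lintegral_comp (by fun_prop), ← hφ.lintegral_comp (by fun_prop),
    lintegral_prod _ h1.aemeasurable, lintegral_prod _ h2.aemeasurable,
    ← lintegral_const_mul _ (Measurable.lintegral_prod_right' h1),
    ← lintegral_mul_const _ (Measurable.lintegral_prod_right' h2)]
  exact lintegral_congr fun ω => h ω a b ha hb

/-! ### Causality in time within one block. -/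

namespace FadingNetwork

variable {V : Type*} [Fintype V] {T : ℕ} (N : FadingNetwork V)

/-- With strictly causal encoders, the channel equation determines the received signals. -/
theorem eq_of_channel_eq {e : V → (Fin T → ℂ) → Fin T → ℂ}
    (he : ∀ v y y' u, (∀ u' < u, y u' = y' u') → e v y u = e v y' u) {g : V → V → ℂ}
    {w y y' : V → Fin T → ℂ} {t : Fin T}
    (h : ∀ v, ∀ u < t, y v u = N.channel g (fun j => e j (y j) u) (fun j => w j u) v)
    (h' : ∀ v, ∀ u < t, y' v u = N.channel g (fun j => e j (y' j) u) (fun j => w j u) v)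
    (v : V) (u : Fin T) (hu : u < t) : y v u = y' v u := by
  induction u using WellFoundedLT.induction generalizing v with
  | ind u ih =>
    rw [h v u hu, h' v u hu]
    congr 1
    exact funext fun j => he j _ _ u fun u' hu' => ih u' hu' j (hu'.trans hu)

theorem lintegral_pi_pi_stdComplexGaussian {F : (V → Fin T → ℂ) → ℝ≥0∞} (hF : Measurable F) :
    ∫⁻ w, F w ∂(Measure.pi fun _ : V => Measure.pi fun _ : Fin T => stdComplexGaussian)
      = ∫⁻ z : V × Fin T → ℂ, (∏ p, ENNReal.ofReal (stdComplexGaussianDensity (z p)))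
          * F (fun v t => z (v, t)) ∂Measure.pi fun _ => volume := by
  have hs : SigmaFinite ((volume : Measure ℂ).withDensity
      fun z => ENNReal.ofReal (stdComplexGaussianDensity z)) := by
    rw [← stdComplexGaussian_eq_withDensity]; infer_instance
  have hm : Measurable fun z => ENNReal.ofReal (stdComplexGaussianDensity z) :=
    continuous_stdComplexGaussianDensity.measurable.ennreal_ofReal
  rw [← (measurePreserving_curry fun (_ : V) (_ : Fin T) => stdComplexGaussian).lintegral_comp hF]
  simp_rw [stdComplexGaussian_eq_withDensity]
  have hp : Measurable fun z : V × Fin T → ℂ =>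
      ∏ p, ENNReal.ofReal (stdComplexGaussianDensity (z p)) :=
    Finset.measurable_prod _ fun p _ => hm.comp (measurable_pi_apply p)
  rw [pi_withDensity (fun _ : V × Fin T => (volume : Measure ℂ)) (fun _ z => ENNReal.ofReal
    (stdComplexGaussianDensity z)) fun _ => hm, lintegral_withDensity_eq_lintegral_mul _ hp
    (by fun_prop)]
  rfl

/-- The likelihood of the signals received before time `t`, for strictly causal encoders. -/
theorem lintegral_exp_mul_past {e : V → (Fin T → ℂ) → Fin T → ℂ}
    (hem : ∀ v, Measurable (e v))
    (he : ∀ v y y' u, (∀ u' < u, y u' = y' u') → e v y u = e v y' u)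
    {r : (V → V → ℂ) × (V → Fin T → ℂ) → V → Fin T → ℂ} (hr : Measurable r)
    (hrec : ∀ b v u, r b v u = N.channel b.1 (fun j => e j (r b j) u) (fun j => b.2 j u) v)
    (t : Fin T) (g : V → V → ℂ)
    {Φ : (V → {u : Fin T // u < t} → ℂ × ℂ) × (V → ℂ) → ℝ≥0∞} (hΦ : Measurable Φ) :
    ∫⁻ w, ENNReal.ofReal (Real.exp (∑ u : {u : Fin T // u < t}, ∑ v, ‖w v u‖ ^ 2)) *
        Φ (N.pastAndSent t (fun v => e v (r (g, w) v), g, w))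
        ∂(Measure.pi fun _ : V => Measure.pi fun _ : Fin T => stdComplexGaussian)
      = ∫⁻ y : V × Fin T → ℂ, (∏ p, ENNReal.ofReal (if p.2 < t then Real.pi⁻¹
            else stdComplexGaussianDensity (y p))) *
          Φ ((fun v (u : {u : Fin T // u < t}) => (e v (fun t => y (v, t)) u, y (v, u))),
            fun v => e v (fun t => y (v, t)) t) ∂Measure.pi fun _ => volume := by
  classical
  have hps : Measurable fun w : V → Fin T → ℂ =>
      N.pastAndSent t (fun v => e v (r (g, w) v), g, w) := by
    refine (N.measurable_pastAndSent t).comp (Measurable.prodMk ?_ (by fun_prop))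
    exact measurable_pi_lambda _ fun v => (hem v).comp
      ((measurable_pi_apply v).comp (hr.comp (by fun_prop)))
  have hF : Measurable fun w : V → Fin T → ℂ =>
      ENNReal.ofReal (Real.exp (∑ u : {u : Fin T // u < t}, ∑ v, ‖w v u‖ ^ 2)) *
        Φ (N.pastAndSent t (fun v => e v (r (g, w) v), g, w)) :=
    Measurable.mul (by fun_prop) (hΦ.comp hps)
  rw [lintegral_pi_pi_stdComplexGaussian hF]
  -- The substitution from noise to received symbols before `t`, with no shift from `t` on. Strict
  -- causality of the encoders makes it triangular in time, so it preserves Lebesgue measure.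
  set h : (V × Fin T → ℂ) → V × Fin T → ℂ := fun y p =>
    if p.2 < t then N.channel g (fun j => e j (fun t => y (j, t)) p.2) (fun _ => 0) p.1 else 0
    with hh
  have hhm : Measurable h := by
    refine measurable_pi_lambda _ fun p => ?_
    simp only [hh, channel]
    split_ifs
    · refine Measurable.add (Finset.measurable_sum _ fun j _ => ?_) measurable_const
      split_ifs
      · exact ((measurable_pi_apply p.2).comp ((hem j).comp (by fun_prop))).const_mul _
      · exact measurable_const
    · exact measurable_const
  have hmd : Measurable stdComplexGaussianDensity :=
    continuous_stdComplexGaussianDensity.measurable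
  have hF' : Measurable fun z : V × Fin T → ℂ =>
      (∏ p, ENNReal.ofReal (stdComplexGaussianDensity (z p))) *
        (ENNReal.ofReal (Real.exp (∑ u : {u : Fin T // u < t}, ∑ v, ‖z (v, u)‖ ^ 2)) *
        Φ (N.pastAndSent t (fun v => e v (r (g, fun v t => z (v, t)) v), g,
          fun v t => z (v, t)))) :=
    Measurable.mul (Finset.measurable_prod _ fun p _ =>
      (hmd.comp (measurable_pi_apply p)).ennreal_ofReal)
      (hF.comp (f := fun (z : V × Fin T → ℂ) v t => z (v, t)) (by fun_prop))
  rw [← lintegral_sub_causal volume (fun p : V × Fin T => p.2) h hhm (fun p y y' hy => ?_) _ hF']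
  · refine lintegral_congr fun y => ?_
    set w : V → Fin T → ℂ := fun v u => y (v, u) - h y (v, u) with hw
    have hy : ∀ v, ∀ u < t, y (v, u)
        = N.channel g (fun j => e j (fun t => y (j, t)) u) (fun j => w j u) v := by
      intro v u hu
      simp [hw, hh, hu, channel]
    have hry : ∀ v, ∀ u < t, r (g, w) v u = y (v, u) :=
      N.eq_of_channel_eq he (y := r (g, w)) (y' := fun v u => y (v, u))
        (fun v u _ => hrec (g, w) v u) hy
    have hps' : N.pastAndSent t (fun v => e v (r (g, w) v), g, w)
        = ((fun v (u : {u : Fin T // u < t}) => (e v (fun t => y (v, t)) u, y (v, u))),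
            fun v => e v (fun t => y (v, t)) t) := by
      refine Prod.ext (funext fun v => funext fun u => Prod.ext ?_ ?_) (funext fun v => ?_)
      · exact he v _ _ _ fun u' hu' => hry v u' (hu'.trans u.2)
      · exact (hrec (g, w) v u).symm.trans (hry v u u.2)
      · exact he v _ _ _ fun u' hu' => hry v u' hu'
    -- The exponential cancels the Gaussian factors at times before `t` up to the constant `π⁻¹`.
    -- The past and the current symbols are functions of `y`, so the resulting integral no longer
    -- depends on the fading `g`.
    have hprod : (∏ p : V × Fin T, ENNReal.ofReal (stdComplexGaussianDensity (w p.1 p.2))) *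
        ENNReal.ofReal (Real.exp (∑ u : {u : Fin T // u < t}, ∑ v, ‖w v u‖ ^ 2))
        = ∏ p : V × Fin T, ENNReal.ofReal (if p.2 < t then Real.pi⁻¹
            else stdComplexGaussianDensity (y p)) := by
      have e1 : ∑ u : {u : Fin T // u < t}, ∑ v, ‖w v u‖ ^ 2
          = ∑ p : V × Fin T, if p.2 < t then ‖w p.1 p.2‖ ^ 2 else 0 := by
        have e2 : ∀ u : Fin T, (∑ v, if u < t then ‖w v u‖ ^ 2 else 0)
            = if u < t then ∑ v, ‖w v u‖ ^ 2 else 0 := by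
          intro u; split_ifs <;> simp
        rw [Fintype.sum_prod_type_right]
        simp_rw [e2]
        rw [← Finset.sum_filter]
        exact (Finset.sum_subtype _ (by simp) fun u => ∑ v, ‖w v u‖ ^ 2).symm
      rw [e1, Real.exp_sum, ENNReal.ofReal_prod_of_nonneg fun _ _ => (Real.exp_pos _).le,
        ← Finset.prod_mul_distrib]
      refine Finset.prod_congr rfl fun p _ => ?_
      rw [← ENNReal.ofReal_mul (stdComplexGaussianDensity_pos _).le]
      congr 1
      split_ifs with hp
      · rw [stdComplexGaussianDensity, mul_assoc, ← Real.exp_add, neg_add_cancel, Real.exp_zero,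
          mul_one]
      · simp [hw, hh, hp]
    rw [← hps', ← hprod, mul_assoc]
  · simp only [hh]
    split_ifs with hp
    · congr 1
      exact funext fun j => he j _ _ _ fun u' hu' => hy (j, u') hu'
    · rfl

/-- The law of one block, for strictly causal encoders. -/
theorem isWeightedProd_time {e : V → (Fin T → ℂ) → Fin T → ℂ}
    (hem : ∀ v, Measurable (e v))
    (he : ∀ v y y' u, (∀ u' < u, y u' = y' u') → e v y u = e v y' u)
    {r : (V → V → ℂ) × (V → Fin T → ℂ) → V → Fin T → ℂ} (hr : Measurable r)
    (hrec : ∀ b v u, r b v u = N.channel b.1 (fun j => e j (r b j) u) (fun j => b.2 j u) v)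
    (t : Fin T) :
    IsWeightedProd (N.blockLaw T)
      (fun b => N.likelihoodWeight (BlockSpace.past N t (fun v => e v (r b v), b)) b.1)
      (fun b => N.pastAndSent t (fun v => e v (r b v), b)) (gainAndFuture t) (N.futureLaw t) := by
  classical
  have hsm : Measurable fun b : (V → V → ℂ) × (V → Fin T → ℂ) =>
      ((fun v => e v (r b v), b) : BlockSpace V T) :=
    Measurable.prodMk (measurable_pi_lambda _ fun v => (hem v).comp
      ((measurable_pi_apply v).comp hr)) measurable_id
  have hps := (N.measurable_pastAndSent t).comp hsm
  have hpwm : Measurable fun p : V → {u : Fin T // u < t} → ℂ × ℂ => pastWeight p := by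
    unfold pastWeight; fun_prop
  -- The first factor does not involve the fading or `b`: for fixed fading, the earlier and the
  -- later noise are independent, and `lintegral_exp_mul_past` evaluates the part with the past to a
  -- constant independent of `g`.
  have key : ∀ (a : (V → {u : Fin T // u < t} → ℂ × ℂ) × (V → ℂ) → ℝ≥0∞) (b : (V → V → ℂ) ×
      (V → {u : Fin T // t ≤ u} → ℂ) → ℝ≥0∞), Measurable a → Measurable b →
      ∫⁻ x, ENNReal.ofReal (N.likelihoodWeight
        (BlockSpace.past N t (fun v => e v (r x v), x)) x.1) *
        (a (N.pastAndSent t (fun v => e v (r x v), x)) * b (gainAndFuture t x)) ∂N.blockLaw T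
      = (∫⁻ y : V × Fin T → ℂ, (∏ p, ENNReal.ofReal (if p.2 < t then Real.pi⁻¹
            else stdComplexGaussianDensity (y p))) *
          (fun q : (V → {u : Fin T // u < t} → ℂ × ℂ) × (V → ℂ) =>
            ENNReal.ofReal (pastWeight q.1) * a q)
          ((fun v (u : {u : Fin T // u < t}) => (e v (fun t => y (v, t)) u, y (v, u))),
            fun v => e v (fun t => y (v, t)) t) ∂Measure.pi fun _ => volume)
        * ∫⁻ h, b h ∂N.futureLaw t := by
    intro a b ha hb
    set Φ : (V → {u : Fin T // u < t} → ℂ × ℂ) × (V → ℂ) → ℝ≥0∞ :=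
      fun q => ENNReal.ofReal (pastWeight q.1) * a q with hΦ
    have hΦm : Measurable Φ := Measurable.mul (by fun_prop) ha
    have hlw : Measurable fun x : (V → V → ℂ) × (V → Fin T → ℂ) => N.likelihoodWeight
        (BlockSpace.past N t (fun v => e v (r x v), x)) x.1 :=
      (N.measurable_likelihoodWeight_past t).comp hsm
    have hm1 : Measurable fun x : (V → V → ℂ) × (V → Fin T → ℂ) =>
        ENNReal.ofReal (N.likelihoodWeight
        (BlockSpace.past N t (fun v => e v (r x v), x)) x.1) *
        (a (N.pastAndSent t (fun v => e v (r x v), x)) * b (gainAndFuture t x)) :=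
      hlw.ennreal_ofReal.mul ((ha.comp hps).mul (by fun_prop))
    have hm2 : Measurable fun x : (V → V → ℂ) × (V → Fin T → ℂ) =>
        ENNReal.ofReal (gainWeight T x.1) * b (gainAndFuture t x) := by fun_prop
    rw [N.lintegral_futureLaw t b hb, blockLaw, lintegral_prod _ hm1.aemeasurable,
      lintegral_prod _ hm2.aemeasurable,
      ← lintegral_const_mul _ (Measurable.lintegral_prod_right' hm2)]
    refine lintegral_congr fun g => ?_
    have hm3 : Measurable fun w : V → Fin T → ℂ => b (gainAndFuture t (g, w)) := by fun_prop
    change _ = _ * ∫⁻ w, ENNReal.ofReal (gainWeight T g) * b (gainAndFuture t (g, w)) ∂_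
    rw [lintegral_const_mul _ hm3, ← N.lintegral_exp_mul_past hem he hr hrec t g hΦm]
    have hsg : Measurable fun w : V → Fin T → ℂ => (g, w) := by fun_prop
    have e1 : ∀ w : V → Fin T → ℂ, ENNReal.ofReal (N.likelihoodWeight
        (BlockSpace.past N t (fun v => e v (r (g, w) v), (g, w))) g) *
        (a (N.pastAndSent t (fun v => e v (r (g, w) v), (g, w))) * b (gainAndFuture t (g, w)))
        = ENNReal.ofReal (gainWeight T g) *
          ((ENNReal.ofReal (Real.exp (∑ u : {u : Fin T // u < t}, ∑ v, ‖w v u‖ ^ 2)) *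
            Φ (N.pastAndSent t (fun v => e v (r (g, w) v), g, w))) *
            b (g, fun v u => w v u)) := by
      intro w
      have hn := N.pastNoise_past t ((fun v => e v (r (g, w) v)), (g, w))
      simp only at hn
      rw [likelihoodWeight]
      simp_rw [hn]
      have hpw : 0 ≤ pastWeight (BlockSpace.past N t (fun v => e v (r (g, w) v), g, w)) :=
        (Real.exp_pos _).le
      rw [ENNReal.ofReal_mul (mul_nonneg (Real.exp_pos _).le hpw),
        ENNReal.ofReal_mul (Real.exp_pos _).le, hΦ]
      simp only [gainAndFuture, pastAndSent]
      ring
    simp_rw [e1]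
    have hmA : Measurable fun w : V → Fin T → ℂ =>
        ((∑ u : {u : Fin T // u < t}, ∑ v, ‖w v u‖ ^ 2 : ℝ),
          N.pastAndSent t (fun v => e v (r (g, w) v), g, w)) :=
      Measurable.prodMk (by fun_prop) (hps.comp hsg)
    have hΦg : Measurable fun w : V → Fin T → ℂ =>
        Φ (N.pastAndSent t (fun v => e v (r (g, w) v), g, w)) := hΦm.comp (hps.comp hsg)
    have hm4 : Measurable fun w : V → Fin T → ℂ =>
        (ENNReal.ofReal (Real.exp (∑ u : {u : Fin T // u < t}, ∑ v, ‖w v u‖ ^ 2)) *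
            Φ (N.pastAndSent t (fun v => e v (r (g, w) v), g, w))) *
            b (g, fun v u => w v u) :=
      Measurable.mul (Measurable.mul (by fun_prop) hΦg) (by fun_prop)
    rw [lintegral_const_mul _ hm4, mul_left_comm]
    congr 1
    -- Resampling the noise from time `t` on leaves the past and the symbols sent at `t` unchanged.
    have hΨ := measurePreserving_pi_prod fun _ : V => measurePreserving_pi_prod fun u : Fin T =>
      measurePreserving_select stdComplexGaussian (t ≤ u)
    refine lintegral_mul_of_resample (a := fun q => ENNReal.ofReal (Real.exp q.1) * Φ q.2)
      (b := fun h => b (g, h)) hΨ hmA (by fun_prop : Measurable fun (w : V → Fin T → ℂ)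
        (v : V) (u : {u : Fin T // t ≤ u}) => w v u) (fun p => ?_) (fun p => ?_)
      (by fun_prop) (by fun_prop)
    · have hlt : ∀ (v : V) (u : Fin T), u < t →
          (if t ≤ u then p.2 v u else p.1 v u) = p.1 v u := fun v u hu => if_neg (not_le.2 hu)
      set w' : V → Fin T → ℂ := fun v u => if t ≤ u then p.2 v u else p.1 v u with hw'
      have hrr : ∀ v, ∀ u < t, r (g, w') v u = r (g, p.1) v u := by
        refine N.eq_of_channel_eq he (g := g) (w := p.1) (fun v u hu => ?_)
          fun v u _ => hrec (g, p.1) v u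
        rw [hrec]
        congr 1
        exact funext fun j => hlt j u hu
      refine Prod.ext ?_ (Prod.ext (funext fun v => funext fun u => Prod.ext ?_ ?_)
        (funext fun v => ?_))
      · change ∑ u : {u : Fin T // u < t}, ∑ v, ‖w' v u‖ ^ 2
          = ∑ u : {u : Fin T // u < t}, ∑ v, ‖p.1 v u‖ ^ 2
        refine Finset.sum_congr rfl fun u _ => Finset.sum_congr rfl fun v _ => ?_
        rw [show w' v u = p.1 v u from hlt v u u.2]
      · exact he v _ _ _ fun u' hu' => hrr v u' (hu'.trans u.2)
      · exact (hrec (g, w') v u).symm.trans ((hrr v u u.2).trans (hrec (g, p.1) v u))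
      · exact he v _ _ _ fun u' hu' => hrr v u' hu'
    · exact funext fun v => funext fun u => if_pos u.2
  -- The factorization for `b` and for the constant one, multiplied crosswise, gives the required
  -- identity.
  intro a b ha hb
  have h1 := key a (fun _ => 1) ha measurable_const
  simp only [mul_one, lintegral_one] at h1
  rw [key a b ha hb, h1]
  ring

end FadingNetwork

namespace NetworkCode

variable {V : Type*} [Fintype V] {s : V} {T n : ℕ} (C : NetworkCode V s T n) (N : FadingNetwork V)

/-- Once all other blocks are frozen, the code acts in block `l` as a system of strictly causal
encoders for that block alone, and the one-block result applies for every frozen realization. -/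
theorem isWeightedProd_time (m : Fin C.M) (l : Fin n) (t : Fin T) :
    IsWeightedProd ((Measure.pi fun _ : Fin n => N.blockLaw T).map (C.blockSample N m l))
      (fun ω => N.likelihoodWeight (BlockSpace.past N t ω) ω.2.1) (N.pastAndSent t)
      (fun ω => FadingNetwork.gainAndFuture t ω.2) (N.futureLaw t) := by
  have hH : Measurable fun ω : BlockSpace V T => FadingNetwork.gainAndFuture t ω.2 :=
    (FadingNetwork.measurable_gainAndFuture t).comp measurable_snd
  rw [isWeightedProd_map (C.measurable_blockSample N m l) (N.measurable_likelihoodWeight_past t)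
    (N.measurable_pastAndSent t) hH]
  have hb := C.measurable_blockSample N m l
  have hU := N.measurePreserving_update_block (T := T) l
  have hfix : ∀ ω : Fin n → (V → V → ℂ) × (V → Fin T → ℂ), IsWeightedProd (N.blockLaw T)
      (fun b => N.likelihoodWeight
        (BlockSpace.past N t (C.blockSample N m l (Function.update ω l b)))
        (C.blockSample N m l (Function.update ω l b)).2.1)
      (fun b => N.pastAndSent t (C.blockSample N m l (Function.update ω l b)))
      (fun b => FadingNetwork.gainAndFuture t (C.blockSample N m l (Function.update ω l b)).2)
      (N.futureLaw t) := by
    intro ω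
    -- The signals received in other blocks are frozen at their values for `ω`. In earlier blocks
    -- these do not depend on block `l`, and later blocks are not seen by a causal encoder.
    let e : V → (Fin T → ℂ) → Fin T → ℂ := fun v y =>
      C.enc v m (Function.update (C.received N m ω v) l y) l
    let r : (V → V → ℂ) × (V → Fin T → ℂ) → V → Fin T → ℂ := fun b v =>
      C.received N m (Function.update ω l b) v l
    have hem : ∀ v, Measurable (e v) := fun v =>
      (measurable_pi_apply l).comp ((C.measurable_enc v m).comp (measurable_update _))
    have he : ∀ v y y' u, (∀ u' < u, y u' = y' u') → e v y u = e v y' u := by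
      intro v y y' u h
      refine C.causal_enc v m _ _ l u fun l' t' hb => ?_
      rcases eq_or_ne l' l with rfl | hne
      · rcases hb with hb | hb
        · exact absurd hb (lt_irrefl _)
        · simpa using h t' hb.2
      · simp [hne]
    have hr : Measurable r := measurable_pi_lambda _ fun v => (measurable_pi_apply l).comp
      ((measurable_pi_apply v).comp ((C.measurable_received N m).comp (measurable_update _)))
    have hsent : ∀ b v, C.sent N m (Function.update ω l b) v l = e v (r b v) := by
      intro b v
      funext u
      refine C.causal_enc v m _ _ l u fun l' t' hb => ?_
      rcases eq_or_ne l' l with rfl | hne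
      · simp [r]
      · have hlt : l' < l := by
          rcases hb with hb | hb
          · exact hb
          · exact absurd hb.1 hne
        rw [Function.update_of_ne hne]
        refine congrFun (C.received_congr_of_le N m (fun l'' hl'' => ?_) v) t'
        exact Function.update_of_ne (hl''.trans_lt hlt).ne _ _
    have hrec : ∀ b v u, r b v u
        = N.channel b.1 (fun j => e j (r b j) u) (fun j => b.2 j u) v := by
      intro b v u
      have := C.received_eq_step N m (Function.update ω l b) v l u
      simp_rw [hsent, Function.update_self] at this
      exact this
    have hbs : ∀ b, C.blockSample N m l (Function.update ω l b)
        = (fun v => e v (r b v), b) := fun b =>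
      Prod.ext (funext fun v => hsent b v) (Function.update_self _ _ _)
    simp_rw [hbs]
    exact N.isWeightedProd_time hem he hr hrec t
  exact IsWeightedProd.of_measurePreserving hU ((N.measurable_likelihoodWeight_past t).comp hb)
    ((N.measurable_pastAndSent t).comp hb) (hH.comp hb) hfix

theorem isFeedbackLaw_avgLaw (hn : 0 < n) (hC : C.PowerConstraint N) :
    N.IsFeedbackLaw (C.avgLaw N) where
  map_channel := C.map_avgLaw_snd N hn
  power := C.avgLaw_power N hn hC
  time t := IsWeightedProd.sum fun m _ => IsWeightedProd.sum fun l _ =>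
    (C.isWeightedProd_time N m l t).smul _
  node i := IsWeightedProd.sum fun m _ => IsWeightedProd.sum fun l _ =>
    (C.isWeightedProd_node N m l i).smul _

end NetworkCode

theorem lintegral_pi_noiseLaw {ι : Type*} [Fintype ι] {T : ℕ} {F : (ι → Fin T → ℂ) → ℝ≥0∞}
    (hF : Measurable F) :
    ∫⁻ w, F w ∂(Measure.pi fun _ : ι => noiseLaw T)
      = ∫⁻ w, (∏ i, ENNReal.ofReal (noiseDensity (w i))) * F w ∂Measure.pi fun _ => volume := by
  have hs : SigmaFinite ((volume : Measure (Fin T → ℂ)).withDensity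
      fun z => ENNReal.ofReal (noiseDensity z)) := by
    rw [← noiseLaw_eq_withDensity]; infer_instance
  have hp : Measurable fun w : ι → Fin T → ℂ => ∏ i, ENNReal.ofReal (noiseDensity (w i)) := by
    fun_prop
  simp_rw [noiseLaw_eq_withDensity]
  rw [pi_withDensity (fun _ : ι => (volume : Measure (Fin T → ℂ)))
    (fun _ z => ENNReal.ofReal (noiseDensity z)) fun _ => by fun_prop,
    lintegral_withDensity_eq_lintegral_mul _ hp hF]
  rfl

/-! ### Joint density of everything received, given the message. -/

namespace FadingNetwork

variable {V : Type*} [Fintype V] {T : ℕ} (N : FadingNetwork V)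

open scoped Classical in
/-- The number of nodes from which a signal can flow to `v`. -/
noncomputable def depth (v : V) : ℕ :=
  (Finset.univ.filter fun u => Relation.TransGen N.graph.Adj u v).card

/-- Acyclicity makes the inclusion of predecessor sets strict: `j` precedes `v` but not itself. The
result ranks the nodes compatibly with the links. -/
theorem depth_lt {j v : V} (h : N.graph.Adj j v) : N.depth j < N.depth v := by
  classical
  refine Finset.card_lt_card ((Finset.ssubset_iff_of_subset fun u hu => ?_).2 ⟨j, ?_, ?_⟩)
  · simp only [Finset.mem_filter, Finset.mem_univ, true_and] at hu ⊢
    exact hu.tail h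
  · simpa using Relation.TransGen.single h
  · simpa using N.acyclic j

/-- Rearrange fading and noise indexed by block and node. -/
def regroup {n : ℕ} (p : (Fin n × V → V → ℂ) × (Fin n × V → Fin T → ℂ)) :
    Fin n → (V → V → ℂ) × (V → Fin T → ℂ) :=
  fun l => (fun j v => p.1 (l, v) j, fun v => p.2 (l, v))

theorem measurePreserving_regroup (n : ℕ) : MeasurePreserving (regroup (n := n) (V := V) (T := T))
    ((Measure.pi fun i : Fin n × V => N.gainLaw i.2).prod (Measure.pi fun _ => noiseLaw T))
    (Measure.pi fun _ : Fin n => N.blockLaw T) := by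
  have hG : MeasurePreserving (fun (f : Fin n × V → V → ℂ) l j v => f (l, v) j)
      (Measure.pi fun i : Fin n × V => N.gainLaw i.2)
      (Measure.pi fun _ : Fin n => Measure.pi fun j => Measure.pi fun v => N.fading j v) :=
    (measurePreserving_pi _ _ fun _ => measurePreserving_swapIndex fun j v => N.fading j v).comp
      (measurePreserving_curry fun (_ : Fin n) v => N.gainLaw v)
  have hW := measurePreserving_curry fun (_ : Fin n) (_ : V) => noiseLaw T
  have hz := measurePreserving_pi_prod (f := fun _ p => p) fun _ : Fin n =>
    MeasurePreserving.id ((Measure.pi fun j => Measure.pi fun v => N.fading j v).prod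
      (Measure.pi fun _ : V => noiseLaw T))
  exact hz.comp (hG.prod hW)

end FadingNetwork

namespace NetworkCode

variable {V : Type*} [Fintype V] {s : V} {T n : ℕ} (C : NetworkCode V s T n) (N : FadingNetwork V)

/-- The signals sent in the block `l` if the received signals are `y`. -/
def sentOf (m : Fin C.M) (y : Fin n × V → Fin T → ℂ) (l : Fin n) (j : V) : Fin T → ℂ :=
  C.enc j m (fun l' => y (l', j)) l

omit [Fintype V] in
theorem sentOf_congr (m : Fin C.M) {y y' : Fin n × V → Fin T → ℂ} {l : Fin n} {j : V}
    (h : ∀ l' ≤ l, y (l', j) = y' (l', j)) : C.sentOf m y l j = C.sentOf m y' l j := by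
  funext t
  refine C.causal_enc j m _ _ l t fun l' t' hb => ?_
  rw [h l' (hb.elim le_of_lt fun hb => hb.1.le)]

omit [Fintype V] in
@[fun_prop]
theorem measurable_sentOf (m : Fin C.M) (l : Fin n) : Measurable fun y => C.sentOf m y l :=
  measurable_pi_lambda _ fun j => (measurable_pi_apply l).comp
    ((C.measurable_enc j m).comp (by fun_prop))

/-- All received signals, indexed by block and node. -/
noncomputable def receivedAll (m : Fin C.M) (ω : Fin n → (V → V → ℂ) × (V → Fin T → ℂ))
    (i : Fin n × V) : Fin T → ℂ :=
  C.received N m ω i.2 i.1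

@[fun_prop]
theorem measurable_receivedAll (m : Fin C.M) : Measurable (C.receivedAll N m) := by
  refine measurable_pi_lambda _ fun i => ?_
  exact (measurable_pi_apply i.1).comp ((measurable_pi_apply i.2).comp (C.measurable_received N m))

theorem receivedAll_eq (m : Fin C.M) (ω : Fin n → (V → V → ℂ) × (V → Fin T → ℂ))
    (i : Fin n × V) : C.receivedAll N m ω i
      = N.signal i.2 (fun j => (ω i.1).1 j i.2) (C.sentOf m (C.receivedAll N m ω) i.1)
        + (ω i.1).2 i.2 :=
  funext fun t => C.received_eq_step N m ω i.2 i.1 t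

/-- With the lexicographic rank (block, depth) the network over all blocks is a triangular system: a
signal coming in over a link was formed from receptions in earlier blocks, or in the same block at
smaller depth. -/
theorem signal_sentOf_congr (m : Fin C.M) {y y' : Fin n × V → Fin T → ℂ} {i : Fin n × V}
    (h : ∀ j : Fin n × V, toLex (j.1, N.depth j.2) < toLex (i.1, N.depth i.2) → y j = y' j)
    (g : V → ℂ) :
    N.signal i.2 g (C.sentOf m y i.1) = N.signal i.2 g (C.sentOf m y' i.1) := by
  refine N.signal_congr fun j hj => C.sentOf_congr m fun l' hl' => h (l', j) ?_
  rw [Prod.Lex.toLex_lt_toLex]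
  rcases hl'.lt_or_eq with h1 | h1
  · exact Or.inl h1
  · exact Or.inr ⟨h1, N.depth_lt hj⟩

/-- The joint density of all received signals, given the message. -/
theorem lintegral_receivedAll (m : Fin C.M) {Φ : (Fin n × V → Fin T → ℂ) → ℝ≥0∞}
    (hΦ : Measurable Φ) :
    ∫⁻ ω, Φ (C.receivedAll N m ω) ∂(Measure.pi fun _ : Fin n => N.blockLaw T)
      = ∫⁻ y, (∏ i, ENNReal.ofReal (N.outDensity i.2 (C.sentOf m y i.1) (y i))) * Φ y
          ∂Measure.pi fun _ : Fin n × V => volume := by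
  classical
  have hmp := N.measurePreserving_regroup (T := T) n
  have hm1 : Measurable fun p => Φ (C.receivedAll N m (FadingNetwork.regroup p)) :=
    hΦ.comp ((C.measurable_receivedAll N m).comp hmp.measurable)
  have hsig : Measurable fun p : (Fin n × V → V → ℂ) × (Fin n × V → Fin T → ℂ) =>
      fun i => N.signal i.2 (p.1 i) (C.sentOf m p.2 i.1) :=
    measurable_pi_lambda _ fun i => (N.measurable_signal i.2).comp
      (f := fun p : (Fin n × V → V → ℂ) × (Fin n × V → Fin T → ℂ) =>
        (p.1 i, C.sentOf m p.2 i.1))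
      (Measurable.prodMk (by fun_prop) ((C.measurable_sentOf m i.1).comp measurable_snd))
  have hdens : Measurable fun p : (Fin n × V → V → ℂ) × (Fin n × V → Fin T → ℂ) =>
      ∏ i, ENNReal.ofReal (noiseDensity (p.2 i - N.signal i.2 (p.1 i) (C.sentOf m p.2 i.1))) :=
    Finset.measurable_prod _ fun i _ => (measurable_noiseDensity.comp
      (Measurable.sub (by fun_prop) ((measurable_pi_apply i).comp hsig))).ennreal_ofReal
  -- For fixed gains, passing from noise to received signals is a triangular shift, so the density
  -- of the received signals is the noise density at the shifted point.
  have hG : ∀ G : Fin n × V → V → ℂ,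
      ∫⁻ W, Φ (C.receivedAll N m (FadingNetwork.regroup (G, W)))
        ∂(Measure.pi fun _ : Fin n × V => noiseLaw T)
      = ∫⁻ y, (∏ i, ENNReal.ofReal
          (noiseDensity (y i - N.signal i.2 (G i) (C.sentOf m y i.1)))) * Φ y
          ∂Measure.pi fun _ : Fin n × V => volume := by
    intro G
    have hmG : Measurable fun W => Φ (C.receivedAll N m (FadingNetwork.regroup (G, W))) :=
      hm1.comp measurable_prodMk_left
    have hmW : Measurable fun W : Fin n × V → Fin T → ℂ =>
        (∏ i, ENNReal.ofReal (noiseDensity (W i))) *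
          Φ (C.receivedAll N m (FadingNetwork.regroup (G, W))) := by
      refine Measurable.mul (by fun_prop) hmG
    rw [lintegral_pi_noiseLaw hmG, ← lintegral_sub_causal volume
      (fun i : Fin n × V => toLex (i.1, N.depth i.2))
      (fun y i => N.signal i.2 (G i) (C.sentOf m y i.1)) (hsig.comp measurable_prodMk_left)
      (fun i y y' h => C.signal_sentOf_congr N m h _) _ hmW]
    refine lintegral_congr fun y => ?_
    congr 2
    refine funext fun i => eq_of_causal (S := fun _ => True)
      (fun i : Fin n × V => toLex (i.1, N.depth i.2)) (fun i _ h => ?_) i trivial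
    rw [receivedAll_eq, C.signal_sentOf_congr N m fun j hj => h j hj trivial]
    simp [FadingNetwork.regroup]
  have hm2 : Measurable fun p : (Fin n × V → V → ℂ) × (Fin n × V → Fin T → ℂ) =>
      (∏ i, ENNReal.ofReal (noiseDensity (p.2 i - N.signal i.2 (p.1 i) (C.sentOf m p.2 i.1))))
        * Φ p.2 := hdens.mul (by fun_prop)
  have hm0 : Measurable fun ω => Φ (C.receivedAll N m ω) :=
    hΦ.comp (C.measurable_receivedAll N m)
  rw [← hmp.lintegral_comp hm0, lintegral_prod _ hm1.aemeasurable]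
  simp_rw [hG]
  rw [lintegral_lintegral_swap hm2.aemeasurable]
  refine lintegral_congr fun y => ?_
  have hdy : Measurable fun G : Fin n × V → V → ℂ =>
      ∏ i, ENNReal.ofReal (noiseDensity (y i - N.signal i.2 (G i) (C.sentOf m y i.1))) :=
    hdens.comp (f := fun G => (G, y)) (by fun_prop)
  -- The gains at different nodes and in different blocks are independent, so averaging the product
  -- averages each factor.
  rw [lintegral_mul_const _ hdy, lintegral_pi_prod (fun i : Fin n × V => N.gainLaw i.2)
    (fun i g => ENNReal.ofReal (noiseDensity (y i - N.signal i.2 g (C.sentOf m y i.1))))]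
  · simp_rw [N.ofReal_outDensity]
  · intro i
    exact ((N.measurable_noiseDensity_sub_signal i.2).comp
      (f := fun g => ((C.sentOf m y i.1, y i), g)) (by fun_prop)).ennreal_ofReal

/-! ### Converse for one code and one cut, by change of measure. -/

section Converse

variable (D : Finset V) (κ : V → (V → Fin T → ℂ) → (V → Fin T → ℂ) → ℝ)

open scoped Classical in
/-- The kernels `κ` at the nodes of `D`, and the conditional densities of the channel at the other
nodes, given the message. -/
noncomputable def cutKernel (m : Fin C.M) (i : Fin n × V) (y : Fin n × V → Fin T → ℂ) : ℝ :=
  if i.2 ∈ D then κ i.2 (C.sentOf m y i.1) (fun u => y (i.1, u))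
  else N.outDensity i.2 (C.sentOf m y i.1) (y i)

variable {D κ}

theorem measurable_cutKernel
    (hκm : ∀ v ∈ D, Measurable fun p : (V → Fin T → ℂ) × (V → Fin T → ℂ) => κ v p.1 p.2)
    (m : Fin C.M) (i : Fin n × V) : Measurable (C.cutKernel N D κ m i) := by
  unfold cutKernel
  split_ifs with h
  · exact (hκm _ h).comp (f := fun y : Fin n × V → Fin T → ℂ =>
      (C.sentOf m y i.1, fun u => y (i.1, u))) (by fun_prop)
  · exact (N.measurable_outDensity i.2).comp (f := fun y : Fin n × V → Fin T → ℂ =>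
      (C.sentOf m y i.1, y i)) (by fun_prop)

/-- The product of the kernels is a subprobability density, even if the message is guessed from
the signal received by a node of `D`. -/
theorem lintegral_prod_cutKernel_le_one {d : V} (hs : s ∉ D) (hd : d ∈ D) (ρ : V → ℕ)
    (hκm : ∀ v ∈ D, Measurable fun p : (V → Fin T → ℂ) × (V → Fin T → ℂ) => κ v p.1 p.2)
    (hκd : ∀ v ∈ D, ∀ x x' y y', y v = y' v →
      (∀ u ∈ D, ρ u < ρ v → x u = x' u ∧ y u = y' u) → κ v x y = κ v x' y')
    (hκ1 : ∀ v ∈ D, ∀ x y, ∫⁻ a, ENNReal.ofReal (κ v x (@Function.update _ _ (Classical.decEq V)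
      y v a)) ≤ 1)
    {ψ : (Fin n × V → Fin T → ℂ) → Fin C.M} (hψm : Measurable ψ)
    (hψ : ∀ y y', (∀ l, y (l, d) = y' (l, d)) → ψ y = ψ y') :
    ∫⁻ y, ∏ i, ENNReal.ofReal (C.cutKernel N D κ (ψ y) i y)
      ∂(Measure.pi fun _ : Fin n × V => volume) ≤ 1 := by
  classical
  -- The source lies outside `D`, so what nodes of `D` send is a function of what they receive,
  -- whatever the message.
  have hrel : ∀ u ∈ D, ∀ (m m' : Fin C.M) {y y' : Fin n × V → Fin T → ℂ} {l : Fin n},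
      (∀ l' ≤ l, y (l', u) = y' (l', u)) → C.sentOf m y l u = C.sentOf m' y' l u := by
    intro u hu m m' y y' l h
    have hus : u ≠ s := by rintro rfl; exact hs hu
    rw [C.sentOf_congr m h, sentOf, sentOf, C.enc_relay u hus m m']
  -- All coordinates of `D` come before all others, so a message guessed at `d` is already available
  -- to the densities outside `D`. Inside `D` the order is by block and then `ρ`; outside by block
  -- and then depth.
  let r : Fin n × V → ℕ ×ₗ (Fin n ×ₗ ℕ) := fun i =>
    toLex (if i.2 ∈ D then 0 else 1, toLex (i.1, if i.2 ∈ D then ρ i.2 else N.depth i.2))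
  have hrD : ∀ {l' l : Fin n} {u v : V}, u ∈ D → v ∈ D → l' ≤ l → ρ u < ρ v →
      r (l', u) < r (l, v) := by
    intro l' l u v hu hv hl h
    simp only [r, hu, hv, if_true, Prod.Lex.toLex_lt_toLex, true_and, lt_self_iff_false, false_or]
    exact hl.lt_or_eq.imp id fun h' => ⟨h', h⟩
  have hrDc : ∀ {l' l : Fin n} {u v : V}, u ∈ D → v ∉ D → r (l', u) < r (l, v) := by
    intro l' l u v hu hv
    simp [r, hu, hv, Prod.Lex.toLex_lt_toLex]
  have hrc : ∀ {l' l : Fin n} {u v : V}, N.graph.Adj u v → v ∉ D → l' ≤ l →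
      r (l', u) < r (l, v) := by
    intro l' l u v huv hv hl
    by_cases hu : u ∈ D
    · exact hrDc hu hv
    · simp only [r, hu, hv, if_false, Prod.Lex.toLex_lt_toLex, true_and, lt_self_iff_false,
        false_or]
      exact hl.lt_or_eq.imp id fun h' => ⟨h', N.depth_lt huv⟩
  refine lintegral_prod_le_one_of_causal (fun _ => volume) r
    (fun i y => ENNReal.ofReal (C.cutKernel N D κ (ψ y) i y)) (fun i => ?_)
    (fun ⟨l, v⟩ y y' hi hlow => ?_) (fun ⟨l, v⟩ y => ?_)
  · have h1 : Measurable fun p : Fin C.M × (Fin n × V → Fin T → ℂ) =>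
        C.cutKernel N D κ p.1 i p.2 :=
      measurable_from_prod_countable_right fun m => C.measurable_cutKernel N hκm m i
    exact (h1.comp (hψm.prodMk measurable_id)).ennreal_ofReal
  · congr 1
    by_cases hv : v ∈ D
    · simp only [cutKernel, hv, if_true]
      refine hκd v hv _ _ _ _ hi fun u hu huv => ⟨hrel u hu _ _ fun l' hl' => ?_, ?_⟩
      · exact hlow _ (hrD hu hv hl' huv)
      · exact hlow _ (hrD hu hv le_rfl huv)
    · simp only [cutKernel, hv, if_false]
      rw [hψ y y' fun l' => hlow _ (hrDc hd hv), hi]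
      exact N.outDensity_congr _ fun j hj => C.sentOf_congr _ fun l' hl' =>
        hlow _ (hrc hj hv hl')
  · have hup : ∀ (a : Fin T → ℂ) (l' : Fin n) (u : V), u ≠ v →
        Function.update y (l, v) a (l', u) = y (l', u) := fun a l' u hu =>
      Function.update_of_ne (by simp [hu]) _ _
    by_cases hv : v ∈ D
    · refine le_of_eq_of_le (lintegral_congr fun a => ?_)
        (hκ1 v hv (C.sentOf (ψ y) y l) fun u => y (l, u))
      simp only [cutKernel, hv, if_true]
      congr 1
      refine hκd v hv _ _ _ _ (by simp) fun u hu huv => ?_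
      have huv' : u ≠ v := by rintro rfl; exact lt_irrefl _ huv
      refine ⟨hrel u hu _ _ fun l' _ => hup a l' u huv', ?_⟩
      rw [Function.update_of_ne huv']
      exact hup a l u huv'
    · refine le_of_eq (Eq.trans (lintegral_congr fun a => ?_)
        (N.lintegral_outDensity v (C.sentOf (ψ y) y l)))
      simp only [cutKernel, hv, if_false]
      have hdv : d ≠ v := by rintro rfl; exact hv hd
      rw [hψ (Function.update y (l, v) a) y fun l' => hup a l' d hdv, Function.update_self]
      congr 1
      refine N.outDensity_congr _ fun j hj => C.sentOf_congr _ fun l' _ => hup a l' j ?_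
      rintro rfl
      exact lt_irrefl _ (N.depth_lt hj)

end Converse

end NetworkCode

namespace NetworkCode

variable {V : Type*} [Fintype V] {s : V} {T n : ℕ} (C : NetworkCode V s T n) (N : FadingNetwork V)

theorem integrable_blockSample (hn : 0 < n) {F : BlockSpace V T → ℝ}
    (hF : Integrable F (C.avgLaw N)) (m : Fin C.M) (l : Fin n) :
    Integrable (fun ω => F (C.blockSample N m l ω)) (Measure.pi fun _ : Fin n => N.blockLaw T) := by
  have h1 := integrable_finsetSum_measure.1 (integrable_finsetSum_measure.1 hF m (Finset.mem_univ _))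
    l (Finset.mem_univ _)
  rw [integrable_smul_measure (ENNReal.inv_ne_zero.2 (by finiteness))
    (ENNReal.inv_ne_top.2 (by have := C.M_pos; simp; omega))] at h1
  exact (integrable_map_measure h1.aestronglyMeasurable
    (C.measurable_blockSample N m l).aemeasurable).1 h1

theorem sum_integral_blockSample (hn : 0 < n) {F : BlockSpace V T → ℝ}
    (hF : Integrable F (C.avgLaw N)) :
    ∑ m, ∑ l, ∫ ω, F (C.blockSample N m l ω) ∂(Measure.pi fun _ : Fin n => N.blockLaw T)
      = C.M * n * ∫ ω, F ω ∂C.avgLaw N := by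
  have hM : (0 : ℝ) < C.M := by exact_mod_cast C.M_pos
  have hn' : (0 : ℝ) < n := by exact_mod_cast hn
  have h0 := fun m => integrable_finsetSum_measure.1 hF m (Finset.mem_univ _)
  have h1 := fun m l => integrable_finsetSum_measure.1 (h0 m) l (Finset.mem_univ _)
  have h2 : ∀ m l, Integrable F ((Measure.pi fun _ : Fin n => N.blockLaw T).map
      (C.blockSample N m l)) := fun m l =>
    (integrable_smul_measure (ENNReal.inv_ne_zero.2 (by finiteness))
      (ENNReal.inv_ne_top.2 (by have := C.M_pos; simp; omega))).1 (h1 m l)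
  rw [avgLaw, integral_finsetSum_measure fun m _ => h0 m]
  simp_rw [integral_finsetSum_measure fun l _ => h1 _ l, integral_smul_measure]
  rw [Finset.mul_sum]
  refine Finset.sum_congr rfl fun m _ => ?_
  rw [Finset.mul_sum]
  refine Finset.sum_congr rfl fun l _ => ?_
  rw [integral_map (C.measurable_blockSample N m l).aemeasurable (h2 m l).aestronglyMeasurable]
  simp only [ENNReal.toReal_inv, ENNReal.toReal_mul, ENNReal.toReal_natCast, smul_eq_mul]
  field_simp

variable {N} {D : Finset V} {κ : V → (V → Fin T → ℂ) → (V → Fin T → ℂ) → ℝ}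

/-- The weight of the message `m` in the comparison of the channel with the kernels. -/
noncomputable def guessWeight (d : V) (m : Fin C.M) (y : Fin n × V → Fin T → ℂ) : ℝ :=
  if C.dec (fun l => y (l, d)) = m then (C.M : ℝ) / 2 else 1 / 2

omit [Fintype V] in
theorem guessWeight_pos (d : V) (m : Fin C.M) (y : Fin n × V → Fin T → ℂ) :
    0 < C.guessWeight d m y := by
  have hM : (0 : ℝ) < C.M := by exact_mod_cast C.M_pos
  unfold guessWeight
  split_ifs <;> positivity

omit [Fintype V] in
theorem measurable_guess (d : V) : Measurable fun y : Fin n × V → Fin T → ℂ =>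
    C.dec (fun l => y (l, d)) :=
  C.measurable_dec.comp (by fun_prop)

omit [Fintype V] in
theorem measurable_guessWeight (d : V) (m : Fin C.M) : Measurable (C.guessWeight d m) :=
  Measurable.ite ((C.measurable_guess d) (measurableSet_singleton m)) measurable_const
    measurable_const

/-- This takes the place of Fano's inequality. The part of the weight supported on correct guesses
contributes at most `M/2` in total, since the guess is correct with total mass at most one over all
messages. The constant part `1/2` contributes at most `1/2` for each of the `M` messages. -/
theorem sum_lintegral_guessWeight_le {d : V} (hs : s ∉ D) (hd : d ∈ D) (ρ : V → ℕ)
    (hκm : ∀ v ∈ D, Measurable fun p : (V → Fin T → ℂ) × (V → Fin T → ℂ) => κ v p.1 p.2)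
    (hκd : ∀ v ∈ D, ∀ x x' y y', y v = y' v →
      (∀ u ∈ D, ρ u < ρ v → x u = x' u ∧ y u = y' u) → κ v x y = κ v x' y')
    (hκ1 : ∀ v ∈ D, ∀ x y, ∫⁻ a, ENNReal.ofReal (κ v x (@Function.update _ _ (Classical.decEq V)
      y v a)) ≤ 1) :
    ∑ m, ∫⁻ y, ENNReal.ofReal (C.guessWeight d m y) *
        ∏ i, ENNReal.ofReal (C.cutKernel N D κ m i y)
      ∂(Measure.pi fun _ : Fin n × V => volume) ≤ C.M := by
  classical
  have hK : ∀ m, Measurable fun y => ∏ i, ENNReal.ofReal (C.cutKernel N D κ m i y) := fun m =>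
    Finset.measurable_prod _ fun i _ => (C.measurable_cutKernel N hκm m i).ennreal_ofReal
  have hind : ∀ m, Measurable fun y : Fin n × V → Fin T → ℂ =>
      if C.dec (fun l => y (l, d)) = m then (1 : ℝ≥0∞) else 0 := fun m =>
    Measurable.ite ((C.measurable_guess d) (measurableSet_singleton m)) measurable_const
      measurable_const
  have hindK : ∀ m, Measurable fun y : Fin n × V → Fin T → ℂ =>
      (if C.dec (fun l => y (l, d)) = m then (1 : ℝ≥0∞) else 0) *
        ∏ i, ENNReal.ofReal (C.cutKernel N D κ m i y) := fun m => (hind m).mul (hK m)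
  have hindK' : ∀ m, Measurable fun y : Fin n × V → Fin T → ℂ => (C.M : ℝ≥0∞) / 2 *
      ((if C.dec (fun l => y (l, d)) = m then (1 : ℝ≥0∞) else 0) *
        ∏ i, ENNReal.ofReal (C.cutKernel N D κ m i y)) := fun m => (hindK m).const_mul _
  have hle : ∀ m y, ENNReal.ofReal (C.guessWeight d m y) *
        ∏ i, ENNReal.ofReal (C.cutKernel N D κ m i y)
      ≤ (C.M : ℝ≥0∞) / 2 * ((if C.dec (fun l => y (l, d)) = m then (1 : ℝ≥0∞) else 0) *
          ∏ i, ENNReal.ofReal (C.cutKernel N D κ m i y))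
        + 1 / 2 * ∏ i, ENNReal.ofReal (C.cutKernel N D κ m i y) := by
    intro m y
    rw [← mul_assoc, ← add_mul]
    gcongr
    unfold guessWeight
    split_ifs
    · rw [ENNReal.ofReal_div_of_pos two_pos, ENNReal.ofReal_natCast, ENNReal.ofReal_ofNat, mul_one]
      exact le_self_add
    · rw [ENNReal.ofReal_div_of_pos two_pos, ENNReal.ofReal_one, ENNReal.ofReal_ofNat]
      exact le_add_self
  -- For each `y` only the message equal to the guess survives, so the sum is the kernel product
  -- with the message replaced by the guess.
  have h1 : ∑ m, ∫⁻ y, (if C.dec (fun l => y (l, d)) = m then (1 : ℝ≥0∞) else 0) *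
          ∏ i, ENNReal.ofReal (C.cutKernel N D κ m i y)
      ∂(Measure.pi fun _ : Fin n × V => volume) ≤ 1 := by
    rw [← lintegral_finsetSum _ fun m _ => hindK m]
    refine le_of_eq_of_le (lintegral_congr fun y => ?_) (C.lintegral_prod_cutKernel_le_one N hs hd ρ
      hκm hκd hκ1 (C.measurable_guess d) fun y y' h => by simp_rw [h])
    rw [Finset.sum_eq_single (C.dec fun l => y (l, d))]
    · simp
    · intro m _ hm
      rw [if_neg hm.symm, zero_mul]
    · simp
  have h2 : ∀ m, ∫⁻ y, ∏ i, ENNReal.ofReal (C.cutKernel N D κ m i y)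
      ∂(Measure.pi fun _ : Fin n × V => volume) ≤ 1 := fun m =>
    C.lintegral_prod_cutKernel_le_one N hs hd ρ hκm hκd hκ1 (ψ := fun _ => m) measurable_const
      fun _ _ _ => rfl
  calc _ ≤ ∑ m, ∫⁻ y, ((C.M : ℝ≥0∞) / 2 * ((if C.dec (fun l => y (l, d)) = m then (1 : ℝ≥0∞) else 0) *
          ∏ i, ENNReal.ofReal (C.cutKernel N D κ m i y))
        + 1 / 2 * ∏ i, ENNReal.ofReal (C.cutKernel N D κ m i y))
          ∂(Measure.pi fun _ : Fin n × V => volume) :=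
        Finset.sum_le_sum fun m _ => lintegral_mono fun y => hle m y
    _ = (C.M : ℝ≥0∞) / 2 * ∑ m, ∫⁻ y, (if C.dec (fun l => y (l, d)) = m then (1 : ℝ≥0∞) else 0) *
          ∏ i, ENNReal.ofReal (C.cutKernel N D κ m i y)
            ∂(Measure.pi fun _ : Fin n × V => volume)
        + 1 / 2 * ∑ m, ∫⁻ y, ∏ i, ENNReal.ofReal (C.cutKernel N D κ m i y)
            ∂(Measure.pi fun _ : Fin n × V => volume) := by
        rw [Finset.mul_sum, Finset.mul_sum, ← Finset.sum_add_distrib]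
        refine Finset.sum_congr rfl fun m _ => ?_
        rw [lintegral_add_left (hindK' m), lintegral_const_mul _ (hindK m), lintegral_const_mul _ (hK m)]
    _ ≤ (C.M : ℝ≥0∞) / 2 * 1 + 1 / 2 * ∑ _m : Fin C.M, 1 := by
        gcongr with m
        exact h2 m
    _ = C.M := by
        simp only [mul_one, Finset.sum_const, Finset.card_univ, Fintype.card_fin, nsmul_eq_mul,
          one_div]
        rw [mul_comm 2⁻¹, ← div_eq_mul_inv, ENNReal.add_halves]

/-- Outside `D` the kernels are the true densities, so the likelihood ratio of the two systems
involves the nodes of `D` only. -/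
theorem exp_sum_log_cutKernel (hκ0 : ∀ v ∈ D, ∀ x y, 0 < κ v x y) (m : Fin C.M)
    (y : Fin n × V → Fin T → ℂ) :
    (∏ i, ENNReal.ofReal (N.outDensity i.2 (C.sentOf m y i.1) (y i))) *
      ENNReal.ofReal (Real.exp (∑ l, ∑ v ∈ D, (Real.log (κ v (C.sentOf m y l) fun u => y (l, u))
        - Real.log (N.outDensity v (C.sentOf m y l) (y (l, v))))))
      = ∏ i, ENNReal.ofReal (C.cutKernel N D κ m i y) := by
  classical
  have e1 : ∑ l, ∑ v ∈ D, (Real.log (κ v (C.sentOf m y l) fun u => y (l, u))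
        - Real.log (N.outDensity v (C.sentOf m y l) (y (l, v))))
      = ∑ i : Fin n × V, (Real.log (C.cutKernel N D κ m i y)
        - Real.log (N.outDensity i.2 (C.sentOf m y i.1) (y i))) := by
    rw [Fintype.sum_prod_type]
    refine Finset.sum_congr rfl fun l _ => ?_
    rw [← Finset.sum_subset (Finset.subset_univ D)]
    · exact Finset.sum_congr rfl fun v hv => by simp [cutKernel, hv]
    · intro v _ hv
      simp [cutKernel, hv]
  have hK0 : ∀ i, 0 < C.cutKernel N D κ m i y := by
    intro i
    unfold cutKernel
    split_ifs with h
    · exact hκ0 _ h _ _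
    · exact N.outDensity_pos _ _ _
  rw [e1, Real.exp_sum, ENNReal.ofReal_prod_of_nonneg fun _ _ => (Real.exp_pos _).le,
    ← Finset.prod_mul_distrib]
  refine Finset.prod_congr rfl fun i _ => ?_
  have hq := N.outDensity_pos i.2 (C.sentOf m y i.1) (y i)
  rw [← ENNReal.ofReal_mul hq.le, Real.exp_sub, Real.exp_log (hK0 i), Real.exp_log hq,
    mul_div_cancel₀ _ hq.ne']

/-- Converse for one cut: the rate is bounded by the divergence of the channel from any system of
kernels on the destination side which is causal along an ordering of the nodes. -/
theorem converse {d : V} (hs : s ∉ D) (hd : d ∈ D) (ρ : V → ℕ) (hn : 0 < n)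
    (hC : C.PowerConstraint N)
    (hκm : ∀ v ∈ D, Measurable fun p : (V → Fin T → ℂ) × (V → Fin T → ℂ) => κ v p.1 p.2)
    (hκ0 : ∀ v ∈ D, ∀ x y, 0 < κ v x y)
    (hκd : ∀ v ∈ D, ∀ x x' y y', y v = y' v →
      (∀ u ∈ D, ρ u < ρ v → x u = x' u ∧ y u = y' u) → κ v x y = κ v x' y')
    (hκ1 : ∀ v ∈ D, ∀ x y, ∫⁻ a, ENNReal.ofReal (κ v x (@Function.update _ _ (Classical.decEq V)
      y v a)) ≤ 1)
    (hκi : ∀ v ∈ D, Integrable (fun ω => Real.log (κ v ω.1 fun u => BlockSpace.recv N u ω))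
      (C.avgLaw N)) :
    (1 - C.errorProb N d) * Real.log C.M - Real.log 2
      ≤ n * ∑ v ∈ D, (∫ ω, -Real.log (κ v ω.1 fun u => BlockSpace.recv N u ω) ∂C.avgLaw N
          - ∫ ω, N.outInfo v ω ∂C.avgLaw N) := by
  classical
  have := C.isProbabilityMeasure_avgLaw N hn
  have hfb := C.isFeedbackLaw_avgLaw N hn hC
  have hM : (0 : ℝ) < C.M := by exact_mod_cast C.M_pos
  set μ := Measure.pi fun _ : Fin n => N.blockLaw T with hμ
  let F : BlockSpace V T → ℝ := fun ω => ∑ v ∈ D,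
    (Real.log (κ v ω.1 fun u => BlockSpace.recv N u ω) + N.outInfo v ω)
  have hFv : ∀ v ∈ D, Integrable (fun ω => Real.log (κ v ω.1 fun u => BlockSpace.recv N u ω)
      + N.outInfo v ω) (C.avgLaw N) := fun v hv => (hκi v hv).add (hfb.integrable_outInfo v)
  have hFi : Integrable F (C.avgLaw N) := integrable_finsetSum _ hFv
  have hFint : ∫ ω, F ω ∂C.avgLaw N = -∑ v ∈ D,
      (∫ ω, -Real.log (κ v ω.1 fun u => BlockSpace.recv N u ω) ∂C.avgLaw N
          - ∫ ω, N.outInfo v ω ∂C.avgLaw N) := by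
    rw [integral_finsetSum _ hFv, ← Finset.sum_neg_distrib]
    refine Finset.sum_congr rfl fun v hv => ?_
    rw [integral_add (hκi v hv) (hfb.integrable_outInfo v), integral_neg]
    ring
  let L : Fin C.M → (Fin n → (V → V → ℂ) × (V → Fin T → ℂ)) → ℝ := fun m ω =>
    Real.log (C.guessWeight d m (C.receivedAll N m ω))
  let B : Fin C.M → (Fin n → (V → V → ℂ) × (V → Fin T → ℂ)) → ℝ := fun m ω =>
    ∑ l, F (C.blockSample N m l ω)
  have hBi : ∀ m, Integrable (B m) μ := fun m =>
    integrable_finsetSum _ fun l _ => C.integrable_blockSample N hn hFi m l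
  have hBsum : ∑ m, ∫ ω, B m ω ∂μ = C.M * n * ∫ ω, F ω ∂C.avgLaw N := by
    rw [← C.sum_integral_blockSample N hn hFi]
    exact Finset.sum_congr rfl fun m _ =>
      integral_finsetSum _ fun l _ => C.integrable_blockSample N hn hFi m l
  let A : Fin C.M → Set (Fin n → (V → V → ℂ) × (V → Fin T → ℂ)) := fun m =>
    {ω | C.dec (C.received N m ω d) ≠ m}
  have hAm : ∀ m, MeasurableSet (A m) := fun m =>
    (((C.measurable_guess d).comp (C.measurable_receivedAll N m))
      (measurableSet_singleton m)).compl
  -- The logarithm of the weight is `log M - log 2` on correct decisions and `- log 2` on errors;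
  -- its mean is the Fano-type left-hand side.
  have hLeq : ∀ m, L m = fun ω => (Real.log C.M - Real.log 2)
      - (A m).indicator (fun _ => Real.log C.M) ω := by
    intro m
    funext ω
    by_cases hω : ω ∈ A m
    · have h1 : ¬ C.dec (fun l => C.receivedAll N m ω (l, d)) = m := hω
      simp only [L, guessWeight, h1, if_false, Set.indicator_of_mem hω]
      rw [one_div, Real.log_inv]; ring
    · have h1 : C.dec (fun l => C.receivedAll N m ω (l, d)) = m := not_not.1 hω
      simp only [L, guessWeight, h1, if_true, Set.indicator_of_notMem hω]
      rw [Real.log_div hM.ne' two_ne_zero, sub_zero]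
  have hLi : ∀ m, Integrable (L m) μ := by
    intro m
    rw [hLeq]
    exact (integrable_const _).sub ((integrable_const _).indicator (hAm m))
  have hLsum : ∑ m, ∫ ω, L m ω ∂μ
      = C.M * ((1 - C.errorProb N d) * Real.log C.M - Real.log 2) := by
    have h1 : ∀ m, ∫ ω, L m ω ∂μ = (Real.log C.M - Real.log 2) - μ.real (A m) * Real.log C.M := by
      intro m
      rw [hLeq, integral_sub (integrable_const _) ((integrable_const _).indicator (hAm m)),
        integral_const, integral_indicator_const _ (hAm m)]
      simp
    simp_rw [h1]
    rw [Finset.sum_sub_distrib, ← Finset.sum_mul]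
    have h2 : ∑ m, μ.real (A m) = C.M * C.errorProb N d := by
      rw [errorProb, mul_div_cancel₀ _ hM.ne']
    rw [h2]
    simp only [Finset.sum_const, Finset.card_univ, Fintype.card_fin, nsmul_eq_mul]
    ring
  let u : Fin C.M → ℝ≥0∞ := fun m => ∫⁻ ω, ENNReal.ofReal (Real.exp (L m ω + B m ω)) ∂μ
  -- The exponential of `L + B` is the guess weight times the likelihood ratio, so its mean under
  -- the code is an integral against the kernel product.
  have hu : ∑ m, u m ≤ C.M := by
    refine le_of_eq_of_le (Finset.sum_congr rfl fun m _ => ?_)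
      (C.sum_lintegral_guessWeight_le (N := N) hs hd ρ hκm hκd hκ1)
    let Φ : (Fin n × V → Fin T → ℂ) → ℝ≥0∞ := fun y => ENNReal.ofReal (C.guessWeight d m y) *
      ENNReal.ofReal (Real.exp (∑ l, ∑ v ∈ D, (Real.log (κ v (C.sentOf m y l) fun u => y (l, u))
        - Real.log (N.outDensity v (C.sentOf m y l) (y (l, v))))))
    have hΦ : Measurable Φ := by
      refine (C.measurable_guessWeight d m).ennreal_ofReal.mul (Measurable.ennreal_ofReal
        (Real.measurable_exp.comp (Finset.measurable_sum _ fun l _ =>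
          Finset.measurable_sum _ fun v hv => Measurable.sub ?_ ?_)))
      · exact ((hκm v hv).comp (f := fun y : Fin n × V → Fin T → ℂ =>
          (C.sentOf m y l, fun u => y (l, u))) (by fun_prop)).log
      · exact ((N.measurable_outDensity v).comp (f := fun y : Fin n × V → Fin T → ℂ =>
          (C.sentOf m y l, y (l, v))) (by fun_prop)).log
    have e1 : u m = ∫⁻ ω, Φ (C.receivedAll N m ω) ∂μ := by
      refine lintegral_congr fun ω => ?_
      rw [Real.exp_add, ENNReal.ofReal_mul (Real.exp_pos _).le,
        Real.exp_log (C.guessWeight_pos d m _)]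
      simp only [Φ]
      congr 3
      refine Finset.sum_congr rfl fun l _ => Finset.sum_congr rfl fun v _ => ?_
      rw [FadingNetwork.outInfo, ← sub_eq_add_neg]
      simp_rw [recv_blockSample]
      rfl
    rw [e1, C.lintegral_receivedAll N m hΦ]
    refine lintegral_congr fun y => ?_
    rw [← C.exp_sum_log_cutKernel (N := N) hκ0 m y]
    simp only [Φ]
    ring
  have hut : ∀ m, u m ≠ ∞ := fun m =>
    ((Finset.single_le_sum (fun _ _ => zero_le) (Finset.mem_univ m)).trans hu).trans_lt
      (ENNReal.natCast_lt_top _) |>.ne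
  -- From `x + 1 ≤ exp x`. Summed over the messages, the ones add up to `M` and cancel the bound for
  -- `∑ u m`.
  have hle : ∀ m, ∫ ω, L m ω ∂μ + ∫ ω, B m ω ∂μ + 1 ≤ (u m).toReal := by
    intro m
    have hi : Integrable (fun ω => L m ω + B m ω) μ := (hLi m).add (hBi m)
    have hexp : Integrable (fun ω => Real.exp (L m ω + B m ω)) μ := by
      refine ⟨Real.continuous_exp.comp_aestronglyMeasurable hi.aestronglyMeasurable, ?_⟩
      rw [hasFiniteIntegral_iff_ofReal (Eventually.of_forall fun ω => (Real.exp_pos _).le)]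
      exact (hut m).lt_top
    have h1 : ∫ ω, Real.exp (L m ω + B m ω) ∂μ = (u m).toReal :=
      integral_eq_lintegral_of_nonneg_ae (Eventually.of_forall fun ω => (Real.exp_pos _).le)
        hexp.aestronglyMeasurable
    rw [← h1]
    calc ∫ ω, L m ω ∂μ + ∫ ω, B m ω ∂μ + 1 = ∫ ω, (L m ω + B m ω + 1) ∂μ := by
          rw [integral_add hi (integrable_const _), integral_add (hLi m) (hBi m)]
          simp
      _ ≤ _ := integral_mono (hi.add (integrable_const _)) hexp fun ω =>
          Real.add_one_le_exp (L m ω + B m ω)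
  have hsum : ∑ m, (u m).toReal ≤ C.M := by
    rw [← ENNReal.toReal_sum fun m _ => hut m]
    exact ENNReal.toReal_le_of_le_ofReal hM.le (by rwa [ENNReal.ofReal_natCast])
  have htot := (Finset.sum_le_sum fun m (_ : m ∈ Finset.univ) => hle m).trans hsum
  rw [Finset.sum_add_distrib, Finset.sum_add_distrib, hLsum, hBsum, hFint] at htot
  simp only [Finset.sum_const, Finset.card_univ, Fintype.card_fin, nsmul_eq_mul, mul_one] at htot
  have h3 : C.M * ((1 - C.errorProb N d) * Real.log C.M - Real.log 2) ≤ C.M *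
      (n * ∑ v ∈ D, (∫ ω, -Real.log (κ v ω.1 fun u => BlockSpace.recv N u ω) ∂C.avgLaw N
          - ∫ ω, N.outInfo v ω ∂C.avgLaw N)) := by linarith
  exact le_of_mul_le_mul_left h3 hM

end NetworkCode

/-! ### A reference density with polynomial tails. -/

section Reference

variable (T : ℕ)

/-- The exponent of the reference density. -/
noncomputable def refExponent : ℝ := Module.finrank ℝ (Fin T → ℂ) + 1

theorem integrable_refDensity :
    Integrable fun y : Fin T → ℂ => (1 + ‖y‖) ^ (-refExponent T) :=
  integrable_one_add_norm (by unfold refExponent; linarith)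

theorem one_add_norm_rpow_pos {T : ℕ} (y : Fin T → ℂ) : 0 < (1 + ‖y‖) ^ (-refExponent T) :=
  Real.rpow_pos_of_pos (by positivity) _

theorem integral_one_add_norm_pos : 0 < ∫ y : Fin T → ℂ, (1 + ‖y‖) ^ (-refExponent T) := by
  refine (integral_pos_iff_support_of_nonneg (fun y => (one_add_norm_rpow_pos y).le)
    (integrable_refDensity T)).2 ?_
  have : Function.support (fun y : Fin T → ℂ => (1 + ‖y‖) ^ (-refExponent T)) = Set.univ :=
    Set.eq_univ_of_forall fun y => (one_add_norm_rpow_pos y).ne'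
  rw [this]
  exact Measure.measure_univ_pos.2 (NeZero.ne _)

variable {T}

/-- A probability density with polynomial tails. -/
noncomputable def refDensity (y : Fin T → ℂ) : ℝ :=
  (∫ y : Fin T → ℂ, (1 + ‖y‖) ^ (-refExponent T))⁻¹ * (1 + ‖y‖) ^ (-refExponent T)

theorem refDensity_pos (y : Fin T → ℂ) : 0 < refDensity y :=
  mul_pos (inv_pos.2 (integral_one_add_norm_pos T)) (one_add_norm_rpow_pos y)

@[fun_prop]
theorem continuous_refDensity : Continuous (refDensity : (Fin T → ℂ) → ℝ) := by
  unfold refDensity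
  refine continuous_const.mul (Continuous.rpow_const (by fun_prop) fun y => Or.inl ?_)
  positivity

@[fun_prop]
theorem measurable_refDensity : Measurable (refDensity : (Fin T → ℂ) → ℝ) :=
  continuous_refDensity.measurable

/-- The growth is only logarithmic, so second moments of the received signals dominate the square
and the integrals converge along the sequence of laws. A Gaussian reference would grow like `‖y‖²`,
for which bounded second moments are not enough. -/
theorem neg_log_refDensity (y : Fin T → ℂ) : -Real.log (refDensity y)
    = Real.log (∫ y : Fin T → ℂ, (1 + ‖y‖) ^ (-refExponent T))
      + refExponent T * Real.log (1 + ‖y‖) := by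
  rw [refDensity, Real.log_mul (inv_pos.2 (integral_one_add_norm_pos T)).ne'
    (one_add_norm_rpow_pos y).ne', Real.log_inv, Real.log_rpow (by positivity)]
  ring

variable (T) in
/-- The probability measure with density `refDensity`. -/
noncomputable def refMeasure : Measure (Fin T → ℂ) :=
  volume.withDensity fun y => ENNReal.ofReal (refDensity y)

instance : IsProbabilityMeasure (refMeasure T) := by
  refine ⟨?_⟩
  rw [refMeasure, withDensity_apply _ MeasurableSet.univ, Measure.restrict_univ,
    ← ofReal_integral_eq_lintegral_ofReal]
  · simp_rw [refDensity]
    rw [integral_const_mul, inv_mul_cancel₀ (integral_one_add_norm_pos T).ne', ENNReal.ofReal_one]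
  · exact (integrable_refDensity T).const_mul _
  · exact Eventually.of_forall fun y => (refDensity_pos y).le

theorem lintegral_refMeasure {F : (Fin T → ℂ) → ℝ≥0∞} (hF : Measurable F) :
    ∫⁻ y, F y ∂refMeasure T = ∫⁻ y, ENNReal.ofReal (refDensity y) * F y := by
  rw [refMeasure, lintegral_withDensity_eq_lintegral_mul _ (by fun_prop) hF]
  rfl

theorem log_one_add_norm_sq_le (y : Fin T → ℂ) :
    Real.log (1 + ‖y‖) ^ 2 ≤ ∑ t, ‖y t‖ ^ 2 := by
  have h0 : 0 ≤ Real.log (1 + ‖y‖) := Real.log_nonneg (by linarith [norm_nonneg y])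
  have h1 : Real.log (1 + ‖y‖) ≤ ‖y‖ := by
    have := Real.log_le_sub_one_of_pos (x := 1 + ‖y‖) (by positivity)
    linarith
  have h2 : ‖y‖ ≤ Real.sqrt (∑ t, ‖y t‖ ^ 2) :=
    (pi_norm_le_iff_of_nonneg (Real.sqrt_nonneg _)).2 fun t => Real.le_sqrt_of_sq_le
      (Finset.single_le_sum (f := fun t => ‖y t‖ ^ 2) (fun _ _ => sq_nonneg _) (Finset.mem_univ t))
  calc Real.log (1 + ‖y‖) ^ 2 ≤ Real.sqrt (∑ t, ‖y t‖ ^ 2) ^ 2 :=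
        pow_le_pow_left₀ h0 (h1.trans h2) 2
    _ = _ := Real.sq_sqrt (Finset.sum_nonneg fun _ _ => sq_nonneg _)

end Reference

/-! ### Exponentially tilted conditional densities. -/

section Partition

variable {T : ℕ} {Z : Type*} [TopologicalSpace Z] [FirstCountableTopology Z]
  (f : BoundedContinuousFunction (Z × (Fin T → ℂ)) ℝ)

/-- The normalization of the density proportional to `exp f` with respect to `refMeasure`. -/
noncomputable def partitionFn (z : Z) : ℝ := ∫ y, Real.exp (f (z, y)) ∂refMeasure T

omit [FirstCountableTopology Z] in
theorem integrable_exp_refMeasure (z : Z) :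
    Integrable (fun y => Real.exp (f (z, y))) (refMeasure T) := by
  refine Integrable.of_bound (by fun_prop : Continuous fun y => Real.exp (f (z, y))).aestronglyMeasurable
    (Real.exp ‖f‖) (Eventually.of_forall fun y => ?_)
  rw [Real.norm_eq_abs, abs_of_pos (Real.exp_pos _)]
  exact Real.exp_le_exp.2 ((le_abs_self _).trans (f.norm_coe_le_norm _))

omit [FirstCountableTopology Z] in
theorem partitionFn_mem (z : Z) :
    Real.exp (-‖f‖) ≤ partitionFn f z ∧ partitionFn f z ≤ Real.exp ‖f‖ := by
  have hb : ∀ y, |f (z, y)| ≤ ‖f‖ := fun y => f.norm_coe_le_norm _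
  constructor
  · calc Real.exp (-‖f‖) = ∫ _, Real.exp (-‖f‖) ∂refMeasure T := by simp
      _ ≤ _ := integral_mono (integrable_const _) (integrable_exp_refMeasure f z) fun y =>
        Real.exp_le_exp.2 (neg_le_of_abs_le (hb y))
  · calc partitionFn f z ≤ ∫ _, Real.exp ‖f‖ ∂refMeasure T :=
        integral_mono (integrable_exp_refMeasure f z) (integrable_const _) fun y =>
          Real.exp_le_exp.2 (le_of_abs_le (hb y))
      _ = _ := by simp

omit [FirstCountableTopology Z] in
theorem partitionFn_pos (z : Z) : 0 < partitionFn f z :=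
  (Real.exp_pos _).trans_le (partitionFn_mem f z).1

omit [FirstCountableTopology Z] in
theorem abs_log_partitionFn_le (z : Z) : |Real.log (partitionFn f z)| ≤ ‖f‖ := by
  rw [abs_le]
  constructor
  · exact (Real.le_log_iff_exp_le (partitionFn_pos f z)).2 (partitionFn_mem f z).1
  · exact (Real.log_le_iff_le_exp (partitionFn_pos f z)).2 (partitionFn_mem f z).2

/-- Together with `abs_log_partitionFn_le` this makes the logarithm of the normalization a bounded
continuous test function. -/
theorem continuous_partitionFn : Continuous (partitionFn f) := by
  refine continuous_of_dominated (bound := fun _ => Real.exp ‖f‖)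
    (fun z => (integrable_exp_refMeasure f z).aestronglyMeasurable)
    (fun z => Eventually.of_forall fun y => ?_) (integrable_const _)
    (Eventually.of_forall fun y => by fun_prop)
  rw [Real.norm_eq_abs, abs_of_pos (Real.exp_pos _)]
  exact Real.exp_le_exp.2 ((le_abs_self _).trans (f.norm_coe_le_norm _))

omit [FirstCountableTopology Z] in
theorem lintegral_exp_mul_refDensity_div (z : Z) :
    ∫⁻ y, ENNReal.ofReal (Real.exp (f (z, y)) * refDensity y / partitionFn f z) = 1 := by
  have hm : Measurable fun y : Fin T → ℂ => ENNReal.ofReal (Real.exp (f (z, y))) :=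
    (by fun_prop : Continuous fun y => Real.exp (f (z, y))).measurable.ennreal_ofReal
  have h1 : ∀ y, ENNReal.ofReal (Real.exp (f (z, y)) * refDensity y / partitionFn f z)
      = (ENNReal.ofReal (refDensity y) * ENNReal.ofReal (Real.exp (f (z, y))))
        * ENNReal.ofReal (partitionFn f z)⁻¹ := by
    intro y
    rw [← ENNReal.ofReal_mul (refDensity_pos y).le, ← ENNReal.ofReal_mul
      (mul_pos (refDensity_pos y) (Real.exp_pos _)).le]
    congr 1
    rw [div_eq_mul_inv]; ring
  simp_rw [h1]
  have hm' : Measurable fun y : Fin T → ℂ =>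
      ENNReal.ofReal (refDensity y) * ENNReal.ofReal (Real.exp (f (z, y))) :=
    Measurable.mul (by fun_prop) hm
  rw [lintegral_mul_const _ hm', ← lintegral_refMeasure hm,
    ← ofReal_integral_eq_lintegral_ofReal (integrable_exp_refMeasure f z)
      (Eventually.of_forall fun y => (Real.exp_pos _).le), ← ENNReal.ofReal_mul]
  · rw [← partitionFn, mul_inv_cancel₀ (partitionFn_pos f z).ne', ENNReal.ofReal_one]
  · exact (partitionFn_pos f z).le

end Partition

/-- Jensen's inequality for the logarithm. -/
theorem integral_log_le_log_integral {Ω : Type*} [MeasurableSpace Ω] {P : Measure Ω}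
    [IsProbabilityMeasure P] {g : Ω → ℝ} (hg : ∀ ω, 0 < g ω) (hi : Integrable g P)
    (hl : Integrable (fun ω => Real.log (g ω)) P) :
    ∫ ω, Real.log (g ω) ∂P ≤ Real.log (∫ ω, g ω ∂P) := by
  have hm : 0 < ∫ ω, g ω ∂P := by
    refine (integral_pos_iff_support_of_nonneg (fun ω => (hg ω).le) hi).2 ?_
    have : Function.support g = Set.univ := Set.eq_univ_of_forall fun ω => (hg ω).ne'
    rw [this, measure_univ]; exact one_pos
  set m := ∫ ω, g ω ∂P with hmdef
  have h1 : ∀ ω, Real.log (g ω) ≤ Real.log m + (g ω / m - 1) := by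
    intro ω
    have := Real.log_le_sub_one_of_pos (div_pos (hg ω) hm)
    rw [Real.log_div (hg ω).ne' hm.ne'] at this
    linarith
  have hi2 : Integrable (fun ω => g ω / m - 1) P := (hi.div_const m).sub (integrable_const 1)
  calc ∫ ω, Real.log (g ω) ∂P ≤ ∫ ω, (Real.log m + (g ω / m - 1)) ∂P :=
        integral_mono hl ((integrable_const _).add hi2) h1
    _ = Real.log m := by
        rw [integral_add (integrable_const _) hi2, integral_sub (hi.div_const m) (integrable_const _),
          integral_div, ← hmdef, div_self hm.ne']
        simp

/-- The Donsker-Varadhan bound for a sum of divergences. -/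
theorem klDiv_ne_top_and_sum_le {ι : Type*} [Fintype ι] {X : ι → Type*}
    [∀ i, TopologicalSpace (X i)] [∀ i, TopologicalSpace.PseudoMetrizableSpace (X i)]
    [∀ i, MeasurableSpace (X i)] [∀ i, BorelSpace (X i)] {μ ν : ∀ i, Measure (X i)}
    [∀ i, IsProbabilityMeasure (μ i)] [∀ i, IsProbabilityMeasure (ν i)] {S : ℝ}
    (h : ∀ f : ∀ i, BoundedContinuousFunction (X i) ℝ,
      ∑ i, (∫ x, f i x ∂μ i - Real.log (∫ x, Real.exp (f i x) ∂ν i)) ≤ S) :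
    (∀ i, InformationTheory.klDiv (μ i) (ν i) ≠ ∞) ∧
      ∑ i, (InformationTheory.klDiv (μ i) (ν i)).toReal ≤ S := by
  classical
  let φ : ∀ i, BoundedContinuousFunction (X i) ℝ → ℝ := fun i f =>
    ∫ x, f x ∂μ i - Real.log (∫ x, Real.exp (f x) ∂ν i)
  have h0 : ∀ i, φ i 0 = 0 := by intro i; simp [φ]
  -- Setting the other test functions to zero turns the bound on the sum into a bound on a single
  -- term.
  have hbdd : ∀ i, BddAbove (Set.range (φ i)) := by
    intro i
    refine ⟨S, ?_⟩
    rintro _ ⟨f, rfl⟩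
    have h1 := h (Function.update (0 : ∀ i, BoundedContinuousFunction (X i) ℝ) i f)
    have h2 : ∑ j, φ j (Function.update (0 : ∀ i, BoundedContinuousFunction (X i) ℝ) i f j) = φ i f := by
      rw [Finset.sum_eq_single i]
      · rw [Function.update_self]
      · intro j _ hj
        rw [Function.update_of_ne hj]
        exact h0 j
      · simp
    rw [← h2]; exact h1
  let a : ι → ℝ := fun i => ⨆ f, φ i f
  have ha0 : ∀ i, 0 ≤ a i := fun i => (h0 i).symm.le.trans (le_ciSup (hbdd i) 0)
  have hkl : ∀ i, InformationTheory.klDiv (μ i) (ν i) ≤ ENNReal.ofReal (a i) := fun i =>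
    klDiv_le_of_forall_boundedContinuous fun f => by
      have : φ i f ≤ a i := le_ciSup (hbdd i) f
      simp only [φ] at this
      linarith
  refine ⟨fun i => ((hkl i).trans_lt ENNReal.ofReal_lt_top).ne, ?_⟩
  refine (Finset.sum_le_sum fun i _ => ENNReal.toReal_le_of_le_ofReal (ha0 i) (hkl i)).trans ?_
  refine le_of_forall_pos_le_add fun ε hε => ?_
  have hδ : 0 < ε / (Fintype.card ι + 1) := by positivity
  -- The test functions are chosen independently for each index, so nearly optimal ones can be used
  -- simultaneously, with total loss at most `ε`.
  have hex : ∀ i, ∃ f, a i - ε / (Fintype.card ι + 1) < φ i f := fun i =>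
    exists_lt_of_lt_ciSup (sub_lt_self _ hδ)
  choose f hf using hex
  have h3 : ∑ i, a i - Fintype.card ι * (ε / (Fintype.card ι + 1)) ≤ S := by
    refine le_trans ?_ (h f)
    calc ∑ i, a i - Fintype.card ι * (ε / (Fintype.card ι + 1))
        = ∑ i, (a i - ε / (Fintype.card ι + 1)) := by
          rw [Finset.sum_sub_distrib]; simp
      _ ≤ _ := Finset.sum_le_sum fun i _ => (hf i).le
  have h4 : Fintype.card ι * (ε / (Fintype.card ι + 1)) ≤ ε := by
    rw [mul_div_assoc', div_le_iff₀ (by positivity)]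
    nlinarith
  linarith

/-! ### Conditional entropy as cross entropy minus divergence. -/

section Entropy

variable {Ω F : Type*} [MeasurableSpace Ω] [MeasurableSpace F] {T : ℕ}

/-- A finite divergence from the product with a reference measure gives a finite conditional
entropy. -/
theorem condDiffEntropy_of_klDiv_ne_top {P : Measure Ω} [IsProbabilityMeasure P]
    {Y : Ω → Fin T → ℂ} {Z : Ω → F} (hY : Measurable Y) (hZ : Measurable Z)
    (hkl : InformationTheory.klDiv (P.map fun ω => (Z ω, Y ω))
      ((P.map Z).prod (refMeasure T)) ≠ ∞)
    (hi : Integrable (fun ω => Real.log (refDensity (Y ω))) P) :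
    HasFiniteCondDiffEntropy P Y Z ∧
      condDiffEntropy P Y Z = (∫ ω, -Real.log (refDensity (Y ω)) ∂P
        - (InformationTheory.klDiv (P.map fun ω => (Z ω, Y ω))
            ((P.map Z).prod (refMeasure T))).toReal) / Real.log 2 := by
  have hZY : Measurable fun ω => (Z ω, Y ω) := hZ.prodMk hY
  have := Measure.isProbabilityMeasure_map (μ := P) hZ.aemeasurable
  have := Measure.isProbabilityMeasure_map (μ := P) hZY.aemeasurable
  set μ := P.map fun ω => (Z ω, Y ω) with hμ
  set ν := (P.map Z).prod (refMeasure T) with hν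
  set lam := (P.map Z).prod (volume : Measure (Fin T → ℂ)) with hlam
  obtain ⟨hac, hint⟩ := InformationTheory.klDiv_ne_top_iff.1 hkl
  have hνlam : ν = lam.withDensity fun p => ENNReal.ofReal (refDensity p.2) := by
    rw [hν, refMeasure, prod_withDensity_right (by fun_prop)]
  have hν' : ν ≪ lam := hνlam ▸ withDensity_absolutelyContinuous _ _
  have hμlam : μ ≪ lam := hac.trans hν'
  have h1 := Measure.rnDeriv_mul_rnDeriv (κ := lam) hac
  have h2 : ν.rnDeriv lam =ᵐ[lam] fun p => ENNReal.ofReal (refDensity p.2) := by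
    rw [hνlam]; exact Measure.rnDeriv_withDensity _ (by fun_prop)
  -- Chain rule for densities: the density relative to Lebesgue measure is the one relative to the
  -- reference measure times the reference density.
  have hllr : llr μ lam =ᵐ[μ] fun p => llr μ ν p + Real.log (refDensity p.2) := by
    filter_upwards [hμlam.ae_le h1, hμlam.ae_le h2, Measure.rnDeriv_pos hac,
      hac.ae_le (Measure.rnDeriv_lt_top μ ν)] with p hp1 hp2 hp3 hp4
    rw [llr, ← hp1, Pi.mul_apply, hp2, ENNReal.toReal_mul,
      ENNReal.toReal_ofReal (refDensity_pos _).le, Real.log_mul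
        (ENNReal.toReal_pos hp3.ne' hp4.ne).ne' (refDensity_pos _).ne', llr]
  have hmr : Measurable fun p : F × (Fin T → ℂ) => Real.log (refDensity p.2) := by fun_prop
  have hi' : Integrable (fun p : F × (Fin T → ℂ) => Real.log (refDensity p.2)) μ :=
    (integrable_map_measure hmr.aestronglyMeasurable hZY.aemeasurable).2 hi
  refine ⟨⟨hμlam, (integrable_congr hllr).2 (hint.add hi')⟩, ?_⟩
  rw [condDiffEntropy, ← hμ, ← hlam, integral_congr_ae hllr, integral_add hint hi',
    InformationTheory.toReal_klDiv_of_measure_eq hac (by simp), integral_neg, hμ,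
    integral_map hZY.aemeasurable hmr.aestronglyMeasurable]
  ring

end Entropy

section WeakLimit

open scoped Topology

variable {X : Type*} [TopologicalSpace X] [MeasurableSpace X] [OpensMeasurableSpace X]
  {P : ℕ → ProbabilityMeasure X} {Q : ProbabilityMeasure X}

theorem tendsto_integral_of_bounded (h : Tendsto P atTop (𝓝 Q)) {g : X → ℝ} (hg : Continuous g)
    {K : ℝ} (hK : ∀ x, |g x| ≤ K) :
    Tendsto (fun k => ∫ x, g x ∂(P k : Measure X)) atTop (𝓝 (∫ x, g x ∂(Q : Measure X))) :=
  ProbabilityMeasure.tendsto_iff_forall_integral_tendsto.1 h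
    (BoundedContinuousFunction.ofNormedAddCommGroup g hg K hK)

end WeakLimit

/-! ### Tightness of the block laws. -/

namespace FadingNetwork

open scoped Topology

variable {V : Type*} [Fintype V] {T : ℕ} {N : FadingNetwork V}

theorem IsFeedbackLaw.measure_norm_gt_le {P : Measure (BlockSpace V T)} [IsProbabilityMeasure P]
    (h : N.IsFeedbackLaw P) (r : ℝ≥0∞) :
    r * P {ω | r ≤ ∑ v, ∑ t, ‖ω.1 v t‖ₑ ^ 2} ≤ Fintype.card V * T := by
  refine (mul_meas_ge_le_lintegral (by fun_prop) r).trans ?_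
  rw [lintegral_finsetSum _ fun v _ => by fun_prop]
  calc ∑ v, ∫⁻ ω, ∑ t, ‖ω.1 v t‖ₑ ^ 2 ∂P = ∑ v, ∑ t, ∫⁻ ω, ‖ω.1 v t‖ₑ ^ 2 ∂P :=
        Finset.sum_congr rfl fun v _ => lintegral_finsetSum _ fun t _ => by fun_prop
    _ ≤ ∑ _v : V, (T : ℝ≥0∞) := Finset.sum_le_sum fun v _ => h.power v
    _ = _ := by simp

/-- Prokhorov's theorem: the channel marginal is the same law for all `k`, and Markov's inequality
with the power constraint confines the sent signals to a ball uniformly in `k`. -/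
theorem exists_tendsto_of_isFeedbackLaw {P : ℕ → ProbabilityMeasure (BlockSpace V T)}
    (h : ∀ k, N.IsFeedbackLaw (P k : Measure (BlockSpace V T))) :
    ∃ (Q : ProbabilityMeasure (BlockSpace V T)) (φ : ℕ → ℕ), StrictMono φ ∧
      Tendsto (P ∘ φ) atTop (𝓝 Q) := by
  have htight : IsTightMeasureSet {ρ : Measure (BlockSpace V T) |
      ∃ μ ∈ Set.range P, (μ : Measure (BlockSpace V T)) = ρ} := by
    rw [isTightMeasureSet_iff_exists_isCompact_measure_compl_le]
    intro ε hε
    have hε2 : 0 < ε / 2 := ENNReal.half_pos hε.ne'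
    obtain ⟨K, hK, hKε⟩ := isTightMeasureSet_iff_exists_isCompact_measure_compl_le.1
      (isTightMeasureSet_singleton (μ := N.blockLaw T)) (ε / 2) hε2
    obtain ⟨r, hr⟩ : ∃ r : ℝ≥0, ∀ k, (P k : Measure (BlockSpace V T))
        {ω | (r : ℝ≥0∞) ≤ ∑ v, ∑ t, ‖ω.1 v t‖ₑ ^ 2} ≤ ε / 2 := by
      by_cases hεt : ε = ∞
      · exact ⟨0, fun k => by rw [hεt, ENNReal.top_div_of_ne_top (by simp)]; exact le_top⟩
      have hfin : (Fintype.card V * T : ℝ≥0∞) / (ε / 2) ≠ ∞ :=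
        ENNReal.div_ne_top (by finiteness) hε2.ne'
      -- The added one makes `r · (ε / 2)` strictly larger than the total power bound.
      refine ⟨((Fintype.card V * T : ℝ≥0∞) / (ε / 2)).toNNReal + 1, fun k => ?_⟩
      have h1 := (h k).measure_norm_gt_le
        ((((Fintype.card V * T : ℝ≥0∞) / (ε / 2)).toNNReal + 1 : ℝ≥0) : ℝ≥0∞)
      by_contra! h2
      have h3 : (Fintype.card V * T : ℝ≥0∞) <
          ((((Fintype.card V * T : ℝ≥0∞) / (ε / 2)).toNNReal + 1 : ℝ≥0) : ℝ≥0∞) * (ε / 2) := by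
        rw [ENNReal.coe_add, ENNReal.coe_toNNReal hfin, ENNReal.coe_one, add_mul, one_mul,
          ENNReal.div_mul_cancel hε2.ne' (ENNReal.div_ne_top hεt two_ne_zero)]
        exact ENNReal.lt_add_right (by finiteness) hε2.ne'
      exact absurd h1 (not_le.2 (h3.trans_le (by gcongr)))
    refine ⟨Metric.closedBall 0 (Real.sqrt r) ×ˢ K, (isCompact_closedBall _ _).prod hK, ?_⟩
    rintro _ ⟨_, ⟨k, rfl⟩, rfl⟩
    have hsub : (Metric.closedBall 0 (Real.sqrt r) ×ˢ K : Set (BlockSpace V T))ᶜ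
        ⊆ {ω | (r : ℝ≥0∞) ≤ ∑ v, ∑ t, ‖ω.1 v t‖ₑ ^ 2} ∪ (fun ω => ω.2) ⁻¹' Kᶜ := by
      intro ω hω
      by_cases hK' : ω.2 ∈ K
      · left
        have h1 : Real.sqrt r < ‖ω.1‖ := by
          by_contra! h2
          exact hω ⟨mem_closedBall_zero_iff.2 h2, hK'⟩
        by_contra h3
        rw [Set.mem_ofPred_eq, not_le] at h3
        refine absurd h1 (not_lt.2 ?_)
        refine (pi_norm_le_iff_of_nonneg (Real.sqrt_nonneg _)).2 fun v =>
          (pi_norm_le_iff_of_nonneg (Real.sqrt_nonneg _)).2 fun t => Real.le_sqrt_of_sq_le ?_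
        have h4 : ‖ω.1 v t‖ₑ ^ 2 ≤ (r : ℝ≥0∞) := by
          refine le_trans ?_ h3.le
          exact (Finset.single_le_sum (f := fun t => ‖ω.1 v t‖ₑ ^ 2) (fun _ _ => zero_le)
            (Finset.mem_univ t)).trans (Finset.single_le_sum
              (f := fun v => ∑ t, ‖ω.1 v t‖ₑ ^ 2) (fun _ _ => zero_le) (Finset.mem_univ v))
        rw [enorm_eq_nnnorm] at h4
        exact_mod_cast h4
      · exact Or.inr hK'
    calc (P k : Measure (BlockSpace V T)) (Metric.closedBall 0 (Real.sqrt r) ×ˢ K)ᶜ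
        ≤ (P k : Measure (BlockSpace V T)) {ω | (r : ℝ≥0∞) ≤ ∑ v, ∑ t, ‖ω.1 v t‖ₑ ^ 2}
          + (P k : Measure (BlockSpace V T)) ((fun ω => ω.2) ⁻¹' Kᶜ) :=
          (measure_mono hsub).trans (measure_union_le _ _)
      _ ≤ ε / 2 + ε / 2 := by
          refine add_le_add (hr k) ?_
          rw [← Measure.map_apply measurable_snd hK.isClosed.measurableSet.compl, (h k).map_channel]
          exact hKε _ rfl
      _ = ε := ENNReal.add_halves ε
  obtain ⟨Q, -, φ, hφ, hlim⟩ := (isCompact_closure_of_isTightMeasureSet htight).tendsto_subseq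
    (x := P) fun k => subset_closure ⟨k, rfl⟩
  exact ⟨Q, φ, hφ, hlim⟩

end FadingNetwork

open scoped Topology

namespace FadingNetwork

variable {V : Type*} [Fintype V] {T : ℕ} {N : FadingNetwork V}

theorem IsFeedbackLaw.lintegral_log_sq_le {P : Measure (BlockSpace V T)} [IsProbabilityMeasure P]
    (h : N.IsFeedbackLaw P) (v : V) :
    ∫⁻ ω, ENNReal.ofReal (Real.log (1 + ‖BlockSpace.recv N v ω‖) ^ 2) ∂P
      ≤ ENNReal.ofReal (N.recvMoment T v).toReal := by
  rw [ENNReal.ofReal_toReal (N.recvMoment_lt_top v).ne]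
  exact (lintegral_mono fun ω => ENNReal.ofReal_le_ofReal (log_one_add_norm_sq_le _)).trans
    (h.lintegral_recv_sq_le v)

theorem continuous_log_one_add_norm_recv (v : V) :
    Continuous fun ω : BlockSpace V T => Real.log (1 + ‖BlockSpace.recv N v ω‖) :=
  (by fun_prop : Continuous fun ω : BlockSpace V T => 1 + ‖BlockSpace.recv N v ω‖).log
    fun ω => by positivity

theorem IsFeedbackLaw.integrable_log_one_add_norm {P : Measure (BlockSpace V T)}
    [IsProbabilityMeasure P] (h : N.IsFeedbackLaw P) (v : V) :
    Integrable (fun ω => Real.log (1 + ‖BlockSpace.recv N v ω‖)) P :=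
  (abs_integral_sub_integral_min_le (continuous_log_one_add_norm_recv v)
    (fun ω => Real.log_nonneg (by linarith [norm_nonneg (BlockSpace.recv N v ω)]))
    ENNReal.toReal_nonneg (h.lintegral_log_sq_le v) one_pos).1

theorem IsFeedbackLaw.integrable_log_refDensity {P : Measure (BlockSpace V T)}
    [IsProbabilityMeasure P] (h : N.IsFeedbackLaw P) (v : V) :
    Integrable (fun ω => Real.log (refDensity (BlockSpace.recv N v ω))) P := by
  have h1 : Integrable (fun ω => -Real.log (refDensity (BlockSpace.recv N v ω))) P := by
    simp_rw [neg_log_refDensity]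
    exact (integrable_const _).add ((h.integrable_log_one_add_norm v).const_mul _)
  exact h1.neg.congr (Eventually.of_forall fun ω => by simp)

/-- Weak convergence together with a uniform bound on the second moment of `log (1 + ‖Y‖)`, which
follows from the one for the received signal. -/
theorem tendsto_integral_neg_log_refDensity {P : ℕ → ProbabilityMeasure (BlockSpace V T)}
    {Q : ProbabilityMeasure (BlockSpace V T)} (hlim : Tendsto P atTop (𝓝 Q))
    (h : ∀ k, N.IsFeedbackLaw (P k : Measure (BlockSpace V T))) (v : V) :
    Tendsto (fun k => ∫ ω, -Real.log (refDensity (BlockSpace.recv N v ω)) ∂(P k : Measure (BlockSpace V T))) atTop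
      (𝓝 (∫ ω, -Real.log (refDensity (BlockSpace.recv N v ω)) ∂(Q : Measure (BlockSpace V T)))) := by
  have hQ := IsFeedbackLaw.of_tendsto N hlim h
  have h1 := (tendsto_integral_of_tendsto_of_sq_le hlim (continuous_log_one_add_norm_recv v)
    (fun ω => Real.log_nonneg (by linarith [norm_nonneg (BlockSpace.recv N v ω)]))
    ENNReal.toReal_nonneg fun k => (h k).lintegral_log_sq_le v).2
  have h2 : ∀ ρ : ProbabilityMeasure (BlockSpace V T), N.IsFeedbackLaw (ρ : Measure (BlockSpace V T)) →
      ∫ ω, -Real.log (refDensity (BlockSpace.recv N v ω)) ∂(ρ : Measure (BlockSpace V T))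
      = Real.log (∫ y : Fin T → ℂ, (1 + ‖y‖) ^ (-refExponent T)) + refExponent T *
        ∫ ω, Real.log (1 + ‖BlockSpace.recv N v ω‖) ∂(ρ : Measure (BlockSpace V T)) := by
    intro ρ hρ
    simp_rw [neg_log_refDensity]
    rw [integral_add (integrable_const _) ((hρ.integrable_log_one_add_norm v).const_mul _),
      integral_const_mul]
    simp
  rw [h2 Q hQ]
  simp_rw [fun k => h2 (P k) (h k)]
  exact (h1.const_mul _).const_add _

end FadingNetwork

/-! ### The cut bound for tilted kernels and its weak limit. -/

section Cut

variable {V : Type*} [Fintype V] {s d : V} {T : ℕ} {N : FadingNetwork V} {L : ℕ} {σ : Fin L → V}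
  {K : Fin L → Type*} [∀ i, TopologicalSpace (K i)] [∀ i, FirstCountableTopology (K i)]
  {ζ : ∀ i, (V → Fin T → ℂ) × (V → Fin T → ℂ) → K i}

/-- The observation of the signals of a block through `ζ`. -/
noncomputable def blockObs {K : Type*} (N : FadingNetwork V)
    (ζ : (V → Fin T → ℂ) × (V → Fin T → ℂ) → K) (ω : BlockSpace V T) : K :=
  ζ (ω.1, fun u => BlockSpace.recv N u ω)

theorem continuous_blockObs {K : Type*} [TopologicalSpace K]
    {ζ : (V → Fin T → ℂ) × (V → Fin T → ℂ) → K} (hζ : Continuous ζ) :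
    Continuous (blockObs N ζ) :=
  hζ.comp (continuous_fst.prodMk (continuous_pi fun u => N.continuous_recv u))

/-- The kernels are `exp f` times the reference density, normalized given the observation `ζ i`.
They are causal along `σ` because `ζ i` sees only the signals of nodes with smaller number. -/
theorem NetworkCode.converse_boundedContinuous {n : ℕ} (C : NetworkCode V s T n) (hn : 0 < n)
    (hC : C.PowerConstraint N) (hσ : Function.Injective σ) (hs : ∀ i, σ i ≠ s)
    (hd : ∃ i, σ i = d) (hζ : ∀ i, Continuous (ζ i))
    (hζd : ∀ i x x' y y', (∀ a < i, x (σ a) = x' (σ a) ∧ y (σ a) = y' (σ a)) →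
      ζ i (x, y) = ζ i (x', y'))
    (f : ∀ i, BoundedContinuousFunction (K i × (Fin T → ℂ)) ℝ) :
    (1 - C.errorProb N d) * Real.log C.M - Real.log 2
      ≤ n * ∑ i, (-(∫ ω, f i (blockObs N (ζ i) ω, BlockSpace.recv N (σ i) ω) ∂C.avgLaw N)
          + ∫ ω, -Real.log (refDensity (BlockSpace.recv N (σ i) ω)) ∂C.avgLaw N
          + ∫ ω, Real.log (partitionFn (f i) (blockObs N (ζ i) ω)) ∂C.avgLaw N
          - ∫ ω, N.outInfo (σ i) ω ∂C.avgLaw N) := by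
  classical
  have := C.isProbabilityMeasure_avgLaw N hn
  have hfb := C.isFeedbackLaw_avgLaw N hn hC
  let κ₀ : Fin L → (V → Fin T → ℂ) → (V → Fin T → ℂ) → ℝ := fun i x y =>
    Real.exp (f i (ζ i (x, y), y (σ i))) * refDensity (y (σ i)) / partitionFn (f i) (ζ i (x, y))
  -- The values off the range of `σ` play no role, since the destination side of the cut is that
  -- range.
  let κ : V → (V → Fin T → ℂ) → (V → Fin T → ℂ) → ℝ := Function.extend σ κ₀ fun _ _ _ => 1
  let ρ : V → ℕ := Function.extend σ (fun i => (i : ℕ)) fun _ => 0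
  have hκ : ∀ i, κ (σ i) = κ₀ i := fun i => hσ.extend_apply _ _ i
  have hρ : ∀ i, ρ (σ i) = i := fun i => hσ.extend_apply _ _ i
  have hlow : ∀ i a, a < i → σ a ∈ Finset.univ.map ⟨σ, hσ⟩ ∧ ρ (σ a) < ρ (σ i) := by
    intro i a ha
    exact ⟨by simp, by rw [hρ, hρ]; exact ha⟩
  have hcont : ∀ i, Continuous fun ω : BlockSpace V T => blockObs N (ζ i) ω := fun i =>
    continuous_blockObs (hζ i)
  have hlog : ∀ i (ω : BlockSpace V T),
      Real.log (κ (σ i) ω.1 fun u => BlockSpace.recv N u ω)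
      = f i (blockObs N (ζ i) ω, BlockSpace.recv N (σ i) ω)
        + Real.log (refDensity (BlockSpace.recv N (σ i) ω))
        - Real.log (partitionFn (f i) (blockObs N (ζ i) ω)) := by
    intro i ω
    rw [hκ]
    simp only [κ₀]
    rw [Real.log_div (mul_pos (Real.exp_pos _) (refDensity_pos _)).ne' (partitionFn_pos _ _).ne',
      Real.log_mul (Real.exp_pos _).ne' (refDensity_pos _).ne', Real.log_exp]
    rfl
  have hi1 : ∀ i, Integrable (fun ω : BlockSpace V T =>
      f i (blockObs N (ζ i) ω, BlockSpace.recv N (σ i) ω)) (C.avgLaw N) := fun i =>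
    Integrable.of_bound ((f i).continuous.comp ((hcont i).prodMk
      (N.continuous_recv (σ i)))).aestronglyMeasurable ‖f i‖
      (Eventually.of_forall fun ω => (f i).norm_coe_le_norm _)
  have hi2 := fun i => hfb.integrable_log_refDensity (σ i)
  have hi3 : ∀ i, Integrable (fun ω : BlockSpace V T =>
      Real.log (partitionFn (f i) (blockObs N (ζ i) ω))) (C.avgLaw N) := fun i =>
    Integrable.of_bound (((continuous_partitionFn (f i)).comp (hcont i)).log fun ω =>
      (partitionFn_pos _ _).ne').aestronglyMeasurable ‖f i‖
      (Eventually.of_forall fun ω => abs_log_partitionFn_le _ _)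
  have hi12 : ∀ i, Integrable (fun ω : BlockSpace V T =>
      f i (blockObs N (ζ i) ω, BlockSpace.recv N (σ i) ω)
        + Real.log (refDensity (BlockSpace.recv N (σ i) ω))) (C.avgLaw N) := fun i =>
    (hi1 i).add (hi2 i)
  have key := C.converse (N := N) (D := Finset.univ.map ⟨σ, hσ⟩) (κ := κ) (d := d)
    (by simpa using hs) (by simpa using hd) ρ hn hC ?_ ?_ ?_ ?_ ?_
  · rw [Finset.sum_map] at key
    refine key.trans (le_of_eq ?_)
    congr 1
    refine Finset.sum_congr rfl fun i _ => ?_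
    simp only [Function.Embedding.coeFn_mk, hlog, integral_neg]
    rw [integral_sub (hi12 i) (hi3 i), integral_add (hi1 i) (hi2 i)]
    ring
  all_goals
    intro v hv
    obtain ⟨i, rfl⟩ : ∃ i, σ i = v := by simpa using hv
  · rw [hκ]
    have h1 : Continuous fun p : (V → Fin T → ℂ) × (V → Fin T → ℂ) => κ₀ i p.1 p.2 := by
      refine Continuous.div ?_ ((continuous_partitionFn (f i)).comp (hζ i)) fun p =>
        (partitionFn_pos _ _).ne'
      refine Continuous.mul (Real.continuous_exp.comp ((f i).continuous.comp
        ((hζ i).prodMk (by fun_prop)))) (continuous_refDensity.comp (by fun_prop))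
    exact h1.measurable
  · intro x y
    rw [hκ]
    exact div_pos (mul_pos (Real.exp_pos _) (refDensity_pos _)) (partitionFn_pos _ _)
  · intro x x' y y' hy hu
    rw [hκ]
    simp only [κ₀]
    rw [hζd i x x' y y' fun a ha => hu _ (hlow i a ha).1 (hlow i a ha).2, hy]
  · intro x y
    rw [hκ]
    refine le_of_eq (Eq.trans (lintegral_congr fun a => ?_)
      (lintegral_exp_mul_refDensity_div (f i) (ζ i (x, y))))
    simp only [κ₀]
    rw [hζd i x x (@Function.update _ _ (Classical.decEq V) y (σ i) a) y fun b hb =>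
      ⟨rfl, Function.update_of_ne (fun h => hb.ne (hσ h)) _ _⟩, Function.update_self]
  · simp_rw [hlog]
    exact (hi12 i).sub (hi3 i)

end Cut

/-- Jensen's inequality for the normalization of a conditional density. -/
theorem integral_log_partitionFn_le {Ω Z : Type*} [MeasurableSpace Ω] {T : ℕ} [TopologicalSpace Z]
    [TopologicalSpace.PseudoMetrizableSpace Z] [SecondCountableTopology Z] [MeasurableSpace Z]
    [BorelSpace Z] {P : Measure Ω} [IsProbabilityMeasure P] {ζ : Ω → Z} (hζ : Measurable ζ)
    (f : BoundedContinuousFunction (Z × (Fin T → ℂ)) ℝ) :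
    ∫ ω, Real.log (partitionFn f (ζ ω)) ∂P
      ≤ Real.log (∫ p, Real.exp (f p) ∂((P.map ζ).prod (refMeasure T))) := by
  have := Measure.isProbabilityMeasure_map (μ := P) hζ.aemeasurable
  have hm : Measurable fun ω => partitionFn f (ζ ω) := (continuous_partitionFn f).measurable.comp hζ
  have h1 : Integrable (fun ω => partitionFn f (ζ ω)) P :=
    Integrable.of_bound hm.aestronglyMeasurable (Real.exp ‖f‖) (Eventually.of_forall fun ω => by
      rw [Real.norm_eq_abs, abs_of_pos (partitionFn_pos _ _)]
      exact (partitionFn_mem f _).2)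
  have h2 : Integrable (fun ω => Real.log (partitionFn f (ζ ω))) P :=
    Integrable.of_bound hm.log.aestronglyMeasurable ‖f‖
      (Eventually.of_forall fun ω => abs_log_partitionFn_le f _)
  refine (integral_log_le_log_integral (fun ω => partitionFn_pos f _) h1 h2).trans (le_of_eq ?_)
  have h3 : Integrable (fun p => Real.exp (f p)) ((P.map ζ).prod (refMeasure T)) :=
    Integrable.of_bound (Real.continuous_exp.comp f.continuous).aestronglyMeasurable
      (Real.exp ‖f‖) (Eventually.of_forall fun p => by
        rw [Real.norm_eq_abs, abs_of_pos (Real.exp_pos _)]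
        exact Real.exp_le_exp.2 ((le_abs_self _).trans (f.norm_coe_le_norm _)))
  rw [integral_prod _ h3, ← integral_map (f := partitionFn f) hζ.aemeasurable
    (continuous_partitionFn f).measurable.aestronglyMeasurable]
  rfl

section Limit

variable {V : Type*} [Fintype V] {s d : V} {T : ℕ} {N : FadingNetwork V} {L : ℕ} {σ : Fin L → V}
  {K : Fin L → Type*} [∀ i, TopologicalSpace (K i)]
  [∀ i, TopologicalSpace.PseudoMetrizableSpace (K i)] [∀ i, SecondCountableTopology (K i)]
  [∀ i, MeasurableSpace (K i)] [∀ i, BorelSpace (K i)]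
  {ζ : ∀ i, (V → Fin T → ℂ) × (V → Fin T → ℂ) → K i}
  {n : ℕ → ℕ} {C : ∀ k, NetworkCode V s T (n k)} {ε : ℕ → ℝ} {R : ℝ}
  {P : ℕ → ProbabilityMeasure (BlockSpace V T)} {Q : ProbabilityMeasure (BlockSpace V T)}

/-- After division by `n k` the term `log 2` disappears. All terms converge except the integrals of
`outInfo`, which are bounded above by a convergent sequence; lower semicontinuity carries this upper
bound to the limit law. -/
theorem NetworkCode.converse_limit (hn : ∀ k, k < n k) (hC : ∀ k, (C k).PowerConstraint N)
    (hM : ∀ k, (2 : ℝ) ^ ((n k : ℝ) * T * R) ≤ (C k).M) (herr : ∀ k, (C k).errorProb N d ≤ ε k)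
    (hε1 : ∀ k, ε k ≤ 1) (hε : Tendsto ε atTop (𝓝 0))
    (hP : ∀ k, (P k : Measure (BlockSpace V T)) = (C k).avgLaw N) (hlim : Tendsto P atTop (𝓝 Q))
    (hσ : Function.Injective σ) (hs : ∀ i, σ i ≠ s) (hd : ∃ i, σ i = d)
    (hζ : ∀ i, Continuous (ζ i))
    (hζd : ∀ i x x' y y', (∀ a < i, x (σ a) = x' (σ a) ∧ y (σ a) = y' (σ a)) →
      ζ i (x, y) = ζ i (x', y'))
    (f : ∀ i, BoundedContinuousFunction (K i × (Fin T → ℂ)) ℝ) :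
    ∑ i, (∫ ω, f i (blockObs N (ζ i) ω, BlockSpace.recv N (σ i) ω) ∂(Q : Measure (BlockSpace V T))
        - ∫ ω, Real.log (partitionFn (f i) (blockObs N (ζ i) ω)) ∂(Q : Measure (BlockSpace V T)))
      ≤ ∑ i, (∫ ω, -Real.log (refDensity (BlockSpace.recv N (σ i) ω))
            ∂(Q : Measure (BlockSpace V T))
          - ∫ ω, N.outInfo (σ i) ω ∂(Q : Measure (BlockSpace V T)))
        - T * R * Real.log 2 := by
  have hn0 : ∀ k, 0 < n k := fun k => (Nat.zero_le k).trans_lt (hn k)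
  have hfb : ∀ k, N.IsFeedbackLaw (P k : Measure (BlockSpace V T)) := fun k => by
    rw [hP k]; exact (C k).isFeedbackLaw_avgLaw N (hn0 k) (hC k)
  have hQ := FadingNetwork.IsFeedbackLaw.of_tendsto N hlim hfb
  let A : ℕ → Fin L → ℝ := fun k i =>
    -(∫ ω, f i (blockObs N (ζ i) ω, BlockSpace.recv N (σ i) ω) ∂(P k : Measure (BlockSpace V T)))
      + ∫ ω, -Real.log (refDensity (BlockSpace.recv N (σ i) ω)) ∂(P k : Measure (BlockSpace V T))
      + ∫ ω, Real.log (partitionFn (f i) (blockObs N (ζ i) ω)) ∂(P k : Measure (BlockSpace V T))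
  let B : Fin L → ℝ := fun i =>
    -(∫ ω, f i (blockObs N (ζ i) ω, BlockSpace.recv N (σ i) ω) ∂(Q : Measure (BlockSpace V T)))
      + ∫ ω, -Real.log (refDensity (BlockSpace.recv N (σ i) ω)) ∂(Q : Measure (BlockSpace V T))
      + ∫ ω, Real.log (partitionFn (f i) (blockObs N (ζ i) ω)) ∂(Q : Measure (BlockSpace V T))
  have hA : ∀ i, Tendsto (fun k => A k i) atTop (𝓝 (B i)) := by
    intro i
    have hc := continuous_blockObs (N := N) (hζ i)
    refine ((Tendsto.neg ?_).add
      (FadingNetwork.tendsto_integral_neg_log_refDensity hlim hfb (σ i))).add ?_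
    · exact tendsto_integral_of_bounded hlim
        ((f i).continuous.comp (hc.prodMk (N.continuous_recv (σ i))))
        fun ω => (f i).norm_coe_le_norm _
    · exact tendsto_integral_of_bounded hlim
        (((continuous_partitionFn (f i)).comp hc).log fun ω => (partitionFn_pos _ _).ne')
        fun ω => abs_log_partitionFn_le _ _
  have hlog2 : 0 < Real.log 2 := Real.log_pos one_lt_two
  have hbound : ∀ k, ∑ i, ∫ ω, N.outInfo (σ i) ω ∂(P k : Measure (BlockSpace V T))
      ≤ ∑ i, A k i - (1 - ε k) * (T * R * Real.log 2) + Real.log 2 / n k := by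
    intro k
    have hnk : (0 : ℝ) < n k := Nat.cast_pos.2 (hn0 k)
    have h1 := (C k).converse_boundedContinuous (hn0 k) (hC k) hσ hs hd hζ hζd f
    rw [← hP k, Finset.sum_sub_distrib] at h1
    have hM1 : (1 : ℝ) ≤ (C k).M := Nat.one_le_cast.2 (C k).M_pos
    have h2 : n k * (T * R * Real.log 2) ≤ Real.log (C k).M := by
      have := Real.log_le_log (by positivity) (hM k)
      rw [Real.log_rpow two_pos] at this
      linarith
    have h3 : (1 - ε k) * (n k * (T * R * Real.log 2))
        ≤ (1 - (C k).errorProb N d) * Real.log (C k).M :=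
      (mul_le_mul_of_nonneg_left h2 (by linarith [hε1 k])).trans
        (mul_le_mul_of_nonneg_right (by linarith [herr k]) (Real.log_nonneg hM1))
    have h4 : n k * (Real.log 2 / n k) = Real.log 2 := mul_div_cancel₀ _ hnk.ne'
    refine le_of_mul_le_mul_left ?_ hnk
    simp only [A]
    linarith
  have hone : Tendsto (fun k => Real.log 2 / n k) atTop (𝓝 0) :=
    tendsto_const_nhds.div_atTop (tendsto_natCast_atTop_atTop.comp
      (tendsto_atTop_mono (fun k => (hn k).le) tendsto_id))
  have hrhs : Tendsto (fun k => ∑ i, A k i - (1 - ε k) * (T * R * Real.log 2) + Real.log 2 / n k)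
      atTop (𝓝 (∑ i, B i - (1 - 0) * (T * R * Real.log 2) + 0)) :=
    ((tendsto_finsetSum _ fun i _ => hA i).sub
      ((tendsto_const_nhds.sub hε).mul_const _)).add hone
  have hlsc := (integrable_and_integral_le_of_tendsto hlim
    (f := fun ω => ∑ i, N.outInfo (σ i) ω)
    (continuous_finsetSum _ fun i _ => N.continuous_outInfo (σ i))
    (fun ω => Finset.sum_nonneg fun i _ => N.outInfo_nonneg (σ i) ω)
    (fun k => integrable_finsetSum _ fun i _ => (hfb k).integrable_outInfo (σ i))
    (fun k => (integral_finsetSum _ fun i _ => (hfb k).integrable_outInfo (σ i)).trans_le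
      (hbound k)) hrhs).2
  rw [integral_finsetSum _ fun i _ => hQ.integrable_outInfo (σ i)] at hlsc
  simp only [B, Finset.sum_add_distrib, Finset.sum_neg_distrib] at hlsc
  simp only [Finset.sum_sub_distrib]
  linarith

/-- The cut bound for a weak limit of the average block laws of a sequence of codes. -/
theorem NetworkCode.cut_bound (hn : ∀ k, k < n k) (hC : ∀ k, (C k).PowerConstraint N)
    (hM : ∀ k, (2 : ℝ) ^ ((n k : ℝ) * T * R) ≤ (C k).M) (herr : ∀ k, (C k).errorProb N d ≤ ε k)
    (hε1 : ∀ k, ε k ≤ 1) (hε : Tendsto ε atTop (𝓝 0))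
    (hP : ∀ k, (P k : Measure (BlockSpace V T)) = (C k).avgLaw N) (hlim : Tendsto P atTop (𝓝 Q))
    (hσ : Function.Injective σ) (hs : ∀ i, σ i ≠ s) (hd : ∃ i, σ i = d)
    (hζ : ∀ i, Continuous (ζ i))
    (hζd : ∀ i x x' y y', (∀ a < i, x (σ a) = x' (σ a) ∧ y (σ a) = y' (σ a)) →
      ζ i (x, y) = ζ i (x', y')) :
    (∀ i, HasFiniteCondDiffEntropy (Q : Measure (BlockSpace V T)) (BlockSpace.recv N (σ i))
        (blockObs N (ζ i))) ∧
      T * R ≤ ∑ i, (condDiffEntropy (Q : Measure (BlockSpace V T)) (BlockSpace.recv N (σ i))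
          (blockObs N (ζ i))
        - condDiffEntropy (Q : Measure (BlockSpace V T)) (BlockSpace.recv N (σ i))
          (BlockSpace.Xin N (σ i))) := by
  have hfb : ∀ k, N.IsFeedbackLaw (P k : Measure (BlockSpace V T)) := fun k => by
    rw [hP k]; exact (C k).isFeedbackLaw_avgLaw N ((Nat.zero_le k).trans_lt (hn k)) (hC k)
  have hQ := FadingNetwork.IsFeedbackLaw.of_tendsto N hlim hfb
  have hZ : ∀ i, Measurable (blockObs N (ζ i)) := fun i => (continuous_blockObs (hζ i)).measurable
  have hY := fun i => N.measurable_recv (T := T) (σ i)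
  have hZY := fun i => (hZ i).prodMk (hY i)
  have := fun i => Measure.isProbabilityMeasure_map (μ := (Q : Measure (BlockSpace V T)))
    (hZ i).aemeasurable
  have := fun i => Measure.isProbabilityMeasure_map (μ := (Q : Measure (BlockSpace V T)))
    (hZY i).aemeasurable
  -- The supremum over the test functions is taken only now, at the limit law. Jensen's inequality
  -- replaces the mean of the log normalization by the log integral of the Donsker-Varadhan bound,
  -- which preserves the direction of the inequality.
  obtain ⟨hkl, hsum⟩ := klDiv_ne_top_and_sum_le (X := fun i => K i × (Fin T → ℂ))
    (μ := fun i => (Q : Measure (BlockSpace V T)).map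
      fun ω => (blockObs N (ζ i) ω, BlockSpace.recv N (σ i) ω))
    (ν := fun i => ((Q : Measure (BlockSpace V T)).map (blockObs N (ζ i))).prod (refMeasure T))
    (fun f => le_trans (Finset.sum_le_sum fun i _ => by
      rw [integral_map (hZY i).aemeasurable (f i).continuous.aestronglyMeasurable]
      exact sub_le_sub_left (integral_log_partitionFn_le (hZ i) (f i)) _)
      (NetworkCode.converse_limit hn hC hM herr hε1 hε hP hlim hσ hs hd hζ hζd f))
  have hent := fun i => condDiffEntropy_of_klDiv_ne_top (hY i) (hZ i) (hkl i)
    (hQ.integrable_log_refDensity (σ i))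
  refine ⟨fun i => (hent i).1, ?_⟩
  have hlog2 : 0 < Real.log 2 := Real.log_pos one_lt_two
  simp_rw [fun i => (hent i).2, fun i => hQ.condDiffEntropy_Xin (σ i), ← sub_div]
  rw [← Finset.sum_div, le_div_iff₀ hlog2]
  simp only [Finset.sum_sub_distrib] at hsum ⊢
  linarith

end Limit

/-- The codes of an achievable rate, along a sequence for which the average block laws converge. -/
theorem FadingNetwork.Achievable.exists_codes {V : Type*} [Fintype V] {N : FadingNetwork V}
    {s d : V} {T : ℕ} {R : ℝ} (h : N.Achievable s d T R) :
    ∃ (n : ℕ → ℕ) (C : ∀ k, NetworkCode V s T (n k)) (ε : ℕ → ℝ)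
      (P : ℕ → ProbabilityMeasure (BlockSpace V T)) (Q : ProbabilityMeasure (BlockSpace V T)),
      (∀ k, k < n k) ∧ (∀ k, (C k).PowerConstraint N) ∧
      (∀ k, (2 : ℝ) ^ ((n k : ℝ) * T * R) ≤ (C k).M) ∧ (∀ k, (C k).errorProb N d ≤ ε k) ∧
      (∀ k, ε k ≤ 1) ∧ Tendsto ε atTop (𝓝 0) ∧
      (∀ k, (P k : Measure (BlockSpace V T)) = (C k).avgLaw N) ∧ Tendsto P atTop (𝓝 Q) := by
  have h1 : ∀ k : ℕ, ∃ n, k < n ∧ ∃ C : NetworkCode V s T n,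
      (2 : ℝ) ^ ((n : ℝ) * T * R) ≤ C.M ∧ C.PowerConstraint N ∧
        C.errorProb N d ≤ 1 / ((k : ℝ) + 1) := fun k =>
    ((eventually_gt_atTop k).and (h _ (by positivity))).exists
  choose n hn C hM hC herr using h1
  have hn0 : ∀ k, 0 < n k := fun k => (Nat.zero_le k).trans_lt (hn k)
  let P : ℕ → ProbabilityMeasure (BlockSpace V T) := fun k =>
    ⟨(C k).avgLaw N, (C k).isProbabilityMeasure_avgLaw N (hn0 k)⟩
  obtain ⟨Q, φ, hφ, hlim⟩ := exists_tendsto_of_isFeedbackLaw (N := N) (P := P) fun k =>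
    (C k).isFeedbackLaw_avgLaw N (hn0 k) (hC k)
  refine ⟨fun k => n (φ k), fun k => C (φ k), fun k => 1 / ((φ k : ℝ) + 1), P ∘ φ, Q,
    fun k => (hφ.id_le k).trans_lt (hn _), fun k => hC _, fun k => hM _, fun k => herr _,
    fun k => ?_, tendsto_one_div_add_atTop_nhds_zero_nat.comp hφ.tendsto_atTop, fun k => rfl, hlim⟩
  rw [div_le_one (by positivity)]
  linarith [Nat.cast_nonneg (α := ℝ) (φ k)]

theorem mainTheorem12 {V : Type*} [Fintype V] (N : FadingNetwork V) (s d : V) (T : ℕ)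
    (hT : 0 < T) (R : ℝ) (hR : N.Achievable s d T R) :
    ∃ P : ProbabilityMeasure (BlockSpace V T),
      IsBlockInputLaw N (P : Measure (BlockSpace V T)) ∧
      ∀ Ω : Set V, s ∈ Ω → d ∉ Ω →
      ∀ (L : ℕ) (σ : Fin L → V), Function.Injective σ → Set.range σ = Ωᶜ →
        (∀ a b, N.graph.Adj (σ a) (σ b) → a < b) →
        (∀ i,
          HasFiniteCondDiffEntropy (P : Measure (BlockSpace V T))
            (BlockSpace.recv N (σ i)) (BlockSpace.prevYInX N Ω σ i) ∧
          HasFiniteCondDiffEntropy (P : Measure (BlockSpace V T))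
            (BlockSpace.recv N (σ i)) (BlockSpace.prevYPrevX N σ i) ∧
          HasFiniteCondDiffEntropy (P : Measure (BlockSpace V T))
            (BlockSpace.recv N (σ i)) (BlockSpace.Xin N (σ i))) ∧
        T * R ≤ ∑ i,
          (condDiffEntropy (P : Measure (BlockSpace V T))
              (BlockSpace.recv N (σ i)) (BlockSpace.prevYInX N Ω σ i)
            - condDiffEntropy (P : Measure (BlockSpace V T))
              (BlockSpace.recv N (σ i)) (BlockSpace.Xin N (σ i))) ∧
        T * R ≤ ∑ i,
          (condDiffEntropy (P : Measure (BlockSpace V T))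
              (BlockSpace.recv N (σ i)) (BlockSpace.prevYPrevX N σ i)
            - condDiffEntropy (P : Measure (BlockSpace V T))
              (BlockSpace.recv N (σ i)) (BlockSpace.Xin N (σ i))) := by
  -- The limit law is fixed here, before any cut or enumeration is given.
  obtain ⟨n, C, ε, P, Q, hn, hC, hM, herr, hε1, hε, hP, hlim⟩ := hR.exists_codes
  have hfb : ∀ k, N.IsFeedbackLaw (P k : Measure (BlockSpace V T)) := fun k => by
    rw [hP k]; exact (C k).isFeedbackLaw_avgLaw N ((Nat.zero_le k).trans_lt (hn k)) (hC k)
  have hQ := FadingNetwork.IsFeedbackLaw.of_tendsto N hlim hfb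
  refine ⟨Q, hQ.isBlockInputLaw, fun Ω hs hd L σ hσ hrange hadj => ?_⟩
  have hs' : ∀ i, σ i ≠ s := fun i hi => by
    have : σ i ∈ Ωᶜ := hrange ▸ Set.mem_range_self i
    exact this (hi ▸ hs)
  have hd' : ∃ i, σ i = d := by
    have : d ∈ Set.range σ := hrange ▸ hd
    exact this
  have hIn := NetworkCode.cut_bound hn hC hM herr hε1 hε hP hlim hσ hs' hd'
    (ζ := fun i p => ((fun v => p.2 v, fun v => p.1 v) :
      ((σ '' Set.Iio i : Set V) → Fin T → ℂ) ×
        (({j | N.graph.Adj j (σ i)} ∩ Ωᶜ : Set V) → Fin T → ℂ)))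
    (fun i => by fun_prop) (by
      intro i x x' y y' hxy
      refine Prod.ext (funext ?_) (funext ?_)
      · rintro ⟨_, a, ha, rfl⟩
        exact (hxy a ha).2
      -- A sender in `Ωᶜ` with a link to `σ i` has a smaller number, so its signal is an admissible
      -- part of the observation.
      · rintro ⟨v, hv, hvΩ⟩
        obtain ⟨a, rfl⟩ : v ∈ Set.range σ := hrange ▸ hvΩ
        exact (hxy a (hadj a i hv)).1)
  have hPrev := NetworkCode.cut_bound hn hC hM herr hε1 hε hP hlim hσ hs' hd'
    (ζ := fun i p => ((fun v => p.2 v, fun v => p.1 v) :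
      ((σ '' Set.Iio i : Set V) → Fin T → ℂ) × ((σ '' Set.Iio i : Set V) → Fin T → ℂ)))
    (fun i => by fun_prop) (by
      intro i x x' y y' hxy
      refine Prod.ext (funext ?_) (funext ?_) <;> rintro ⟨_, a, ha, rfl⟩
      exacts [(hxy a ha).2, (hxy a ha).1])
  exact ⟨fun i => ⟨hIn.1 i, hPrev.1 i, hQ.hasFiniteCondDiffEntropy_Xin (σ i)⟩, hIn.2, hPrev.2⟩
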